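/- Let $I=(0,1)$, $1<\alpha<2$, $0\le r\le 1$, and let $\alpha-1\le\beta\le 1$ satisfy $r=\dfrac{\sin(\pi\beta)}{\sin(\pi(\alpha-\beta))+\sin(\pi\beta)}$. Let $\rho^{(a,b)}(x)=(1-x)^a x^b$ and $$\mathcal L_r^\alpha u=-\bigl(rD^\alpha u+(1-r)D^{\alpha*}u\bigr),\quad D^\alpha u(x)=D\,\frac1{\Gamma(2-\alpha)}\int_0^x\frac{Du(t)}{(x-t)^{\alpha-1}}\,dt,\quad D^{\alpha*}u(x)=D\,\frac1{\Gamma(2-\alpha)}\int_x^1\frac{Du(t)}{(t-x)^{\alpha-1}}\,dt .$$ For $a,b>-1$ let $\tilde G_j^{(a,b)}$ be the Jacobi polynomials $P_j^{(a,b)}(2x-1)$ normalised in $L^2_{\rho^{(a,b)}}(I)$. For $s\ge0$ let $H^s_{(a,b)}(I)$ be the space of all $v\in L^2_{\rho^{(a,b)}}(I)$ with $\|v\|_{s,(a,b)}^2=\sum_j(1+j^2)^s v_j^2<\infty$, where $v_j=\int_0^1\rho^{(a,b)}v\,\tilde G^{(a,b)}_j\,dx$; for $s<0$ let $H^s_{(a,b)}(I)$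 be the space of bounded linear functionals on $H^{-s}_{(a,b)}(I)$, with the dual norm, the duality $\langle\cdot,\cdot\rangle_{\rho^{(a,b)}}$ extending the inner product of $L^2_{\rho^{(a,b)}}(I)$. For $\phi\in H^{s+\alpha}_{(\alpha-\beta,\beta)}(I)$ and $f\in H^s_{(\beta,\alpha-\beta)}(I)$ the equation $\mathcal L_r^\alpha(\rho^{(\alpha-\beta,\beta)}\phi)=f$ is understood by transposition: $$\langle f,g\rangle_{\rho^{(\beta,\alpha-\beta)}}=\bigl\langle \phi,\ \mathcal L_{1-r}^\alpha(\rho^{(\beta,\alpha-\beta)}g)\bigr\rangle_{\rho^{(\alpha-\beta,\beta)}}$$ for all $g\in C_c^\infty(I)$ and all polynomials $g$, where $\mathcal L_{1-r}^\alpha$ is evaluated pointwise (both pairings being defined). Then for every $s\in\mathbb R$: (1) There is a bijective linear map $T:H^{s+\alpha}_{(\alpha-\beta,\beta)}(I)\to H^s_{(\beta,\alpha-\beta)}(I)$, continuous and with continuous inverse, such that $T\phi=f$ if and only if $\mathcal L_r^\alpha(\rho^{(\alpha-\beta,\beta)}\phi)=f$; that is, $\phi\mapsto\mathcal L_r^\alpha(\rho^{(\alpha-\beta,\beta)}\phi)$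 is well defined, bijective, continuous and has a continuous inverse. (2) There is a constant $C$ such that for every $f\in H^s_{(\beta,\alpha-\beta)}(I)$ there is a unique $\phi\in H^{s+\alpha}_{(\alpha-\beta,\beta)}(I)$ with $\mathcal L_r^\alpha(\rho^{(\alpha-\beta,\beta)}\phi)=f$, and $\|\phi\|_{s+\alpha,(\alpha-\beta,\beta)}\le C\|f\|_{s,(\beta,\alpha-\beta)}$. (3) If $s+\alpha\ge1$, there is a constant $C$ such that for every $f\in H^s_{(\beta,\alpha-\beta)}(I)$ the problem $\mathcal L_r^\alpha u=f$ in $I$, $u(0)=u(1)=0$, has exactly one solution $u$ that is absolutely continuous on $[0,1]$ (the outer derivative in $D^\alpha$, $D^{\alpha*}$ being taken in the sense of distributions on $I$, where $f$ acts on $\psi\in C_c^\infty(I)$ as $\langle f,\psi/\rho^{(\beta,\alpha-\beta)}\rangle_{\rho^{(\beta,\alpha-\beta)}}$). It has the form $u=\rho^{(\alpha-\beta,\beta)}\phi$ on $I$, where $\phi$ is the element of $H^{s+\alpha}_{(\alpha-\beta,\beta)}(I)$ in (2), and $\|\phi\|_{s+\alpha,(\alpha-\beta,\beta)}\le C\|f\|_{s,(\beta,\alpha-\beta)}$.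 -/

import Mathlib

open MeasureTheory Set Filter Topology
open scoped ContDiff

noncomputable section

namespace FracDiff

/-! ### Weights, Jacobi polynomials on `(0,1)` and Jacobi coefficients -/

/-- The weight `ρ^{(a,b)}(x) = (1 - x)^a x^b`. -/
def rho (a b x : ℝ) : ℝ := (1 - x) ^ a * x ^ b

/-- The measure `ρ^{(a,b)}(x) dx` on `I = (0,1)`. -/
def wMeasure (a b : ℝ) : Measure ℝ :=
  (volume.restrict (Ioo 0 1)).withDensity fun x => ENNReal.ofReal (rho a b x)

/-- The Jacobi polynomial `G_n^{(a,b)}(x) = P_n^{(a,b)}(2x - 1)`, where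
`P_n^{(a,b)}(t) = 2^{-n} ∑_{m ≤ n} C(n+a, m) C(n+b, n-m) (t-1)^{n-m} (t+1)^m`. -/
def jacobiG (a b : ℝ) (n : ℕ) (x : ℝ) : ℝ :=
  ∑ m ∈ Finset.range (n + 1),
    Ring.choose ((n : ℝ) + a) m * Ring.choose ((n : ℝ) + b) (n - m) / 2 ^ n *
      ((2 * x - 1) - 1) ^ (n - m) * ((2 * x - 1) + 1) ^ m

/-- The norm of `G_n^{(a,b)}` in `L²_{ρ^{(a,b)}}(I)`. -/
def jacobiNorm (a b : ℝ) (n : ℕ) : ℝ :=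
  Real.sqrt (∫ x, jacobiG a b n x ^ 2 ∂(wMeasure a b))

/-- The normalised Jacobi polynomial. -/
def jacobiN (a b : ℝ) (n : ℕ) (x : ℝ) : ℝ := jacobiG a b n x / jacobiNorm a b n

/-- The space `L²_{ρ^{(a,b)}}(I)`. -/
abbrev WL2 (a b : ℝ) : Type := Lp ℝ 2 (wMeasure a b)

open Classical in
/-- The normalised Jacobi polynomial as an element of `L²_{ρ^{(a,b)}}(I)`. The condition in the
definition holds whenever `a, b > -1`, see `memLp_jacobiN`. -/
def jacobiLp (a b : ℝ) (n : ℕ) : WL2 a b :=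
  if h : MemLp (jacobiN a b n) 2 (wMeasure a b) then h.toLp _ else 0

/-- The Jacobi coefficient `v_n = ∫₀¹ ρ^{(a,b)} v G̃_n^{(a,b)} dx`, see `coeff_eq_integral`. -/
def coeff (a b : ℝ) (n : ℕ) : WL2 a b →ₗ[ℝ] ℝ := (innerSL ℝ (jacobiLp a b n)).toLinearMap

lemma continuous_jacobiN (a b : ℝ) (n : ℕ) : Continuous (jacobiN a b n) := by
  unfold jacobiN jacobiG
  fun_prop

lemma integrableOn_rho {a b : ℝ} (ha : -1 < a) (hb : -1 < b) :
    IntegrableOn (rho a b) (Ioo 0 1) := by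
  have h := Complex.betaIntegral_convergent (u := ((b + 1 : ℝ) : ℂ)) (v := ((a + 1 : ℝ) : ℂ))
    (by simp; linarith) (by simp; linarith)
  rw [intervalIntegrable_iff_integrableOn_Ioo_of_le zero_le_one] at h
  refine h.re.congr ?_
  filter_upwards [ae_restrict_mem measurableSet_Ioo] with x hx
  have h1 : ((x : ℂ)) ^ (((b + 1 : ℝ) : ℂ) - 1) = ((x ^ b : ℝ) : ℂ) := by
    rw [Complex.ofReal_cpow hx.1.le]; push_cast; ring_nf
  have h2 : ((1 : ℂ) - (x : ℂ)) ^ (((a + 1 : ℝ) : ℂ) - 1) = (((1 - x) ^ a : ℝ) : ℂ) := by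
    rw [Complex.ofReal_cpow (by linarith [hx.2])]; push_cast; ring_nf
  rw [h1, h2, ← Complex.ofReal_mul]
  simp [rho, mul_comm]

lemma isFiniteMeasure_wMeasure {a b : ℝ} (ha : -1 < a) (hb : -1 < b) :
    IsFiniteMeasure (wMeasure a b) :=
  isFiniteMeasure_withDensity_ofReal (integrableOn_rho ha hb).2

lemma memLp_jacobiN {a b : ℝ} (ha : -1 < a) (hb : -1 < b) (n : ℕ) :
    MemLp (jacobiN a b n) 2 (wMeasure a b) := by
  have := isFiniteMeasure_wMeasure ha hb
  obtain ⟨C, hC⟩ := (isCompact_Icc (a := (0 : ℝ)) (b := 1)).exists_bound_of_continuousOn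
    (continuous_jacobiN a b n).continuousOn
  refine MemLp.of_bound (continuous_jacobiN a b n).aestronglyMeasurable C ?_
  refine (withDensity_absolutelyContinuous _ _).ae_le ?_
  filter_upwards [ae_restrict_mem measurableSet_Ioo] with x hx
  exact hC x ⟨hx.1.le, hx.2.le⟩

lemma coeff_eq_integral {a b : ℝ} (ha : -1 < a) (hb : -1 < b) (n : ℕ) (v : WL2 a b) :
    coeff a b n v = ∫ x in Ioo (0 : ℝ) 1, rho a b x * v x * jacobiN a b n x := by
  have hm := memLp_jacobiN ha hb n
  have h1 : coeff a b n v = ∫ x, jacobiN a b n x * v x ∂(wMeasure a b) := by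
    have : coeff a b n v = inner ℝ (jacobiLp a b n) v := rfl
    rw [this, L2.inner_def]
    refine integral_congr_ae ?_
    have h2 : jacobiLp a b n = hm.toLp _ := by unfold jacobiLp; rw [dif_pos hm]
    rw [h2]
    filter_upwards [hm.coeFn_toLp] with x hx
    rw [hx]
    simp [mul_comm]
  rw [h1]
  have hmeas : Measurable fun x => ENNReal.ofReal (rho a b x) := by
    unfold rho; fun_prop
  unfold wMeasure at *
  rw [integral_withDensity_eq_integral_toReal_smul hmeas (by simp)]
  refine setIntegral_congr_fun measurableSet_Ioo fun x hx => ?_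
  have : 0 ≤ rho a b x :=
    mul_nonneg (Real.rpow_nonneg (by linarith [hx.2]) _) (Real.rpow_nonneg hx.1.le _)
  simp only [ENNReal.toReal_ofReal this, smul_eq_mul]
  ring

/-! ### The spaces `H^s_{(a,b)}(I)` for `s ≥ 0` -/

/-- The elements `v` of `L²_{ρ^{(a,b)}}(I)` with `∑ (1 + j²)^s v_j² < ∞`. -/
def posSubmodule (s a b : ℝ) : Submodule ℝ (WL2 a b) where
  carrier := {v | Summable fun j : ℕ => (1 + (j : ℝ) ^ 2) ^ s * coeff a b j v ^ 2}
  zero_mem' := by simp [summable_zero]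
  add_mem' := by
    intro v w hv hw
    refine Summable.of_nonneg_of_le (fun j => by positivity) (fun j => ?_)
      ((hv.mul_left 2).add (hw.mul_left 2))
    have h : (0 : ℝ) ≤ (1 + (j : ℝ) ^ 2) ^ s := by positivity
    rw [map_add]
    nlinarith [mul_nonneg h (sq_nonneg (coeff a b j v - coeff a b j w))]
  smul_mem' := by
    intro c v hv
    refine (hv.mul_left (c ^ 2)).congr fun j => ?_
    rw [map_smul, smul_eq_mul]
    ring

/-- `H^s_{(a,b)}(I)` for `s ≥ 0`, as a type of its own (it does not carry the `L²` norm). -/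
def PosSpace (s a b : ℝ) : Type := posSubmodule s a b

instance (s a b : ℝ) : AddCommGroup (PosSpace s a b) :=
  inferInstanceAs (AddCommGroup (posSubmodule s a b))

instance (s a b : ℝ) : Module ℝ (PosSpace s a b) :=
  inferInstanceAs (Module ℝ (posSubmodule s a b))

/-- The inclusion of `H^s_{(a,b)}(I)`, `s ≥ 0`, in `L²_{ρ^{(a,b)}}(I)`. -/
def PosSpace.toL2 {s a b : ℝ} : PosSpace s a b →ₗ[ℝ] WL2 a b := (posSubmodule s a b).subtype

lemma memlp_seq {s a b : ℝ} (v : PosSpace s a b) :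
    Memℓp (fun j : ℕ => (1 + (j : ℝ) ^ 2) ^ (s / 2) * coeff a b j v.toL2) 2 := by
  refine memℓp_gen (Summable.congr (v.2 : Summable _) fun j => ?_)
  have h : (0 : ℝ) ≤ 1 + (j : ℝ) ^ 2 := by positivity
  have h2 : ((1 + (j : ℝ) ^ 2) ^ (s / 2)) ^ 2 = (1 + (j : ℝ) ^ 2) ^ s := by
    rw [← Real.rpow_natCast, ← Real.rpow_mul h]; norm_num
  simp only [ENNReal.toReal_ofNat, Real.rpow_ofNat, Real.norm_eq_abs, sq_abs, mul_pow, h2]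
  rfl

/-- The sequence `((1 + j²)^{s/2} v_j)_j ∈ ℓ²`. -/
def PosSpace.toSeq (s a b : ℝ) : PosSpace s a b →ₗ[ℝ] lp (fun _ : ℕ => ℝ) 2 where
  toFun v := ⟨_, memlp_seq v⟩
  map_add' v w := by
    ext j
    simp only [map_add, mul_add]
    rfl
  map_smul' c v := by
    ext j
    simp [mul_left_comm]

/-- The norm of `H^s_{(a,b)}(I)`, `s ≥ 0`; explicitly, see `PosSpace.norm_eq`. -/
instance (s a b : ℝ) : SeminormedAddCommGroup (PosSpace s a b) :=
  SeminormedAddCommGroup.induced _ _ (PosSpace.toSeq s a b)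

instance (s a b : ℝ) : NormedSpace ℝ (PosSpace s a b) :=
  NormedSpace.induced ℝ _ _ (PosSpace.toSeq s a b)

lemma PosSpace.norm_eq {s a b : ℝ} (v : PosSpace s a b) :
    ‖v‖ = Real.sqrt (∑' j : ℕ, (1 + (j : ℝ) ^ 2) ^ s * coeff a b j v.toL2 ^ 2) := by
  have h1 : ‖v‖ = ‖PosSpace.toSeq s a b v‖ := rfl
  rw [h1, lp.norm_eq_tsum_rpow (by norm_num), Real.sqrt_eq_rpow]
  norm_num
  congr 1
  refine tsum_congr fun j => ?_
  have h : (0 : ℝ) ≤ 1 + (j : ℝ) ^ 2 := by positivity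
  have h2 : ((1 + (j : ℝ) ^ 2) ^ (s / 2)) ^ 2 = (1 + (j : ℝ) ^ 2) ^ s := by
    rw [← Real.rpow_natCast, ← Real.rpow_mul h]; norm_num
  rw [← h2, ← mul_pow]
  rfl

/-! ### The spaces `H^s_{(a,b)}(I)` for all real `s` -/

/-- The two kinds of spaces: functions (`true`), or bounded linear functionals (`false`). -/
def SobAux : Bool → ℝ → ℝ → ℝ → Type
  | true, s, a, b => PosSpace s a b
  | false, s, a, b => StrongDual ℝ (PosSpace (-s) a b)

instance : ∀ (t : Bool) (s a b : ℝ), SeminormedAddCommGroup (SobAux t s a b)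
  | true, s, a, b => inferInstanceAs (SeminormedAddCommGroup (PosSpace s a b))
  | false, s, a, b => inferInstanceAs (SeminormedAddCommGroup (StrongDual ℝ (PosSpace (-s) a b)))

instance : ∀ (t : Bool) (s a b : ℝ), NormedSpace ℝ (SobAux t s a b)
  | true, s, a, b => inferInstanceAs (NormedSpace ℝ (PosSpace s a b))
  | false, s, a, b => inferInstanceAs (NormedSpace ℝ (StrongDual ℝ (PosSpace (-s) a b)))

open Classical in
/-- The weighted Sobolev space `H^s_{(a,b)}(I)`, `s ∈ ℝ`: for `s ≥ 0` the functions
`v ∈ L²_{ρ^{(a,b)}}(I)` with `∑ (1 + j²)^s v_j² < ∞`, and for `s < 0` the bounded linear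
functionals on `H^{-s}_{(a,b)}(I)` with the dual norm. -/
abbrev Sob (s a b : ℝ) : Type := SobAux (decide (0 ≤ s)) s a b

/-- An element of `H^s_{(a,b)}(I)`, `s < 0`, as a functional on `H^{-s}_{(a,b)}(I)`. -/
def SobAux.toDual {s a b : ℝ} (F : SobAux false s a b) : StrongDual ℝ (PosSpace (-s) a b) := F

/-- `Pairs F g c`: the function `g` on `I` lies in the space on which `F` acts
(`L²_{ρ^{(a,b)}}(I)` if `F` is a function, `H^{-s}_{(a,b)}(I)` if `F` is a functional), and
`⟨F, g⟩_{ρ^{(a,b)}} = c`. -/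
def Pairs : ∀ {t : Bool} {s a b : ℝ}, SobAux t s a b → (ℝ → ℝ) → ℝ → Prop
  | true, _, a, b, v, g, c =>
      MemLp g 2 (wMeasure a b) ∧
        ∫ x, (PosSpace.toL2 v : WL2 a b) x * g x ∂(wMeasure a b) = c
  | false, s, a, b, F, g, c =>
      ∃ w : PosSpace (-s) a b, (w.toL2 : ℝ → ℝ) =ᵐ[wMeasure a b] g ∧
        SobAux.toDual F w = c

/-- `F` is (given by) the function `h` on `I`. -/
def IsFunction : ∀ {t : Bool} {s a b : ℝ}, SobAux t s a b → (ℝ → ℝ) → Prop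
  | true, _, a, b, v, h => ((PosSpace.toL2 v : WL2 a b) : ℝ → ℝ) =ᵐ[wMeasure a b] h
  | false, s, a, b, F, h =>
      ∀ w : PosSpace (-s) a b, Integrable (fun x => h x * w.toL2 x) (wMeasure a b) ∧
        SobAux.toDual F w = ∫ x, h x * w.toL2 x ∂(wMeasure a b)

/-! ### The fractional diffusion operator -/

/-- `Γ(2-α)⁻¹ ∫₀ˣ (x - t)^{-(α-1)} u'(t) dt`. -/
def leftFlux (α : ℝ) (u : ℝ → ℝ) (x : ℝ) : ℝ :=
  1 / Real.Gamma (2 - α) * ∫ t in (0 : ℝ)..x, 1 / (x - t) ^ (α - 1) * deriv u t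

/-- `Γ(2-α)⁻¹ ∫ₓ¹ (t - x)^{-(α-1)} u'(t) dt`. -/
def rightFlux (α : ℝ) (u : ℝ → ℝ) (x : ℝ) : ℝ :=
  1 / Real.Gamma (2 - α) * ∫ t in x..(1 : ℝ), 1 / (t - x) ^ (α - 1) * deriv u t

/-- The fractional derivatives `D^α` (left) and `D^{α*}` (right), pointwise. -/
def leftDeriv (α : ℝ) (u : ℝ → ℝ) (x : ℝ) : ℝ := deriv (leftFlux α u) x

/-- The right fractional derivative `D^{α*}`, pointwise. -/
def rightDeriv (α : ℝ) (u : ℝ → ℝ) (x : ℝ) : ℝ := deriv (rightFlux α u) x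

/-- The operator `L_r^α u = -(r D^α u + (1 - r) D^{α*} u)`, pointwise. -/
def fracOp (α r : ℝ) (u : ℝ → ℝ) (x : ℝ) : ℝ :=
  -(r * leftDeriv α u x + (1 - r) * rightDeriv α u x)

/-- Test functions on `I`: smooth with compact support in `(0,1)`. -/
def IsTest (ψ : ℝ → ℝ) : Prop :=
  ContDiff ℝ ∞ ψ ∧ HasCompactSupport ψ ∧ tsupport ψ ⊆ Ioo 0 1

/-- `L_r^α (ρ^{(a,b)} φ) = f` for `φ ∈ H^σ_{(a,b)}(I)` and `f ∈ H^s_{(b,a)}(I)`, by transposition: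
the formal adjoint of `L_r^α` in `L²(I)` is `L_{1-r}^α`, so that with `ψ = ρ^{(b,a)} g`
`∫ f ψ = ⟨f, g⟩_{ρ^{(b,a)}}` has to equal `∫ ρ^{(a,b)} φ L_{1-r}^α ψ = ⟨φ, L_{1-r}^α ψ⟩_{ρ^{(a,b)}}`.
Test functions are those with `g` smooth and compactly supported in `I`, which give the equation
in the sense of distributions on `I`, and those with `g` a polynomial: for very negative `s` an
element of `H^s_{(b,a)}(I)` is not determined by its action on functions that vanish near the
endpoints. -/
def FracEq (α r : ℝ) {t t' : Bool} {σ s a b : ℝ} (φ : SobAux t σ a b) (f : SobAux t' s b a) :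
    Prop :=
  ∀ g : ℝ → ℝ, (IsTest g ∨ ∃ p : Polynomial ℝ, g = fun x => p.eval x) →
    ∃ c : ℝ, Pairs f g c ∧ Pairs φ (fracOp α (1 - r) fun x => rho b a x * g x) c

/-- `u` solves `L_r^α u = f` in `I`, `u(0) = u(1) = 0`: `u` is absolutely continuous, so that
the fractional integrals of `Du` in the definition of `D^α u` and `D^{α*} u` exist, and the
outer derivative is taken in the sense of distributions on `I`. The generalised function
`f ∈ H^s_{(a,b)}(I)` acts on a test function `ψ` as `∫ f ψ = ⟨f, ψ / ρ^{(a,b)}⟩_{ρ^{(a,b)}}`. -/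
structure IsSolution (α r : ℝ) {t : Bool} {s a b : ℝ} (f : SobAux t s a b) (u : ℝ → ℝ) :
    Prop where
  absolutelyContinuous : AbsolutelyContinuousOnInterval u 0 1
  left : u 0 = 0
  right : u 1 = 0
  equation : ∀ ψ : ℝ → ℝ, IsTest ψ → ∃ c : ℝ, Pairs f (fun x => ψ x / rho a b x) c ∧
    ∫ x in (0 : ℝ)..1, (r * leftFlux α u x + (1 - r) * rightFlux α u x) * deriv ψ x = c

/-- The conditions that determine `β` from `α` and `r`. -/
structure ConditionA (α r β : ℝ) : Prop where
  lower : α - 1 ≤ β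
  upper : β ≤ 1
  eq : r = Real.sin (Real.pi * β) / (Real.sin (Real.pi * (α - β)) + Real.sin (Real.pi * β))

end FracDiff

end

/-!
# Regularity for the two-sided fractional diffusion equation

Write `a = α - β` and `b = β`, so that `a, b ∈ (0, 1]` and `a + b = α`. The condition relating `r`
and `β` becomes `r sin (π a) = (1 - r) sin (π b)` (`Params`), which is invariant under exchanging
`a` and `b` and replacing `r` by `1 - r`; this symmetry takes `L_r^α` to its formal adjoint
`L_{1-r}^α`.

*The operator is diagonal in Jacobi polynomials.* The derivatives of the left and of the right Abel
integral of the weight `ρ^{(a-1,b-1)}` are both multiples of `ρ^{(-b,-a)}`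
(`hasDerivAt_leftAbel_rho`: after a Möbius substitution this is a beta integral), and the condition
on `r` says that they cancel in the two-sided combination. So the two-sided Abel operator maps
`ρ^{(a-1,b-1)}` to a constant (`Params.twoAbel_rho`). Commuting it with multiplication by the
variable shows that it maps `ρ^{(a-1,b-1)} p`, for a polynomial `p`, to a polynomial of no larger
degree, with an explicit factor on the top coefficient (`Params.exists_twoAbel_wPoly`). As
`(ρ^{(a,b)} p)'` is of this form, `L_r^α (ρ^{(a,b)} p)` is a polynomial whose degree is at most that
of `p`. By Fubini, `L_r^α` and `L_{1-r}^α` are adjoint to each other on weighted polynomials, so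
that `L_r^α (ρ^{(a,b)} G_n^{(a,b)})` is orthogonal to lower degrees, which means
`L_r^α (ρ^{(a,b)} G_n^{(a,b)}) = λ_n G_n^{(b,a)}` (`Params.fracOp_jacobiPoly`). Here `λ_n > 0` is
a constant times a quotient of Gamma functions and grows like `n^α` (`Params.exists_eigen_bounds`).

*The isomorphism.* Weighted Jacobi coefficients identify `H^s_{(a,b)}(I)`, for all real `s`, with
`ℓ²` (`sobIso`). The functions `g` by which the equation is tested, and their images
`L_{1-r}^α (ρ^{(b,a)} g)`, have rapidly decreasing coefficients, and these coefficients differ by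
the factors `λ_n` (`Params.jcoeff_fracOp`). Hence the equation by transposition says `f_n = λ_n φ_n`
for all `n` (`Params.fracEq_iff`). Since `λ_n` is comparable to `(1 + n²)^{α/2}`, this defines an
isomorphism.

*Absolutely continuous solutions.* The derivatives of `ρ^{(a,b)} G_n^{(a,b)}` are `ρ^{(a-1,b-1)}`
times functions that are orthogonal in `L²_{ρ^{(a-1,b-1)}}(I)`, with norms of order `n` relative to
that of `G_n^{(a,b)}`. If `φ` has order at least one, the differentiated expansion of `ρ^{(a,b)} φ`
therefore converges, and `ρ^{(a,b)} φ` is the primitive of an integrable function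
(`exists_primitive_eq_rho_mul`); it solves the equation in the sense of distributions because the
flux of an absolutely continuous function can be integrated by parts against test functions
(`integral_flux_mul_deriv`). If an absolutely continuous `u` vanishing at the endpoints satisfies
`L_r^α u = 0`, its flux is constant by the lemma of du Bois-Reymond. Pairing the flux with the
derivative of `ρ^{(b,a)} G_n^{(b,a)}` gives `∫ u G_n^{(a,b)} = 0` for all `n`, so that `u = 0`
(`Params.eqOn_zero_of_integral_fracOp`).
-/

noncomputable section

namespace FracDiff

/-! ### Beta integrals and the Abel integral of a Jacobi weight -/

lemma rho_nonneg {a b x : ℝ} (hx : x ∈ Ioo (0 : ℝ) 1) : 0 ≤ rho a b x :=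
  mul_nonneg (Real.rpow_nonneg (by linarith [hx.2]) _) (Real.rpow_nonneg hx.1.le _)

lemma rho_pos {a b x : ℝ} (hx : x ∈ Ioo (0 : ℝ) 1) : 0 < rho a b x :=
  mul_pos (Real.rpow_pos_of_pos (by linarith [hx.2]) _) (Real.rpow_pos_of_pos hx.1 _)

lemma measurable_rho (a b : ℝ) : Measurable (rho a b) := by
  unfold rho; fun_prop

lemma rho_one_sub (a b x : ℝ) : rho a b (1 - x) = rho b a x := by
  simp [rho, mul_comm]

lemma integral_rho {a b : ℝ} (ha : -1 < a) (hb : -1 < b) :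
    ∫ x in Ioo (0 : ℝ) 1, rho a b x =
      Real.Gamma (a + 1) * Real.Gamma (b + 1) / Real.Gamma (a + b + 2) := by
  have h : ProbabilityTheory.beta (b + 1) (a + 1) =
      (Complex.betaIntegral ((b + 1 : ℝ) : ℂ) ((a + 1 : ℝ) : ℂ)).re :=
    ProbabilityTheory.beta_eq_betaIntegralReal _ _ (by linarith) (by linarith)
  have h3 : Complex.betaIntegral ((b + 1 : ℝ) : ℂ) ((a + 1 : ℝ) : ℂ) =
      ((∫ x in Ioo (0 : ℝ) 1, rho a b x : ℝ) : ℂ) := by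
    rw [Complex.betaIntegral, intervalIntegral.integral_of_le zero_le_one,
      integral_Ioc_eq_integral_Ioo, ← integral_complex_ofReal]
    refine setIntegral_congr_fun measurableSet_Ioo fun x hx => ?_
    have h1 : ((x : ℂ)) ^ (((b + 1 : ℝ) : ℂ) - 1) = ((x ^ b : ℝ) : ℂ) := by
      rw [Complex.ofReal_cpow hx.1.le]; push_cast; ring_nf
    have h2 : ((1 : ℂ) - (x : ℂ)) ^ (((a + 1 : ℝ) : ℂ) - 1) = (((1 - x) ^ a : ℝ) : ℂ) := by
      rw [Complex.ofReal_cpow (by linarith [hx.2])]; push_cast; ring_nf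
    simp only [h1, h2, rho]
    push_cast; ring
  rw [h3, Complex.ofReal_re] at h
  rw [← h, ProbabilityTheory.beta, mul_comm (Real.Gamma (b + 1))]
  ring_nf

/-- The Möbius substitution `y = s / (1 - x + x s)` turns this Euler integral into a beta
integral, because the exponents of the three singular points `0`, `1`, `1/x` sum to `-2`. -/
lemma integral_rho_mul_one_sub_mul_rpow (a b : ℝ) {x : ℝ} (hx : x ∈ Ioo (0 : ℝ) 1) :
    ∫ y in Ioo (0 : ℝ) 1, rho (1 - (a + b)) (b - 1) y * (1 - x * y) ^ (a - 2) =
      (1 - x) ^ (-b) * ∫ s in Ioo (0 : ℝ) 1, rho (1 - (a + b)) (b - 1) s := by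
  obtain ⟨hx0, hx1⟩ := hx
  have hx' : 0 < 1 - x := by linarith
  set F : ℝ → ℝ := fun s => s / (1 - x + x * s) with hF
  have hD : ∀ s ∈ Ioo (0 : ℝ) 1, 0 < 1 - x + x * s := fun s hs => by
    have := mul_pos hx0 hs.1
    linarith
  have himg : F '' Ioo 0 1 = Ioo 0 1 := by
    ext y
    constructor
    · rintro ⟨s, hs, rfl⟩
      have h := hD s hs
      refine ⟨div_pos hs.1 h, (div_lt_one h).2 ?_⟩
      nlinarith [hs.2]
    · intro hy
      have h : 0 < 1 - x * y := by nlinarith [hy.1, hy.2]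
      refine ⟨(1 - x) * y / (1 - x * y), ⟨by have := hy.1; positivity, ?_⟩, ?_⟩
      · rw [div_lt_one h]; nlinarith [hy.2]
      · have h2 : 1 - x + x * ((1 - x) * y / (1 - x * y)) = (1 - x) / (1 - x * y) := by
          field_simp; ring
        simp only [hF]
        rw [h2]
        field_simp
  have hder : ∀ s ∈ Ioo (0 : ℝ) 1,
      HasDerivWithinAt F ((1 - x) / (1 - x + x * s) ^ 2) (Ioo 0 1) s := fun s hs => by
    have h := (hD s hs).ne'
    have h1 : HasDerivAt F ((1 * (1 - x + x * s) - s * (0 + x * 1)) / (1 - x + x * s) ^ 2) s :=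
      (hasDerivAt_id s).div ((hasDerivAt_const s (1 - x)).add ((hasDerivAt_id s).const_mul x)) h
    exact (h1.congr_deriv (by ring)).hasDerivWithinAt
  have hinj : InjOn F (Ioo 0 1) := fun s hs t ht hst => by
    have h1 := (hD s hs).ne'
    have h2 := (hD t ht).ne'
    simp only [hF] at hst
    rw [div_eq_div_iff h1 h2] at hst
    have : (1 - x) * (s - t) = 0 := by linarith
    rcases mul_eq_zero.1 this with h | h <;> linarith
  have key := integral_image_eq_integral_abs_deriv_smul measurableSet_Ioo hder hinj
    (fun y => rho (1 - (a + b)) (b - 1) y * (1 - x * y) ^ (a - 2))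
  rw [himg] at key
  rw [key, ← integral_const_mul]
  refine setIntegral_congr_fun measurableSet_Ioo fun s hs => ?_
  have hd := hD s hs
  have hs1 : 0 < 1 - s := by linarith [hs.2]
  have e1 : 1 - F s = (1 - x) * (1 - s) / (1 - x + x * s) := by
    have := hd.ne'
    rw [eq_div_iff this, sub_mul, div_mul_cancel₀ _ this]; ring
  have e2 : 1 - x * F s = (1 - x) / (1 - x + x * s) := by
    have := hd.ne'
    rw [eq_div_iff this, sub_mul, mul_assoc, div_mul_cancel₀ _ this]; ring
  simp only [rho]
  rw [e1, e2]
  simp only [hF]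
  generalize 1 - x + x * s = D at hd
  rw [abs_of_pos (by positivity), Real.div_rpow (by positivity) hd.le,
    Real.div_rpow hs.1.le hd.le, Real.div_rpow hx'.le hd.le, Real.mul_rpow hx'.le hs1.le,
    smul_eq_mul]
  have hDp : D ^ 2 * (D ^ (1 - (a + b)) * D ^ (b - 1) * D ^ (a - 2)) = 1 := by
    rw [← Real.rpow_natCast, ← Real.rpow_add hd, ← Real.rpow_add hd, ← Real.rpow_add hd]
    rw [show ((2 : ℕ) : ℝ) + (1 - (a + b) + (b - 1) + (a - 2)) = 0 by push_cast; ring,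
      Real.rpow_zero]
  have hXp : (1 - x) * ((1 - x) ^ (1 - (a + b)) * (1 - x) ^ (a - 2)) = (1 - x) ^ (-b) := by
    nth_rewrite 1 [← Real.rpow_one (1 - x)]
    rw [← Real.rpow_add hx', ← Real.rpow_add hx']
    ring_nf
  have p1 := Real.rpow_pos_of_pos hd (1 - (a + b))
  have p2 := Real.rpow_pos_of_pos hd (b - 1)
  have p3 := Real.rpow_pos_of_pos hd (a - 2)
  rw [← hXp]
  field_simp
  rw [mul_assoc] at hDp
  linear_combination (-s ^ (b - 1)) * hDp

/-- The left Abel integral `∫₀ˣ (x - t)^{1-α} f(t) dt`. -/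
def leftAbel (α : ℝ) (f : ℝ → ℝ) (x : ℝ) : ℝ := ∫ t in (0 : ℝ)..x, 1 / (x - t) ^ (α - 1) * f t

/-- The right Abel integral `∫ₓ¹ (t - x)^{1-α} f(t) dt`. -/
def rightAbel (α : ℝ) (f : ℝ → ℝ) (x : ℝ) : ℝ := ∫ t in x..(1 : ℝ), 1 / (t - x) ^ (α - 1) * f t

lemma rightAbel_eq_leftAbel (α : ℝ) (f : ℝ → ℝ) (x : ℝ) :
    rightAbel α f x = leftAbel α (fun t => f (1 - t)) (1 - x) := by
  have h := intervalIntegral.integral_comp_sub_left (a := 0) (b := 1 - x)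
    (fun t => 1 / (t - x) ^ (α - 1) * f t) 1
  simp only [sub_sub_cancel, sub_zero] at h
  rw [rightAbel, leftAbel, ← h]
  refine intervalIntegral.integral_congr fun t _ => ?_
  rw [show 1 - t - x = 1 - x - t by ring]

/-- Scaling to the unit interval. -/
lemma leftAbel_rho_eq {a b : ℝ} {x : ℝ} (hx : x ∈ Ioo (0 : ℝ) 1) :
    leftAbel (a + b) (rho (a - 1) (b - 1)) x =
      x ^ (1 - a) * ∫ y in Ioo (0 : ℝ) 1, rho (1 - (a + b)) (b - 1) y * (1 - x * y) ^ (a - 1) := by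
  have h := intervalIntegral.integral_comp_mul_left (a := 0) (b := 1)
    (fun t => 1 / (x - t) ^ (a + b - 1) * rho (a - 1) (b - 1) t) hx.1.ne'
  simp only [mul_zero, mul_one, smul_eq_mul] at h
  have h2 : leftAbel (a + b) (rho (a - 1) (b - 1)) x =
      x * ∫ y in (0 : ℝ)..1, 1 / (x - x * y) ^ (a + b - 1) * rho (a - 1) (b - 1) (x * y) := by
    rw [h, leftAbel, mul_inv_cancel_left₀ hx.1.ne']
  rw [h2, intervalIntegral.integral_of_le zero_le_one, integral_Ioc_eq_integral_Ioo,
    ← integral_const_mul, ← integral_const_mul]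
  refine setIntegral_congr_fun measurableSet_Ioo fun y hy => ?_
  have hy1 : 0 < 1 - y := by linarith [hy.2]
  simp only [rho]
  rw [show x - x * y = x * (1 - y) by ring, Real.mul_rpow hx.1.le hy1.le,
    Real.mul_rpow hx.1.le hy.1.le, show (1 : ℝ) - (a + b) = -(a + b - 1) by ring,
    Real.rpow_neg hy1.le]
  have e : x * x ^ (b - 1) = x ^ (1 - a) * x ^ (a + b - 1) := by
    rw [← Real.rpow_add hx.1]
    nth_rewrite 1 [← Real.rpow_one x]
    rw [← Real.rpow_add hx.1]; ring_nf
  have p1 := Real.rpow_pos_of_pos hx.1 (a + b - 1)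
  have p2 := Real.rpow_pos_of_pos hy1 (a + b - 1)
  field_simp
  linear_combination ((1 - x * y) ^ (a - 1) * y ^ (b - 1)) * e

/-- The Abel integral of the Jacobi weight `ρ^{(a-1,b-1)}`, `α = a + b`, has the elementary
derivative `C x^{-a} (1 - x)^{-b}`. -/
lemma hasDerivAt_leftAbel_rho {a b : ℝ} (ha : a ≤ 1) (hb : 0 < b) (hab : a + b < 2) {x : ℝ}
    (hx : x ∈ Ioo (0 : ℝ) 1) :
    HasDerivAt (leftAbel (a + b) (rho (a - 1) (b - 1)))
      ((1 - a) * (∫ s in Ioo (0 : ℝ) 1, rho (1 - (a + b)) (b - 1) s) * rho (-b) (-a) x) x := by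
  set E : ℝ := ∫ s in Ioo (0 : ℝ) 1, rho (1 - (a + b)) (b - 1) s with hE
  have hint : IntegrableOn (rho (1 - (a + b)) (b - 1)) (Ioo 0 1) :=
    integrableOn_rho (by linarith) (by linarith)
  -- `leftAbel` is `x ^ (1 - a) * g x` near `x`; `g` is differentiated under the integral sign
  set g : ℝ → ℝ := fun x => ∫ y in Ioo (0 : ℝ) 1,
    rho (1 - (a + b)) (b - 1) y * (1 - x * y) ^ (a - 1) with hg
  have hx0 := hx.1
  have hx1 := hx.2
  have hδ : 0 < (1 - x) / 2 := by linarith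
  have hlow : ∀ y ∈ Ioo (0 : ℝ) 1, ∀ z ∈ Ioo 0 ((1 + x) / 2), (1 - x) / 2 ≤ 1 - z * y := by
    intro y hy z hz
    nlinarith [mul_pos hz.1 (sub_pos.2 hy.2), hz.2]
  have hIb : ∀ c : ℝ, c ≤ 0 → ∀ y ∈ Ioo (0 : ℝ) 1, ∀ z ∈ Ioo 0 ((1 + x) / 2),
      |(1 - z * y) ^ c| ≤ ((1 - x) / 2) ^ c := by
    intro c hc y hy z hz
    have := hlow y hy z hz
    rw [abs_of_nonneg (Real.rpow_nonneg (by linarith) _)]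
    exact Real.rpow_le_rpow_of_nonpos hδ this hc
  have hxm : x ∈ Ioo 0 ((1 + x) / 2) := ⟨hx0, by linarith⟩
  have hgd := hasDerivAt_integral_of_dominated_loc_of_deriv_le
    (μ := volume.restrict (Ioo (0 : ℝ) 1)) (x₀ := x) (s := Ioo 0 ((1 + x) / 2))
    (F := fun x y => rho (1 - (a + b)) (b - 1) y * (1 - x * y) ^ (a - 1))
    (F' := fun x y => rho (1 - (a + b)) (b - 1) y * ((-y) * (a - 1) * (1 - x * y) ^ (a - 2)))
    (bound := fun y => rho (1 - (a + b)) (b - 1) y * ((1 - a) * ((1 - x) / 2) ^ (a - 2)))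
    (Ioo_mem_nhds hxm.1 hxm.2) ?_ ?_ ?_ ?_ ?_ ?_
  · have hgder := hgd.2
    have hpow : HasDerivAt (fun x : ℝ => x ^ (1 - a)) ((1 - a) * x ^ (1 - a - 1)) x :=
      Real.hasDerivAt_rpow_const (Or.inl hx0.ne')
    have hprod := hpow.mul hgder
    have hcongr : leftAbel (a + b) (rho (a - 1) (b - 1)) =ᶠ[𝓝 x] fun x => x ^ (1 - a) * g x := by
      filter_upwards [Ioo_mem_nhds hx0 hx1] with z hz using leftAbel_rho_eq hz
    refine (hprod.congr_of_eventuallyEq hcongr).congr_deriv ?_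
    have hI1 : IntegrableOn (fun y => rho (1 - (a + b)) (b - 1) y * (1 - x * y) ^ (a - 1))
        (Ioo 0 1) := by
      refine Integrable.mul_bdd (c := ((1 - x) / 2) ^ (a - 1)) hint
        (Measurable.pow_const (by fun_prop) _).aestronglyMeasurable ?_
      filter_upwards [ae_restrict_mem measurableSet_Ioo] with y hy
      exact hIb _ (by linarith) y hy x hxm
    rw [← integral_const_mul, ← integral_const_mul, ← integral_add (hI1.const_mul _)
      (hgd.1.const_mul _)]
    have hm := integral_rho_mul_one_sub_mul_rpow a b hx
    rw [← hE] at hm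
    have hrhs : (1 - a) * E * rho (-b) (-a) x = ∫ y in Ioo (0 : ℝ) 1,
        (1 - a) * x ^ (-a) * (rho (1 - (a + b)) (b - 1) y * (1 - x * y) ^ (a - 2)) := by
      rw [integral_const_mul, hm, rho]; ring
    rw [hrhs]
    refine setIntegral_congr_fun measurableSet_Ioo fun y hy => ?_
    have hp : 0 < 1 - x * y := lt_of_lt_of_le hδ (hlow y hy x hxm)
    have e1 : (1 - x * y) ^ (a - 1) = (1 - x * y) ^ (a - 2) * (1 - x * y) := by
      nth_rewrite 3 [← Real.rpow_one (1 - x * y)]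
      rw [← Real.rpow_add hp]; ring_nf
    have e2 : x ^ (1 - a) = x ^ (-a) * x := by
      nth_rewrite 3 [← Real.rpow_one x]
      rw [← Real.rpow_add hx0]; ring_nf
    simp only [e1, e2, show (1 : ℝ) - a - 1 = -a by ring]
    ring
  · exact Eventually.of_forall fun z =>
      ((measurable_rho _ _).mul (by fun_prop)).aestronglyMeasurable
  · refine Integrable.mul_bdd (c := ((1 - x) / 2) ^ (a - 1)) hint
      (Measurable.pow_const (by fun_prop) _).aestronglyMeasurable ?_
    filter_upwards [ae_restrict_mem measurableSet_Ioo] with y hy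
    exact hIb _ (by linarith) y hy x hxm
  · exact ((measurable_rho _ _).mul (by fun_prop)).aestronglyMeasurable
  · filter_upwards [ae_restrict_mem measurableSet_Ioo] with y hy z hz
    rw [norm_mul, Real.norm_of_nonneg (rho_nonneg hy)]
    refine mul_le_mul_of_nonneg_left ?_ (rho_nonneg hy)
    rw [norm_mul, norm_mul, Real.norm_eq_abs, Real.norm_eq_abs, Real.norm_eq_abs, abs_neg,
      abs_of_pos hy.1, abs_of_nonpos (by linarith : a - 1 ≤ 0)]
    have := hIb (a - 2) (by linarith) y hy z hz
    calc y * -(a - 1) * |(1 - z * y) ^ (a - 2)|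
        ≤ 1 * (1 - a) * ((1 - x) / 2) ^ (a - 2) := by
          refine mul_le_mul ?_ this (abs_nonneg _) (by linarith)
          nlinarith [hy.1, hy.2]
      _ = _ := by ring
  · exact hint.mul_const _
  · filter_upwards [ae_restrict_mem measurableSet_Ioo] with y hy z hz
    have hp : 0 < 1 - z * y := lt_of_lt_of_le hδ (hlow y hy z hz)
    have h1 : HasDerivAt (fun x : ℝ => 1 - x * y) (-y) z := by
      simpa using ((hasDerivAt_id z).mul_const y).const_sub 1
    have h2 := (h1.rpow_const (p := a - 1) (Or.inl hp.ne')).const_mul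
      (rho (1 - (a + b)) (b - 1) y)
    rw [show a - 1 - 1 = a - 2 by ring] at h2
    exact h2

/-! ### Fubini's theorem for Abel integrals -/

/-- The kernel `(x - t)_+^{1-α}` of the left Abel integral. -/
def abelKernel (α t x : ℝ) : ℝ := if t < x then 1 / (x - t) ^ (α - 1) else 0

lemma abelKernel_nonneg (α t x : ℝ) : 0 ≤ abelKernel α t x := by
  unfold abelKernel
  split_ifs with h
  · exact div_nonneg zero_le_one (Real.rpow_nonneg (by linarith) _)
  · exact le_rfl

lemma measurable_abelKernel (α : ℝ) : Measurable fun z : ℝ × ℝ => abelKernel α z.1 z.2 := by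
  unfold abelKernel
  exact Measurable.ite (measurableSet_lt measurable_fst measurable_snd) (by fun_prop) (by fun_prop)

lemma leftAbel_eq_integral_abelKernel (α : ℝ) (f : ℝ → ℝ) {x : ℝ} (hx : x ∈ Ioo (0 : ℝ) 1) :
    leftAbel α f x = ∫ t in Ioo (0 : ℝ) 1, abelKernel α t x * f t := by
  rw [leftAbel, intervalIntegral.integral_of_le hx.1.le, integral_Ioc_eq_integral_Ioo,
    ← inter_eq_right.2 (Ioo_subset_Ioo_right hx.2.le : Ioo 0 x ⊆ Ioo (0 : ℝ) 1),
    ← setIntegral_indicator measurableSet_Ioo]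
  refine setIntegral_congr_fun measurableSet_Ioo fun t ht => ?_
  by_cases h : t < x
  · simp [abelKernel, h, ht.1]
  · simp [abelKernel, h]

lemma rightAbel_eq_integral_abelKernel (α : ℝ) (f : ℝ → ℝ) {x : ℝ} (hx : x ∈ Ioo (0 : ℝ) 1) :
    rightAbel α f x = ∫ t in Ioo (0 : ℝ) 1, abelKernel α x t * f t := by
  rw [rightAbel, intervalIntegral.integral_of_le hx.2.le, integral_Ioc_eq_integral_Ioo,
    ← inter_eq_right.2 (Ioo_subset_Ioo_left hx.1.le : Ioo x 1 ⊆ Ioo (0 : ℝ) 1),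
    ← setIntegral_indicator measurableSet_Ioo]
  refine setIntegral_congr_fun measurableSet_Ioo fun t ht => ?_
  by_cases h : x < t
  · simp [abelKernel, h, ht.2]
  · simp [abelKernel, h]

/-- The left and the right Abel integral are adjoint to each other. -/
lemma integral_leftAbel_mul {α r : ℝ} {f g : ℝ → ℝ}
    (h : Integrable (fun z : ℝ × ℝ => r * (abelKernel α z.1 z.2 * f z.1 * g z.2))
      ((volume.restrict (Ioo (0 : ℝ) 1)).prod (volume.restrict (Ioo (0 : ℝ) 1)))) :
    ∫ x in Ioo (0 : ℝ) 1, r * leftAbel α f x * g x =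
      ∫ t in Ioo (0 : ℝ) 1, f t * (r * rightAbel α g t) := by
  have h1 : ∀ x ∈ Ioo (0 : ℝ) 1, r * leftAbel α f x * g x =
      ∫ t in Ioo (0 : ℝ) 1, r * (abelKernel α t x * f t * g x) := fun x hx => by
    rw [integral_const_mul, integral_mul_const, leftAbel_eq_integral_abelKernel α f hx, mul_assoc]
  have h2 : ∀ t ∈ Ioo (0 : ℝ) 1, f t * (r * rightAbel α g t) =
      ∫ x in Ioo (0 : ℝ) 1, r * (abelKernel α t x * f t * g x) := fun t ht => by
    rw [integral_const_mul, rightAbel_eq_integral_abelKernel α g ht, mul_left_comm,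
      ← integral_const_mul]
    congr 1
    refine integral_congr_ae (Eventually.of_forall fun x => ?_)
    ring
  rw [setIntegral_congr_fun measurableSet_Ioo h1, setIntegral_congr_fun measurableSet_Ioo h2]
  exact (integral_integral_swap (f := fun t x => r * (abelKernel α t x * f t * g x)) h).symm

lemma integrable_leftAbel_mul {α r : ℝ} {f g : ℝ → ℝ}
    (h : Integrable (fun z : ℝ × ℝ => r * (abelKernel α z.1 z.2 * f z.1 * g z.2))
      ((volume.restrict (Ioo (0 : ℝ) 1)).prod (volume.restrict (Ioo (0 : ℝ) 1)))) :
    IntegrableOn (fun x => r * leftAbel α f x * g x) (Ioo 0 1) := by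
  refine IntegrableOn.congr_fun h.integral_prod_right (fun x hx => ?_) measurableSet_Ioo
  dsimp only
  rw [integral_const_mul, integral_mul_const, leftAbel_eq_integral_abelKernel α f hx, mul_assoc]

lemma integrable_mul_rightAbel {α r : ℝ} {f g : ℝ → ℝ}
    (h : Integrable (fun z : ℝ × ℝ => r * (abelKernel α z.1 z.2 * f z.1 * g z.2))
      ((volume.restrict (Ioo (0 : ℝ) 1)).prod (volume.restrict (Ioo (0 : ℝ) 1)))) :
    IntegrableOn (fun t => f t * (r * rightAbel α g t)) (Ioo 0 1) := by
  refine IntegrableOn.congr_fun h.integral_prod_left (fun t ht => ?_) measurableSet_Ioo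
  dsimp only
  rw [integral_const_mul, rightAbel_eq_integral_abelKernel α g ht, mul_left_comm,
    ← integral_const_mul (f t)]
  refine congrArg (r * ·) (integral_congr_ae (Eventually.of_forall fun x => ?_))
  ring

lemma integrableOn_sub_rpow {α : ℝ} (hα : α < 2) (t c : ℝ) :
    IntegrableOn (fun x => 1 / (x - t) ^ (α - 1)) (Ioo t c) := by
  rcases le_total c t with h | h
  · simp [Ioo_eq_empty_of_le h]
  have h1 : IntervalIntegrable (fun x : ℝ => x ^ (1 - α)) volume 0 (c - t) :=
    intervalIntegral.intervalIntegrable_rpow' (by linarith)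
  have h2 := h1.comp_sub_right t
  rw [zero_add, sub_add_cancel, intervalIntegrable_iff_integrableOn_Ioo_of_le h] at h2
  refine h2.congr_fun (fun x hx => ?_) measurableSet_Ioo
  simp only [show 1 - α = -(α - 1) by ring]
  rw [Real.rpow_neg (by linarith [hx.1]), one_div]

lemma integral_sub_rpow {α : ℝ} (hα : α < 2) {t c : ℝ} (h : t ≤ c) :
    ∫ x in Ioo t c, 1 / (x - t) ^ (α - 1) = (c - t) ^ (2 - α) / (2 - α) := by
  have h1 : ∫ x in Ioo t c, 1 / (x - t) ^ (α - 1) = ∫ x in t..c, (x - t) ^ (1 - α) := by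
    rw [intervalIntegral.integral_of_le h, integral_Ioc_eq_integral_Ioo]
    refine setIntegral_congr_fun measurableSet_Ioo fun x hx => ?_
    rw [show 1 - α = -(α - 1) by ring, Real.rpow_neg (by linarith [hx.1]), one_div]
  rw [h1, intervalIntegral.integral_comp_sub_right (fun x : ℝ => x ^ (1 - α)) t, sub_self,
    integral_rpow (Or.inl (by linarith)), show 1 - α + 1 = 2 - α by ring,
    Real.zero_rpow (by linarith), sub_zero]

lemma integrable_abelKernel {α : ℝ} (hα : α < 2) (t : ℝ) :
    IntegrableOn (fun x => abelKernel α t x) (Ioo 0 1) := by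
  have h := (integrable_indicator_iff (measurableSet_Ioo)).2 (integrableOn_sub_rpow hα t 1)
  refine (h.integrableOn (s := Ioo 0 1)).congr_fun (fun x hx => ?_) measurableSet_Ioo
  by_cases hh : t < x
  · simp [abelKernel, hh, hx.2]
  · simp [abelKernel, hh]

lemma integral_abelKernel {α : ℝ} (hα : α < 2) {t : ℝ} (ht : t ∈ Ioo (0 : ℝ) 1) :
    ∫ x in Ioo (0 : ℝ) 1, abelKernel α t x = (1 - t) ^ (2 - α) / (2 - α) := by
  have h := rightAbel_eq_integral_abelKernel α (fun _ => 1) ht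
  simp only [mul_one] at h
  rw [← h, rightAbel, intervalIntegral.integral_of_le ht.2.le, integral_Ioc_eq_integral_Ioo]
  simp only [mul_one]
  exact integral_sub_rpow hα ht.2.le

lemma integrable_abelKernel_mul_bdd {α : ℝ} (hα : α < 2) {f g : ℝ → ℝ}
    (hf : IntegrableOn f (Ioo 0 1)) (hg : Measurable g) {C : ℝ} (hC : ∀ x, |g x| ≤ C) (r : ℝ) :
    Integrable (fun z : ℝ × ℝ => r * (abelKernel α z.1 z.2 * f z.1 * g z.2))
      ((volume.restrict (Ioo (0 : ℝ) 1)).prod (volume.restrict (Ioo (0 : ℝ) 1))) := by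
  refine Integrable.const_mul ?_ r
  refine Integrable.mul_bdd (c := C) ?_ (hg.comp measurable_snd).aestronglyMeasurable
    (Eventually.of_forall fun z => hC z.2)
  have hmeas : AEStronglyMeasurable (fun z : ℝ × ℝ => abelKernel α z.1 z.2 * f z.1)
      ((volume.restrict (Ioo (0 : ℝ) 1)).prod (volume.restrict (Ioo (0 : ℝ) 1))) :=
    (measurable_abelKernel α).aestronglyMeasurable.mul hf.1.comp_fst
  rw [integrable_prod_iff hmeas]
  constructor
  · exact Eventually.of_forall fun t => Integrable.mul_const (integrable_abelKernel hα t) (f t)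
  · have h2α : 0 < 2 - α := by linarith
    have : IntegrableOn (fun t => (1 - t) ^ (2 - α) / (2 - α) * ‖f t‖) (Ioo 0 1) := by
      refine Integrable.bdd_mul (c := 1 / (2 - α)) hf.norm (by fun_prop (disch := linarith)) ?_
      filter_upwards [ae_restrict_mem measurableSet_Ioo] with t ht
      rw [norm_div, Real.norm_of_nonneg h2α.le, Real.norm_of_nonneg
        (Real.rpow_nonneg (by linarith [ht.2]) _)]
      gcongr
      exact Real.rpow_le_one (by linarith [ht.2]) (by linarith [ht.1]) h2α.le
    refine IntegrableOn.congr_fun this (fun t ht => ?_) measurableSet_Ioo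
    simp only [norm_mul, Real.norm_of_nonneg (abelKernel_nonneg _ _ _)]
    rw [integral_mul_const, integral_abelKernel hα ht]

/-- Integrating the Abel integral raises the exponent of the kernel by one. -/
lemma integral_leftAbel {α : ℝ} (hα : α < 2) {f : ℝ → ℝ} (hf : IntegrableOn f (Ioo 0 1)) {x : ℝ}
    (hx : x ∈ Ioo (0 : ℝ) 1) :
    (2 - α) * ∫ y in (0 : ℝ)..x, leftAbel α f y = ∫ t in (0 : ℝ)..x, (x - t) ^ (2 - α) * f t := by
  have hg : Measurable ((Iio x).indicator fun _ : ℝ => (1 : ℝ)) :=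
    measurable_const.indicator measurableSet_Iio
  have hgC : ∀ y, |(Iio x).indicator (fun _ : ℝ => (1 : ℝ)) y| ≤ 1 := fun y => by
    by_cases h : y < x <;> simp [h]
  have key := integral_leftAbel_mul (integrable_abelKernel_mul_bdd hα hf hg hgC 1)
  simp only [one_mul] at key
  have hset : Ioo (0 : ℝ) 1 ∩ Iio x = Ioo 0 x := by
    ext y; simp only [mem_inter_iff, mem_Ioo, mem_Iio]; constructor
    · rintro ⟨h1, h2⟩; exact ⟨h1.1, h2⟩
    · rintro ⟨h1, h2⟩; exact ⟨⟨h1, h2.trans hx.2⟩, h2⟩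
  have e1 : ∫ y in (0 : ℝ)..x, leftAbel α f y =
      ∫ y in Ioo (0 : ℝ) 1, leftAbel α f y * (Iio x).indicator (fun _ : ℝ => (1 : ℝ)) y := by
    rw [intervalIntegral.integral_of_le hx.1.le, integral_Ioc_eq_integral_Ioo, ← hset,
      ← setIntegral_indicator measurableSet_Iio]
    refine setIntegral_congr_fun measurableSet_Ioo fun y _ => ?_
    by_cases h : y < x <;> simp [h]
  have e2 : ∫ t in (0 : ℝ)..x, (x - t) ^ (2 - α) * f t =
      ∫ t in Ioo (0 : ℝ) 1, (Iio x).indicator (fun t => (x - t) ^ (2 - α) * f t) t := by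
    rw [intervalIntegral.integral_of_le hx.1.le, integral_Ioc_eq_integral_Ioo, ← hset,
      ← setIntegral_indicator measurableSet_Iio]
  rw [e1, key, e2, ← integral_const_mul]
  refine setIntegral_congr_fun measurableSet_Ioo fun t ht => ?_
  have e3 : rightAbel α ((Iio x).indicator fun _ : ℝ => (1 : ℝ)) t =
      ∫ y in Ioo t 1, (Iio x).indicator (fun y => 1 / (y - t) ^ (α - 1)) y := by
    rw [rightAbel, intervalIntegral.integral_of_le ht.2.le, integral_Ioc_eq_integral_Ioo]
    refine setIntegral_congr_fun measurableSet_Ioo fun y _ => ?_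
    by_cases h : y < x <;> simp [h]
  have h2α : 2 - α ≠ 0 := by linarith
  simp only [e3]
  rw [setIntegral_indicator measurableSet_Iio]
  by_cases h : t < x
  · have : Ioo t 1 ∩ Iio x = Ioo t x := by
      ext y; simp only [mem_inter_iff, mem_Ioo, mem_Iio]; constructor
      · rintro ⟨h1, h2⟩; exact ⟨h1.1, h2⟩
      · rintro ⟨h1, h2⟩; exact ⟨⟨h1, h2.trans hx.2⟩, h2⟩
    rw [this, integral_sub_rpow hα h.le, indicator_of_mem (by exact h)]
    field_simp
  · have : Ioo t 1 ∩ Iio x = ∅ := by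
      ext y; simp only [mem_inter_iff, mem_Ioo, mem_Iio, mem_empty_iff_false, iff_false]
      rintro ⟨h1, h2⟩; exact h (h1.1.trans h2)
    rw [this, indicator_of_notMem (by exact h)]
    simp

lemma integrableOn_leftAbel {α : ℝ} (hα : α < 2) {f : ℝ → ℝ} (hf : IntegrableOn f (Ioo 0 1)) :
    IntegrableOn (leftAbel α f) (Ioo 0 1) := by
  have := integrable_leftAbel_mul (g := fun _ => 1) (integrable_abelKernel_mul_bdd hα hf
    (g := fun _ => 1) measurable_const (C := 1) (by simp) 1)
  simpa using this

/-! ### Abel integrals of a Jacobi weight times a polynomial -/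

lemma integrableOn_rho_mul {a b : ℝ} (ha : -1 < a) (hb : -1 < b) {g : ℝ → ℝ} (hg : Continuous g) :
    IntegrableOn (fun t => rho a b t * g t) (Ioo 0 1) := by
  obtain ⟨C, hC⟩ := (isCompact_Icc (a := (0 : ℝ)) (b := 1)).exists_bound_of_continuousOn
    hg.continuousOn
  refine Integrable.mul_bdd (c := C) (integrableOn_rho ha hb) hg.aestronglyMeasurable ?_
  filter_upwards [ae_restrict_mem measurableSet_Ioo] with x hx
  exact hC x ⟨hx.1.le, hx.2.le⟩

lemma continuousOn_rho (a b : ℝ) : ContinuousOn (rho a b) (Ioo 0 1) := by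
  intro x hx
  have h : (1 : ℝ) - x ≠ 0 := by linarith [hx.2]
  exact ((ContinuousAt.rpow_const (by fun_prop) (Or.inl h)).mul
    (ContinuousAt.rpow_const continuousAt_id (Or.inl hx.1.ne'))).continuousWithinAt

lemma intervalIntegrable_leftAbel {α : ℝ} (hα : α < 2) {f : ℝ → ℝ}
    (hf : IntegrableOn f (Ioo 0 1)) (hc : ContinuousOn f (Ioo 0 1)) {x : ℝ}
    (hx : x ∈ Ioo (0 : ℝ) 1) :
    IntervalIntegrable (fun t => 1 / (x - t) ^ (α - 1) * f t) volume 0 x := by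
  obtain ⟨h0, h1⟩ := hx
  have hx2 : x / 2 < x := by linarith
  have hx0 : 0 < x / 2 := by linarith
  refine IntervalIntegrable.trans (b := x / 2) ?_ ?_
  · refine IntervalIntegrable.continuousOn_mul ?_ ?_
    · rw [intervalIntegrable_iff_integrableOn_Ioo_of_le hx0.le]
      exact hf.mono_set (Ioo_subset_Ioo_right (by linarith))
    · intro t ht
      rw [uIcc_of_le hx0.le] at ht
      have h : 0 < x - t := by linarith [ht.2]
      refine ContinuousAt.continuousWithinAt ?_
      exact continuousAt_const.div (ContinuousAt.rpow_const (by fun_prop) (Or.inl h.ne'))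
        (Real.rpow_pos_of_pos h _).ne'
  · refine IntervalIntegrable.mul_continuousOn ?_ ?_
    · have h := (intervalIntegral.intervalIntegrable_rpow' (a := x / 2) (b := 0) (r := 1 - α)
        (by linarith)).comp_sub_left x
      rw [sub_zero, show x - x / 2 = x / 2 by ring,
        intervalIntegrable_iff_integrableOn_Ioo_of_le hx2.le] at h
      rw [intervalIntegrable_iff_integrableOn_Ioo_of_le hx2.le]
      refine h.congr_fun (fun t ht => ?_) measurableSet_Ioo
      simp only [show 1 - α = -(α - 1) by ring]
      rw [Real.rpow_neg (by linarith [ht.2]), one_div]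
    · rw [uIcc_of_le hx2.le]
      exact hc.mono fun t ht => ⟨by linarith [ht.1], by linarith [ht.2]⟩

lemma leftAbel_add {α : ℝ} (hα : α < 2) {f g : ℝ → ℝ}
    (hf : IntegrableOn f (Ioo 0 1)) (hfc : ContinuousOn f (Ioo 0 1))
    (hg : IntegrableOn g (Ioo 0 1)) (hgc : ContinuousOn g (Ioo 0 1)) {x : ℝ}
    (hx : x ∈ Ioo (0 : ℝ) 1) :
    leftAbel α (fun t => f t + g t) x = leftAbel α f x + leftAbel α g x := by
  simp only [leftAbel]
  rw [← intervalIntegral.integral_add (intervalIntegrable_leftAbel hα hf hfc hx)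
    (intervalIntegrable_leftAbel hα hg hgc hx)]
  simp only [mul_add]

lemma leftAbel_const_mul (α c : ℝ) (f : ℝ → ℝ) (x : ℝ) :
    leftAbel α (fun t => c * f t) x = c * leftAbel α f x := by
  simp only [leftAbel]
  rw [← intervalIntegral.integral_const_mul]
  simp only [mul_left_comm c]

lemma integrableOn_comp_one_sub {f : ℝ → ℝ} (hf : IntegrableOn f (Ioo 0 1)) :
    IntegrableOn (fun t => f (1 - t)) (Ioo 0 1) := by
  rw [← intervalIntegrable_iff_integrableOn_Ioo_of_le zero_le_one] at hf ⊢
  simpa using (hf.comp_sub_left 1).symm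

lemma one_sub_mem_Ioo {x : ℝ} (hx : x ∈ Ioo (0 : ℝ) 1) : 1 - x ∈ Ioo (0 : ℝ) 1 :=
  ⟨by linarith [hx.2], by linarith [hx.1]⟩

lemma continuousOn_comp_one_sub {f : ℝ → ℝ} (hf : ContinuousOn f (Ioo 0 1)) :
    ContinuousOn (fun t => f (1 - t)) (Ioo 0 1) :=
  hf.comp (by fun_prop) fun _ => one_sub_mem_Ioo

lemma rightAbel_add {α : ℝ} (hα : α < 2) {f g : ℝ → ℝ}
    (hf : IntegrableOn f (Ioo 0 1)) (hfc : ContinuousOn f (Ioo 0 1))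
    (hg : IntegrableOn g (Ioo 0 1)) (hgc : ContinuousOn g (Ioo 0 1)) {x : ℝ}
    (hx : x ∈ Ioo (0 : ℝ) 1) :
    rightAbel α (fun t => f t + g t) x = rightAbel α f x + rightAbel α g x := by
  simp only [rightAbel_eq_leftAbel]
  exact leftAbel_add hα (integrableOn_comp_one_sub hf) (continuousOn_comp_one_sub hfc)
    (integrableOn_comp_one_sub hg) (continuousOn_comp_one_sub hgc) (one_sub_mem_Ioo hx)

lemma rightAbel_const_mul (α c : ℝ) (f : ℝ → ℝ) (x : ℝ) :
    rightAbel α (fun t => c * f t) x = c * rightAbel α f x := by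
  simp only [rightAbel_eq_leftAbel, leftAbel_const_mul]

/-- The commutation relation of the Abel integral with multiplication by the variable:
`t = x - (x - t)`, and the kernel `(x - t)^{2-α}` is a primitive of `(2 - α) (x - t)^{1-α}`. -/
lemma hasDerivAt_leftAbel_id_mul {α : ℝ} (hα : α < 2) {f : ℝ → ℝ}
    (hf : IntegrableOn f (Ioo 0 1)) (hc : ContinuousOn f (Ioo 0 1))
    (hd : ∀ x ∈ Ioo (0 : ℝ) 1, DifferentiableAt ℝ (leftAbel α f) x) {x : ℝ}
    (hx : x ∈ Ioo (0 : ℝ) 1) :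
    HasDerivAt (leftAbel α fun t => t * f t)
      (x * deriv (leftAbel α f) x + (α - 1) * leftAbel α f x) x := by
  have hA := integrableOn_leftAbel hα hf
  have heq : leftAbel α (fun t => t * f t) =ᶠ[𝓝 x] fun x =>
      x * leftAbel α f x - (2 - α) * ∫ y in (0 : ℝ)..x, leftAbel α f y := by
    filter_upwards [Ioo_mem_nhds hx.1 hx.2] with z hz
    have hi := intervalIntegrable_leftAbel hα hf hc hz
    have hi2 : IntervalIntegrable (fun t => (z - t) ^ (2 - α) * f t) volume 0 z := by
      refine IntervalIntegrable.continuousOn_mul ?_ ?_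
      · rw [intervalIntegrable_iff_integrableOn_Ioo_of_le hz.1.le]
        exact hf.mono_set (Ioo_subset_Ioo_right hz.2.le)
      · exact ContinuousOn.rpow_const (by fun_prop) fun _ _ => Or.inr (by linarith)
    rw [integral_leftAbel hα hf hz]
    simp only [leftAbel]
    rw [← intervalIntegral.integral_const_mul,
      ← intervalIntegral.integral_sub (hi.const_mul z) hi2,
      intervalIntegral.integral_of_le hz.1.le, intervalIntegral.integral_of_le hz.1.le,
      integral_Ioc_eq_integral_Ioo, integral_Ioc_eq_integral_Ioo]
    refine setIntegral_congr_fun measurableSet_Ioo fun t ht => ?_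
    have hp : 0 < z - t := by linarith [ht.2]
    have e : (z - t) ^ (2 - α) * (z - t) ^ (α - 1) = z - t := by
      rw [← Real.rpow_add hp]; norm_num
    have p1 := Real.rpow_pos_of_pos hp (α - 1)
    field_simp
    linear_combination (f t) * e
  have hcont : ContinuousAt (leftAbel α f) x := (hd x hx).continuousAt
  have hint : IntervalIntegrable (leftAbel α f) volume 0 x := by
    rw [intervalIntegrable_iff_integrableOn_Ioo_of_le hx.1.le]
    exact hA.mono_set (Ioo_subset_Ioo_right hx.2.le)
  have hftc := intervalIntegral.integral_hasDerivAt_right hint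
    ⟨Ioo 0 1, Ioo_mem_nhds hx.1 hx.2, hA.1⟩ hcont
  have h2 := ((hasDerivAt_id x).mul (hd x hx).hasDerivAt).sub (hftc.const_mul (2 - α))
  refine (h2.congr_of_eventuallyEq heq).congr_deriv ?_
  simp only [id_eq]
  ring

lemma hasDerivAt_rightAbel {α : ℝ} {f : ℝ → ℝ} {D x : ℝ}
    (h : HasDerivAt (leftAbel α fun t => f (1 - t)) D (1 - x)) :
    HasDerivAt (rightAbel α f) (-D) x := by
  have h1 := h.comp_const_sub 1 x
  exact h1.congr_of_eventuallyEq (Eventually.of_forall fun z => rightAbel_eq_leftAbel α f z)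

lemma hasDerivAt_leftAbel_comp_one_sub {α : ℝ} {f : ℝ → ℝ} {x : ℝ}
    (h : DifferentiableAt ℝ (rightAbel α f) (1 - x)) :
    HasDerivAt (leftAbel α fun t => f (1 - t)) (-deriv (rightAbel α f) (1 - x)) x := by
  have h1 := h.hasDerivAt.comp_const_sub 1 x
  refine h1.congr_of_eventuallyEq (Eventually.of_forall fun z => ?_)
  simp only [rightAbel_eq_leftAbel, sub_sub_cancel]

lemma hasDerivAt_rightAbel_id_mul {α : ℝ} (hα : α < 2) {f : ℝ → ℝ}
    (hf : IntegrableOn f (Ioo 0 1)) (hc : ContinuousOn f (Ioo 0 1))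
    (hd : ∀ x ∈ Ioo (0 : ℝ) 1, DifferentiableAt ℝ (rightAbel α f) x) {x : ℝ}
    (hx : x ∈ Ioo (0 : ℝ) 1) :
    HasDerivAt (rightAbel α fun t => t * f t)
      (x * deriv (rightAbel α f) x + (α - 1) * rightAbel α f x) x := by
  have hf' := integrableOn_comp_one_sub hf
  have hc' := continuousOn_comp_one_sub hc
  have hd' : ∀ z ∈ Ioo (0 : ℝ) 1, HasDerivAt (leftAbel α fun t => f (1 - t))
      (-deriv (rightAbel α f) (1 - z)) z := fun z hz =>
    hasDerivAt_leftAbel_comp_one_sub (hd _ (one_sub_mem_Ioo hz))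
  have hx' := one_sub_mem_Ioo hx
  have h1 := hasDerivAt_leftAbel_id_mul hα hf' hc' (fun z hz => (hd' z hz).differentiableAt) hx'
  rw [(hd' _ hx').deriv, sub_sub_cancel, ← rightAbel_eq_leftAbel α f x] at h1
  have h2 := (hd' _ hx').sub h1
  rw [sub_sub_cancel] at h2
  have h3 : HasDerivAt (leftAbel α fun t => (1 - t) * f (1 - t))
      (-deriv (rightAbel α f) x - ((1 - x) * -deriv (rightAbel α f) x +
        (α - 1) * rightAbel α f x)) (1 - x) := by
    refine h2.congr_of_eventuallyEq ?_
    filter_upwards [Ioo_mem_nhds hx'.1 hx'.2] with z hz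
    have hm : IntegrableOn (fun t => t * f (1 - t)) (Ioo 0 1) := by
      refine Integrable.bdd_mul (c := 1) hf' (by fun_prop) ?_
      filter_upwards [ae_restrict_mem measurableSet_Ioo] with t ht
      rw [Real.norm_of_nonneg ht.1.le]; exact ht.2.le
    have h4 := leftAbel_add hα (g := fun t => -1 * (t * f (1 - t))) hf' hc' (hm.const_mul (-1))
      (continuousOn_const.mul (continuousOn_id.mul hc')) hz
    rw [leftAbel_const_mul] at h4
    simp only [Pi.sub_apply]
    rw [sub_eq_add_neg, neg_eq_neg_one_mul, ← h4]
    congr 1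
    ext t
    ring
  refine (hasDerivAt_rightAbel (f := fun t => t * f t) h3).congr_deriv ?_
  ring

/-- The function `ρ^{(a-1,b-1)} p`. -/
def wPoly (a b : ℝ) (p : Polynomial ℝ) (t : ℝ) : ℝ := rho (a - 1) (b - 1) t * p.eval t

lemma integrableOn_wPoly {a b : ℝ} (ha : 0 < a) (hb : 0 < b) (p : Polynomial ℝ) :
    IntegrableOn (wPoly a b p) (Ioo 0 1) :=
  integrableOn_rho_mul (by linarith) (by linarith) p.continuous

lemma continuousOn_wPoly (a b : ℝ) (p : Polynomial ℝ) : ContinuousOn (wPoly a b p) (Ioo 0 1) :=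
  (continuousOn_rho _ _).mul p.continuous.continuousOn

lemma wPoly_add (a b : ℝ) (p q : Polynomial ℝ) :
    wPoly a b (p + q) = fun t => wPoly a b p t + wPoly a b q t := by
  ext t; simp [wPoly, mul_add]

lemma wPoly_C_mul (a b c : ℝ) (p : Polynomial ℝ) :
    wPoly a b (Polynomial.C c * p) = fun t => c * wPoly a b p t := by
  ext t; simp [wPoly, mul_left_comm]

lemma wPoly_X_mul (a b : ℝ) (p : Polynomial ℝ) :
    wPoly a b (Polynomial.X * p) = fun t => t * wPoly a b p t := by
  ext t; simp [wPoly, mul_left_comm]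

lemma wPoly_one (a b : ℝ) : wPoly a b 1 = rho (a - 1) (b - 1) := by
  ext t; simp [wPoly]

lemma wPoly_one_sub (a b : ℝ) (p : Polynomial ℝ) :
    (fun t => wPoly a b p (1 - t)) = wPoly b a (p.comp (1 - Polynomial.X)) := by
  ext t; simp [wPoly, rho_one_sub]

lemma differentiableAt_leftAbel_wPoly {a b : ℝ} (ha : 0 < a) (ha1 : a ≤ 1) (hb : 0 < b)
    (hab : a + b < 2) (p : Polynomial ℝ) :
    ∀ x ∈ Ioo (0 : ℝ) 1, DifferentiableAt ℝ (leftAbel (a + b) (wPoly a b p)) x := by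
  have hC : ∀ (c : ℝ) (p : Polynomial ℝ),
      (∀ x ∈ Ioo (0 : ℝ) 1, DifferentiableAt ℝ (leftAbel (a + b) (wPoly a b p)) x) →
      ∀ x ∈ Ioo (0 : ℝ) 1,
        DifferentiableAt ℝ (leftAbel (a + b) (wPoly a b (Polynomial.C c * p))) x := by
    intro c p hp x hx
    refine ((hp x hx).const_mul c).congr_of_eventuallyEq (Eventually.of_forall fun z => ?_)
    rw [wPoly_C_mul, leftAbel_const_mul]
  have hXn : ∀ n : ℕ, ∀ x ∈ Ioo (0 : ℝ) 1,
      DifferentiableAt ℝ (leftAbel (a + b) (wPoly a b (Polynomial.X ^ n))) x := by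
    intro n
    induction n with
    | zero =>
      intro x hx
      rw [pow_zero, wPoly_one]
      exact (hasDerivAt_leftAbel_rho ha1 hb hab hx).differentiableAt
    | succ n ih =>
      intro x hx
      rw [pow_succ', wPoly_X_mul]
      exact (hasDerivAt_leftAbel_id_mul hab (integrableOn_wPoly ha hb _)
        (continuousOn_wPoly a b _) ih hx).differentiableAt
  induction p using Polynomial.induction_on' with
  | add p q hp hq =>
    intro x hx
    refine ((hp x hx).add (hq x hx)).congr_of_eventuallyEq ?_
    filter_upwards [Ioo_mem_nhds hx.1 hx.2] with z hz
    rw [wPoly_add]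
    exact leftAbel_add hab (integrableOn_wPoly ha hb _) (continuousOn_wPoly a b _)
      (integrableOn_wPoly ha hb _) (continuousOn_wPoly a b _) hz
  | monomial n c =>
    rw [← Polynomial.C_mul_X_pow_eq_monomial]
    exact hC c _ (hXn n)

lemma differentiableAt_rightAbel_wPoly {a b : ℝ} (ha : 0 < a) (hb : 0 < b) (hb1 : b ≤ 1)
    (hab : a + b < 2) (p : Polynomial ℝ) :
    ∀ x ∈ Ioo (0 : ℝ) 1, DifferentiableAt ℝ (rightAbel (a + b) (wPoly a b p)) x := by
  intro x hx
  have h := differentiableAt_leftAbel_wPoly hb hb1 ha (by linarith)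
    (p.comp (1 - Polynomial.X)) (1 - x) (one_sub_mem_Ioo hx)
  rw [← wPoly_one_sub, add_comm b a] at h
  exact (hasDerivAt_rightAbel h.hasDerivAt).differentiableAt

/-! ### The two-sided Abel operator preserves polynomials -/

/-- The admissible parameters, with `a = α - β` and `b = β`. The condition on `r` is in the form
in which it is used; it is invariant under exchanging `a`, `b` and replacing `r` by `1 - r`. -/
structure Params (a b r : ℝ) : Prop where
  a_pos : 0 < a
  a_le : a ≤ 1
  b_pos : 0 < b
  b_le : b ≤ 1
  one_lt : 1 < a + b
  lt_two : a + b < 2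
  r_nonneg : 0 ≤ r
  r_le : r ≤ 1
  eq : r * Real.sin (Real.pi * a) = (1 - r) * Real.sin (Real.pi * b)

lemma Params.symm {a b r : ℝ} (P : Params a b r) : Params b a (1 - r) where
  a_pos := P.b_pos
  a_le := P.b_le
  b_pos := P.a_pos
  b_le := P.a_le
  one_lt := by linarith [P.one_lt]
  lt_two := by linarith [P.lt_two]
  r_nonneg := by linarith [P.r_le]
  r_le := by linarith [P.r_nonneg]
  eq := by rw [sub_sub_cancel]; exact P.eq.symm

/-- `Γ(2-α)` times the two-sided flux: `r ∫₀ˣ (x-t)^{1-α} f + (1-r) ∫ₓ¹ (t-x)^{1-α} f`. -/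
def twoAbel (α r : ℝ) (f : ℝ → ℝ) (x : ℝ) : ℝ := r * leftAbel α f x + (1 - r) * rightAbel α f x

lemma twoAbel_add {α r : ℝ} (hα : α < 2) {f g : ℝ → ℝ}
    (hf : IntegrableOn f (Ioo 0 1)) (hfc : ContinuousOn f (Ioo 0 1))
    (hg : IntegrableOn g (Ioo 0 1)) (hgc : ContinuousOn g (Ioo 0 1)) {x : ℝ}
    (hx : x ∈ Ioo (0 : ℝ) 1) :
    twoAbel α r (fun t => f t + g t) x = twoAbel α r f x + twoAbel α r g x := by
  simp only [twoAbel, leftAbel_add hα hf hfc hg hgc hx, rightAbel_add hα hf hfc hg hgc hx]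
  ring

lemma twoAbel_const_mul (α r c : ℝ) (f : ℝ → ℝ) (x : ℝ) :
    twoAbel α r (fun t => c * f t) x = c * twoAbel α r f x := by
  simp only [twoAbel, leftAbel_const_mul, rightAbel_const_mul]
  ring

/-- The constant of the Abel integral of the weight. Euler's reflection formula gives it a form
that also holds for `a = 1`, where both sides vanish. -/
lemma one_sub_mul_integral_rho {a b : ℝ} (ha : 0 < a) (ha1 : a ≤ 1) (hb : 0 < b)
    (hab : a + b < 2) :
    (1 - a) * (∫ s in Ioo (0 : ℝ) 1, rho (1 - (a + b)) (b - 1) s) =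
      Real.Gamma (2 - (a + b)) * Real.Gamma a * Real.Gamma b * Real.sin (Real.pi * a)
        / Real.pi := by
  rw [integral_rho (by linarith) (by linarith), show (1 : ℝ) - (a + b) + 1 = 2 - (a + b) by ring,
    show b - 1 + 1 = b by ring, show (1 : ℝ) - (a + b) + (b - 1) + 2 = 2 - a by ring]
  rcases ha1.eq_or_lt with rfl | h
  · simp
  · have h0 : (1 : ℝ) - a ≠ 0 := by linarith
    have hG : Real.Gamma (2 - a) = (1 - a) * Real.Gamma (1 - a) := by
      rw [← Real.Gamma_add_one h0]; ring_nf
    have hG1 : 0 < Real.Gamma (1 - a) := Real.Gamma_pos_of_pos (by linarith)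
    have hs : 0 < Real.sin (Real.pi * a) :=
      Real.sin_pos_of_pos_of_lt_pi (by positivity) (by nlinarith [Real.pi_pos])
    have hrefl := Real.Gamma_mul_Gamma_one_sub a
    rw [eq_div_iff hs.ne'] at hrefl
    have hpi := Real.pi_pos
    rw [hG]
    field_simp
    rw [mul_comm a Real.pi]
    linear_combination (Real.Gamma (2 - (a + b))) * (-hrefl)

lemma leftAbel_rho_pos {a b : ℝ} (hb : 0 < b) (ha : 0 < a) (hab : a + b < 2) {x : ℝ}
    (hx : x ∈ Ioo (0 : ℝ) 1) : 0 < leftAbel (a + b) (rho (a - 1) (b - 1)) x := by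
  refine intervalIntegral.intervalIntegral_pos_of_pos_on ?_ ?_ hx.1
  · exact intervalIntegrable_leftAbel hab (integrableOn_rho (by linarith) (by linarith))
      (continuousOn_rho _ _) hx
  · intro t ht
    have h : 0 < x - t := by linarith [ht.2]
    have h2 : t ∈ Ioo (0 : ℝ) 1 := ⟨ht.1, ht.2.trans hx.2⟩
    exact mul_pos (div_pos one_pos (Real.rpow_pos_of_pos h _)) (rho_pos h2)

lemma rightAbel_rho_eq (a b x : ℝ) :
    rightAbel (a + b) (rho (a - 1) (b - 1)) x =
      leftAbel (b + a) (rho (b - 1) (a - 1)) (1 - x) := by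
  rw [rightAbel_eq_leftAbel, add_comm b a]
  simp only [rho_one_sub]

/-- The value of the two-sided Abel operator on the weight `ρ^{(a-1,b-1)}`, a constant function. -/
def abelConst (a b r : ℝ) : ℝ := twoAbel (a + b) r (rho (a - 1) (b - 1)) (1 / 2)

lemma Params.abelConst_pos {a b r : ℝ} (P : Params a b r) : 0 < abelConst a b r := by
  have h : (1 / 2 : ℝ) ∈ Ioo (0 : ℝ) 1 := by constructor <;> norm_num
  have h1 := leftAbel_rho_pos P.b_pos P.a_pos P.lt_two h
  have h2 := leftAbel_rho_pos P.a_pos P.b_pos P.symm.lt_two (one_sub_mem_Ioo h)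
  rw [← rightAbel_rho_eq] at h2
  rw [abelConst, twoAbel]
  rcases P.r_nonneg.eq_or_lt with h0 | h0
  · rw [← h0]; simpa using h2
  · exact add_pos_of_pos_of_nonneg (mul_pos h0 h1)
      (mul_nonneg (by linarith [P.r_le]) h2.le)

/-- The weight `ρ^{(a-1,b-1)}` solves the generalised Abel equation with constant right-hand side:
the derivatives of its left and right Abel integral are both multiples of `ρ^{(-b,-a)}`, and the
condition on `r` makes them cancel. -/
lemma Params.twoAbel_rho {a b r : ℝ} (P : Params a b r) {x : ℝ} (hx : x ∈ Ioo (0 : ℝ) 1) :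
    twoAbel (a + b) r (rho (a - 1) (b - 1)) x = abelConst a b r := by
  have hder : ∀ z ∈ Ioo (0 : ℝ) 1,
      HasDerivAt (twoAbel (a + b) r (rho (a - 1) (b - 1))) 0 z := by
    intro z hz
    have h1 := hasDerivAt_leftAbel_rho P.a_le P.b_pos P.lt_two hz
    have h2 := hasDerivAt_leftAbel_rho P.b_le P.a_pos P.symm.lt_two (one_sub_mem_Ioo hz)
    have h3 := h2.comp_const_sub 1 z
    have h4 : HasDerivAt (rightAbel (a + b) (rho (a - 1) (b - 1))) _ z :=
      h3.congr_of_eventuallyEq (Eventually.of_forall fun y => rightAbel_rho_eq a b y)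
    have h5 := (h1.const_mul r).add (h4.const_mul (1 - r))
    refine h5.congr_deriv ?_
    rw [one_sub_mul_integral_rho P.a_pos P.a_le P.b_pos P.lt_two,
      one_sub_mul_integral_rho P.b_pos P.b_le P.a_pos P.symm.lt_two, rho_one_sub, add_comm b a]
    linear_combination (Real.Gamma (2 - (a + b)) * Real.Gamma a * Real.Gamma b
        / Real.pi * rho (-b) (-a) z) * P.eq
  exact isOpen_Ioo.is_const_of_deriv_eq_zero isPreconnected_Ioo
    (fun z hz => (hder z hz).differentiableAt.differentiableWithinAt)
    (fun z hz => (hder z hz).deriv) hx (by constructor <;> norm_num)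

lemma exists_natDegree_le_derivative_eq (n : ℕ) (S : Polynomial ℝ) (hS : S.natDegree ≤ n) :
    ∃ R : Polynomial ℝ, R.natDegree ≤ n + 1 ∧ R.derivative = S ∧
      R.coeff (n + 1) = S.coeff n / (n + 1) := by
  obtain ⟨R, hR1, hR2⟩ : ∃ R : Polynomial ℝ, R.natDegree ≤ n + 1 ∧ R.derivative = S := by
    refine ⟨∑ i ∈ Finset.range (n + 1), Polynomial.C (S.coeff i / (i + 1)) * Polynomial.X ^ (i + 1),
      ?_, ?_⟩
    · refine Polynomial.natDegree_sum_le_of_forall_le _ _ fun i hi => ?_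
      refine (Polynomial.natDegree_C_mul_X_pow_le _ _).trans ?_
      have := Finset.mem_range.1 hi
      omega
    · conv_rhs => rw [Polynomial.as_sum_range_C_mul_X_pow' S (Nat.lt_succ_of_le hS)]
      rw [Polynomial.derivative_sum]
      refine Finset.sum_congr rfl fun i _ => ?_
      rw [Polynomial.derivative_C_mul_X_pow]
      have : (i : ℝ) + 1 ≠ 0 := by positivity
      congr 2
      push_cast
      field_simp
  refine ⟨R, hR1, hR2, ?_⟩
  have h := Polynomial.coeff_derivative R n
  rw [hR2] at h
  rw [h]
  have : (n : ℝ) + 1 ≠ 0 := by positivity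
  field_simp

/-- The factor by which the two-sided Abel operator multiplies the coefficient of `x^n` of a
polynomial of degree `n`, relative to its value at `n = 0`: the number `(α-1)_n / n!`. -/
def abelFactor (α : ℝ) (n : ℕ) : ℝ := ∏ j ∈ Finset.range n, (α - 1 + j) / (j + 1)

lemma abelFactor_succ (α : ℝ) (n : ℕ) :
    abelFactor α (n + 1) = abelFactor α n * ((α - 1 + n) / (n + 1)) :=
  Finset.prod_range_succ _ _

lemma Params.hasDerivAt_twoAbel_X_mul {a b r : ℝ} (P : Params a b r) (p : Polynomial ℝ) {x : ℝ}
    (hx : x ∈ Ioo (0 : ℝ) 1) :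
    HasDerivAt (twoAbel (a + b) r (wPoly a b (Polynomial.X * p)))
      (x * deriv (twoAbel (a + b) r (wPoly a b p)) x +
        (a + b - 1) * twoAbel (a + b) r (wPoly a b p) x) x := by
  have hi := integrableOn_wPoly P.a_pos P.b_pos p
  have hc := continuousOn_wPoly a b p
  have dl := differentiableAt_leftAbel_wPoly P.a_pos P.a_le P.b_pos P.lt_two p
  have dr := differentiableAt_rightAbel_wPoly P.a_pos P.b_pos P.b_le P.lt_two p
  have h1 := hasDerivAt_leftAbel_id_mul P.lt_two hi hc dl hx
  have h2 := hasDerivAt_rightAbel_id_mul P.lt_two hi hc dr hx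
  have h3 : HasDerivAt (twoAbel (a + b) r (wPoly a b p)) _ x :=
    ((dl x hx).hasDerivAt.const_mul r).add ((dr x hx).hasDerivAt.const_mul (1 - r))
  rw [wPoly_X_mul]
  refine ((h1.const_mul r).add (h2.const_mul (1 - r))).congr_deriv ?_
  rw [h3.deriv, twoAbel]
  ring

/-- The two-sided Abel operator maps `ρ^{(a-1,b-1)}` times a polynomial of degree at most `n` to a
polynomial of degree at most `n`, and acts on the top coefficients by a nonzero factor. -/
theorem Params.exists_twoAbel_wPoly {a b r : ℝ} (P : Params a b r) (n : ℕ) :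
    ∀ p : Polynomial ℝ, p.natDegree ≤ n → ∃ Q : Polynomial ℝ, Q.natDegree ≤ n ∧
      Q.coeff n = abelConst a b r * abelFactor (a + b) n * p.coeff n ∧
      ∀ x ∈ Ioo (0 : ℝ) 1, twoAbel (a + b) r (wPoly a b p) x = Q.eval x := by
  have hconst : ∀ (c : ℝ), ∀ x ∈ Ioo (0 : ℝ) 1,
      twoAbel (a + b) r (wPoly a b (Polynomial.C c)) x = c * abelConst a b r := by
    intro c x hx
    have := wPoly_C_mul a b c 1
    rw [mul_one] at this
    rw [this, twoAbel_const_mul, wPoly_one, P.twoAbel_rho hx]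
  induction n with
  | zero =>
    intro p hp
    obtain ⟨c, rfl⟩ := Polynomial.natDegree_eq_zero.1 (Nat.le_zero.1 hp)
    refine ⟨Polynomial.C (c * abelConst a b r), (Polynomial.natDegree_C _).le,
      by simp [abelFactor, mul_comm], ?_⟩
    intro x hx
    rw [hconst c x hx, Polynomial.eval_C]
  | succ n ih =>
    intro p hp
    set q := p.divX with hq
    have hqd : q.natDegree ≤ n := by
      rw [hq, Polynomial.natDegree_divX_eq_natDegree_tsub_one]; omega
    have hpq : p = Polynomial.X * q + Polynomial.C (p.coeff 0) := by
      conv_lhs => rw [← Polynomial.divX_mul_X_add p, mul_comm]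
    obtain ⟨Q, hQd, hQc, hQ⟩ := ih q hqd
    -- `S` is the derivative of the image of `ρ^{(a-1,b-1)} X q`, by the commutation relation
    set S : Polynomial ℝ := Polynomial.X * Q.derivative + Polynomial.C (a + b - 1) * Q with hS
    have hSd : S.natDegree ≤ n := by
      refine Polynomial.natDegree_add_le_of_degree_le ?_ ?_
      · rcases Nat.eq_zero_or_pos n with rfl | hn
        · obtain ⟨c, rfl⟩ := Polynomial.natDegree_eq_zero.1 (Nat.le_zero.1 hQd)
          simp
        · refine Polynomial.natDegree_mul_le.trans ?_
          have := Polynomial.natDegree_derivative_le Q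
          rw [Polynomial.natDegree_X]
          omega
      · exact (Polynomial.natDegree_C_mul_le _ _).trans hQd
    have hSc : S.coeff n = (a + b - 1 + n) * Q.coeff n := by
      rw [hS, Polynomial.coeff_add, Polynomial.coeff_C_mul]
      cases n with
      | zero => simp
      | succ m =>
        rw [Polynomial.coeff_X_mul, Polynomial.coeff_derivative]
        push_cast; ring
    obtain ⟨R, hRd, hRS, hRc⟩ := exists_natDegree_le_derivative_eq n S hSd
    have hder : ∀ x ∈ Ioo (0 : ℝ) 1, HasDerivAt
        (fun x => twoAbel (a + b) r (wPoly a b (Polynomial.X * q)) x - R.eval x) 0 x := by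
      intro x hx
      have h1 := P.hasDerivAt_twoAbel_X_mul q hx
      have h2 : deriv (twoAbel (a + b) r (wPoly a b q)) x = Q.derivative.eval x := by
        have : twoAbel (a + b) r (wPoly a b q) =ᶠ[𝓝 x] fun x => Q.eval x := by
          filter_upwards [Ioo_mem_nhds hx.1 hx.2] with z hz using hQ z hz
        rw [this.deriv_eq, Polynomial.deriv]
      refine (h1.sub (R.hasDerivAt x)).congr_deriv ?_
      rw [h2, hQ x hx, hRS, hS]
      simp
    set k := twoAbel (a + b) r (wPoly a b (Polynomial.X * q)) (1 / 2) - R.eval (1 / 2) with hk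
    have hR : ∀ x ∈ Ioo (0 : ℝ) 1,
        twoAbel (a + b) r (wPoly a b (Polynomial.X * q)) x - R.eval x = k := fun x hx =>
      isOpen_Ioo.is_const_of_deriv_eq_zero isPreconnected_Ioo
        (fun z hz => (hder z hz).differentiableAt.differentiableWithinAt)
        (fun z hz => (hder z hz).deriv) hx (by constructor <;> norm_num)
    refine ⟨R + Polynomial.C (k + p.coeff 0 * abelConst a b r), ?_, ?_, ?_⟩
    · exact Polynomial.natDegree_add_le_of_degree_le hRd
        ((Polynomial.natDegree_C _).le.trans (Nat.zero_le _))
    · rw [Polynomial.coeff_add, Polynomial.coeff_C_succ, add_zero, hRc, hSc, hQc, abelFactor_succ,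
        hq, Polynomial.coeff_divX]
      ring
    · intro x hx
      have h1 := hR x hx
      have h2 := hconst (p.coeff 0) x hx
      conv_lhs => rw [hpq, wPoly_add]
      rw [twoAbel_add P.lt_two (integrableOn_wPoly P.a_pos P.b_pos _) (continuousOn_wPoly a b _)
        (integrableOn_wPoly P.a_pos P.b_pos _) (continuousOn_wPoly a b _) hx, h2]
      simp only [Polynomial.eval_add, Polynomial.eval_C]
      linarith

/-! ### The fractional operator on weighted polynomials -/

lemma rho_zero {a b : ℝ} (hb : b ≠ 0) : rho a b 0 = 0 := by simp [rho, hb]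

lemma rho_one {a b : ℝ} (ha : a ≠ 0) : rho a b 1 = 0 := by simp [rho, ha]

lemma continuous_rho {a b : ℝ} (ha : 0 ≤ a) (hb : 0 ≤ b) : Continuous (rho a b) := by
  unfold rho
  exact (Continuous.rpow_const (by fun_prop) fun _ => Or.inr ha).mul
    (Continuous.rpow_const (by fun_prop) fun _ => Or.inr hb)

/-- The function `q` in `(ρ^{(a,b)} g)' = ρ^{(a-1,b-1)} q`. -/
def wDiff (a b : ℝ) (g : ℝ → ℝ) (t : ℝ) : ℝ :=
  (b * (1 - t) - a * t) * g t + t * (1 - t) * deriv g t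

lemma hasDerivAt_rho_mul (a b : ℝ) {g : ℝ → ℝ} {t : ℝ} (ht : t ∈ Ioo (0 : ℝ) 1)
    (hg : DifferentiableAt ℝ g t) :
    HasDerivAt (fun t => rho a b t * g t) (rho (a - 1) (b - 1) t * wDiff a b g t) t := by
  have h1 : 0 < 1 - t := by linarith [ht.2]
  have d1 : HasDerivAt (fun t : ℝ => (1 - t) ^ a) (-1 * a * (1 - t) ^ (a - 1)) t :=
    ((hasDerivAt_id t).const_sub 1).rpow_const (Or.inl h1.ne')
  have d2 : HasDerivAt (fun t : ℝ => t ^ b) (b * t ^ (b - 1)) t :=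
    Real.hasDerivAt_rpow_const (Or.inl ht.1.ne')
  refine ((d1.mul d2).mul hg.hasDerivAt).congr_deriv ?_
  have e1 : (1 - t) ^ a = (1 - t) ^ (a - 1) * (1 - t) := by
    rw [← Real.rpow_add_one h1.ne']; ring_nf
  have e2 : t ^ b = t ^ (b - 1) * t := by
    rw [← Real.rpow_add_one ht.1.ne']; ring_nf
  simp only [rho, wDiff, Pi.mul_apply]
  rw [e1, e2]
  ring

/-- `wDiff` on polynomials, see `wDiff_eval`. -/
def polyDiff (a b : ℝ) (p : Polynomial ℝ) : Polynomial ℝ :=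
  (Polynomial.C b - Polynomial.C (a + b) * Polynomial.X) * p +
    (Polynomial.X - Polynomial.X ^ 2) * p.derivative

lemma wDiff_eval (a b : ℝ) (p : Polynomial ℝ) :
    wDiff a b (fun t => p.eval t) = fun t => (polyDiff a b p).eval t := by
  ext t
  simp only [wDiff, polyDiff, Polynomial.deriv, Polynomial.eval_add, Polynomial.eval_mul,
    Polynomial.eval_sub, Polynomial.eval_C, Polynomial.eval_X, Polynomial.eval_pow]
  ring

lemma polyDiff_natDegree_le (a b : ℝ) {n : ℕ} {p : Polynomial ℝ} (hp : p.natDegree ≤ n) :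
    (polyDiff a b p).natDegree ≤ n + 1 := by
  have h1 : (Polynomial.C b - Polynomial.C (a + b) * Polynomial.X).natDegree ≤ 1 := by
    compute_degree
  have h2 : (Polynomial.X - Polynomial.X ^ 2 : Polynomial ℝ).natDegree ≤ 2 := by compute_degree
  refine Polynomial.natDegree_add_le_of_degree_le ?_ ?_
  · exact Polynomial.natDegree_mul_le.trans (by omega)
  · rcases Nat.eq_zero_or_pos n with rfl | hn
    · obtain ⟨c, rfl⟩ := Polynomial.natDegree_eq_zero.1 (Nat.le_zero.1 hp)
      simp
    · have := Polynomial.natDegree_derivative_le p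
      exact Polynomial.natDegree_mul_le.trans (by omega)

lemma polyDiff_coeff (a b : ℝ) {n : ℕ} {p : Polynomial ℝ} (hp : p.natDegree ≤ n) :
    (polyDiff a b p).coeff (n + 1) = -(a + b + n) * p.coeff n := by
  have h0 : p.coeff (n + 1) = 0 := Polynomial.coeff_eq_zero_of_natDegree_lt (by omega)
  have h0' : p.derivative.coeff n = 0 := by rw [Polynomial.coeff_derivative, h0, zero_mul]
  rw [polyDiff, Polynomial.coeff_add, sub_mul, sub_mul, Polynomial.coeff_sub, Polynomial.coeff_sub,
    Polynomial.coeff_C_mul, mul_assoc, Polynomial.coeff_C_mul, Polynomial.coeff_X_mul,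
    Polynomial.coeff_X_mul, h0, h0', pow_two, mul_assoc, Polynomial.coeff_X_mul]
  cases n with
  | zero => simp; ring
  | succ m =>
    rw [Polynomial.coeff_X_mul, Polynomial.coeff_derivative]
    push_cast; ring

lemma leftAbel_congr {α : ℝ} {f g : ℝ → ℝ} (h : ∀ t ∈ Ioo (0 : ℝ) 1, f t = g t) {x : ℝ}
    (hx : x ∈ Ioo (0 : ℝ) 1) : leftAbel α f x = leftAbel α g x := by
  rw [leftAbel_eq_integral_abelKernel α f hx, leftAbel_eq_integral_abelKernel α g hx]
  exact setIntegral_congr_fun measurableSet_Ioo fun t ht => by simp only [h t ht]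

lemma rightAbel_congr {α : ℝ} {f g : ℝ → ℝ} (h : ∀ t ∈ Ioo (0 : ℝ) 1, f t = g t) {x : ℝ}
    (hx : x ∈ Ioo (0 : ℝ) 1) : rightAbel α f x = rightAbel α g x := by
  rw [rightAbel_eq_integral_abelKernel α f hx, rightAbel_eq_integral_abelKernel α g hx]
  exact setIntegral_congr_fun measurableSet_Ioo fun t ht => by simp only [h t ht]

lemma leftFlux_eq (α : ℝ) (u : ℝ → ℝ) (x : ℝ) :
    leftFlux α u x = 1 / Real.Gamma (2 - α) * leftAbel α (deriv u) x := rfl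

lemma rightFlux_eq (α : ℝ) (u : ℝ → ℝ) (x : ℝ) :
    rightFlux α u x = 1 / Real.Gamma (2 - α) * rightAbel α (deriv u) x := rfl

/-- The operator in terms of Abel integrals of any function `f` that is the derivative of `u` on
`(0,1)`. -/
lemma fracOp_eq {α r : ℝ} {u f : ℝ → ℝ} (hu : ∀ t ∈ Ioo (0 : ℝ) 1, deriv u t = f t) {x : ℝ}
    (hx : x ∈ Ioo (0 : ℝ) 1) {D₁ D₂ : ℝ} (h1 : HasDerivAt (leftAbel α f) D₁ x)
    (h2 : HasDerivAt (rightAbel α f) D₂ x) :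
    fracOp α r u x = -(1 / Real.Gamma (2 - α) * (r * D₁ + (1 - r) * D₂)) := by
  have e1 : HasDerivAt (leftFlux α u) (1 / Real.Gamma (2 - α) * D₁) x := by
    refine (h1.const_mul _).congr_of_eventuallyEq ?_
    filter_upwards [Ioo_mem_nhds hx.1 hx.2] with z hz
    rw [leftFlux_eq, leftAbel_congr hu hz]
  have e2 : HasDerivAt (rightFlux α u) (1 / Real.Gamma (2 - α) * D₂) x := by
    refine (h2.const_mul _).congr_of_eventuallyEq ?_
    filter_upwards [Ioo_mem_nhds hx.1 hx.2] with z hz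
    rw [rightFlux_eq, rightAbel_congr hu hz]
  rw [fracOp, leftDeriv, rightDeriv, e1.deriv, e2.deriv]
  ring

lemma deriv_rho_mul_eval (a b : ℝ) (p : Polynomial ℝ) :
    ∀ t ∈ Ioo (0 : ℝ) 1,
      deriv (fun t => rho a b t * p.eval t) t = wPoly a b (polyDiff a b p) t := fun t ht => by
  rw [(hasDerivAt_rho_mul a b ht p.differentiableAt).deriv, wDiff_eval, wPoly]

/-- The factor `λ_n` by which `u = ρ^{(a,b)} p ↦ L_r^α u` multiplies the coefficient of `x^n` of a
polynomial `p` of degree `n`. -/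
def eigen (a b r : ℝ) (n : ℕ) : ℝ :=
  abelConst a b r / Real.Gamma (2 - (a + b)) *
    (abelFactor (a + b) (n + 1) * ((n + 1) * (a + b + n)))

/-- The flux of `ρ^{(a,b)} p` and hence also its image under `L_r^α` is a polynomial. -/
theorem Params.exists_fracOp_rho_mul {a b r : ℝ} (P : Params a b r) {n : ℕ} {p : Polynomial ℝ}
    (hp : p.natDegree ≤ n) :
    ∃ F : Polynomial ℝ, F.derivative.natDegree ≤ n ∧
      (-F.derivative).coeff n = eigen a b r n * p.coeff n ∧
      (∀ x ∈ Ioo (0 : ℝ) 1, 1 / Real.Gamma (2 - (a + b)) *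
        twoAbel (a + b) r (wPoly a b (polyDiff a b p)) x = F.eval x) ∧
      ∀ x ∈ Ioo (0 : ℝ) 1,
        fracOp (a + b) r (fun x => rho a b x * p.eval x) x = (-F.derivative).eval x := by
  obtain ⟨Q, hQd, hQc, hQ⟩ := P.exists_twoAbel_wPoly (n + 1) (polyDiff a b p)
    (polyDiff_natDegree_le a b hp)
  set c := 1 / Real.Gamma (2 - (a + b)) with hc
  refine ⟨Polynomial.C c * Q, ?_, ?_, ?_, ?_⟩
  · refine (Polynomial.natDegree_derivative_le _).trans ?_
    have := Polynomial.natDegree_C_mul_le c Q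
    omega
  · rw [Polynomial.coeff_neg, Polynomial.coeff_derivative, Polynomial.coeff_C_mul, hQc,
      polyDiff_coeff a b hp, eigen, hc]
    ring
  · intro x hx
    rw [hQ x hx, Polynomial.eval_mul, Polynomial.eval_C]
  · intro x hx
    have d1 := (differentiableAt_leftAbel_wPoly P.a_pos P.a_le P.b_pos P.lt_two
      (polyDiff a b p) x hx).hasDerivAt
    have d2 := (differentiableAt_rightAbel_wPoly P.a_pos P.b_pos P.b_le P.lt_two
      (polyDiff a b p) x hx).hasDerivAt
    have d3 : HasDerivAt (twoAbel (a + b) r (wPoly a b (polyDiff a b p))) _ x :=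
      (d1.const_mul r).add (d2.const_mul (1 - r))
    have d4 : HasDerivAt (fun x => Q.eval x) _ x := d3.congr_of_eventuallyEq (by
      filter_upwards [Ioo_mem_nhds hx.1 hx.2] with z hz using (hQ z hz).symm)
    have h2 := d4.unique (Q.hasDerivAt x)
    rw [fracOp_eq (deriv_rho_mul_eval a b p) hx d1 d2, h2]
    simp [hc]

/-! ### The adjoint of the fractional operator -/

lemma integral_mul_deriv_of_zero {v v' F F' : ℝ → ℝ} (hv : ContinuousOn v (Icc 0 1))
    (hv0 : v 0 = 0) (hv1 : v 1 = 0) (hv' : ∀ x ∈ Ioo (0 : ℝ) 1, HasDerivAt v (v' x) x)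
    (hvi : IntegrableOn v' (Ioo 0 1)) (hF : ContinuousOn F (Icc 0 1))
    (hFd : ∀ x ∈ Ioo (0 : ℝ) 1, HasDerivAt F (F' x) x) (hF' : ContinuousOn F' (Icc 0 1)) :
    ∫ x in Ioo (0 : ℝ) 1, F x * v' x = -∫ x in Ioo (0 : ℝ) 1, F' x * v x := by
  obtain ⟨C, hC⟩ := isCompact_Icc.exists_bound_of_continuousOn hF
  have hmeasI : ∀ {g : ℝ → ℝ}, ContinuousOn g (Icc 0 1) →
      AEStronglyMeasurable g (volume.restrict (Ioo (0 : ℝ) 1)) := fun hg =>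
    (hg.mono Ioo_subset_Icc_self).aestronglyMeasurable measurableSet_Ioo
  have i1 : IntegrableOn (fun x => F x * v' x) (Ioo 0 1) := by
    refine Integrable.bdd_mul (c := C) hvi (hmeasI hF) ?_
    filter_upwards [ae_restrict_mem measurableSet_Ioo] with x hx
    exact hC x ⟨hx.1.le, hx.2.le⟩
  have i2 : IntegrableOn (fun x => F' x * v x) (Ioo 0 1) :=
    ((hF'.mul hv).integrableOn_Icc).mono_set Ioo_subset_Icc_self
  have h := intervalIntegral.integral_eq_sub_of_hasDerivAt_of_le zero_le_one (hF.mul hv)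
    (fun x hx => (hFd x hx).mul (hv' x hx))
    ((intervalIntegrable_iff_integrableOn_Ioo_of_le zero_le_one).2 (i2.add i1))
  rw [intervalIntegral.integral_of_le zero_le_one, integral_Ioc_eq_integral_Ioo,
    integral_add i2 i1] at h
  simp only [Pi.mul_apply, hv0, hv1, mul_zero, sub_zero] at h
  linarith

lemma integrableOn_abelKernel_mul {α : ℝ} (hα : α < 2) {f : ℝ → ℝ}
    (hf : IntegrableOn f (Ioo 0 1)) (hc : ContinuousOn f (Ioo 0 1)) {x : ℝ}
    (hx : x ∈ Ioo (0 : ℝ) 1) : IntegrableOn (fun t => abelKernel α t x * f t) (Ioo 0 1) := by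
  have h := intervalIntegrable_leftAbel hα hf hc hx
  rw [intervalIntegrable_iff_integrableOn_Ioo_of_le hx.1.le,
    ← integrable_indicator_iff measurableSet_Ioo] at h
  refine (h.integrableOn (s := Ioo 0 1)).congr_fun (fun t ht => ?_) measurableSet_Ioo
  by_cases hh : t < x
  · simp [abelKernel, hh, ht.1]
  · simp [abelKernel, hh]

/-- Integrability on the square for Fubini's theorem: integrating in `t` first, the two-sided Abel
operator of the weight is constant, hence its left part is bounded. -/
lemma Params.integrable_abelKernel_wPoly {a b r : ℝ} (P : Params a b r) (p : Polynomial ℝ)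
    {f : ℝ → ℝ} (hf : IntegrableOn f (Ioo 0 1)) :
    Integrable (fun z : ℝ × ℝ => r * (abelKernel (a + b) z.1 z.2 * wPoly a b p z.1 * f z.2))
      ((volume.restrict (Ioo (0 : ℝ) 1)).prod (volume.restrict (Ioo (0 : ℝ) 1))) := by
  have hp := integrableOn_wPoly P.a_pos P.b_pos p
  have hw : IntegrableOn (rho (a - 1) (b - 1)) (Ioo 0 1) :=
    integrableOn_rho (by linarith [P.a_pos]) (by linarith [P.b_pos])
  have hmeas : AEStronglyMeasurable
      (fun z : ℝ × ℝ => r * (abelKernel (a + b) z.1 z.2 * wPoly a b p z.1 * f z.2))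
      ((volume.restrict (Ioo (0 : ℝ) 1)).prod (volume.restrict (Ioo (0 : ℝ) 1))) :=
    (((measurable_abelKernel _).aestronglyMeasurable.mul hp.1.comp_fst).mul
      hf.1.comp_snd).const_mul r
  obtain ⟨C, hC⟩ := (isCompact_Icc (a := (0 : ℝ)) (b := 1)).exists_bound_of_continuousOn
    p.continuous.continuousOn
  rw [integrable_prod_iff' hmeas]
  constructor
  · filter_upwards [ae_restrict_mem measurableSet_Ioo] with x hx
    exact ((integrableOn_abelKernel_mul P.lt_two hp (continuousOn_wPoly a b p) hx).mul_const
      _).const_mul r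
  · refine Integrable.mono' (g := fun x => C * abelConst a b r * ‖f x‖)
      (hf.norm.const_mul _) hmeas.norm.prod_swap.integral_prod_right' ?_
    filter_upwards [ae_restrict_mem measurableSet_Ioo] with x hx
    rw [Real.norm_of_nonneg (integral_nonneg fun _ => norm_nonneg _)]
    have hA : r * leftAbel (a + b) (rho (a - 1) (b - 1)) x ≤ abelConst a b r := by
      have h1 := P.twoAbel_rho hx
      have h2 := leftAbel_rho_pos P.a_pos P.b_pos P.symm.lt_two (one_sub_mem_Ioo hx)
      rw [← rightAbel_rho_eq] at h2
      have h3 := mul_nonneg (sub_nonneg.2 P.r_le) h2.le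
      rw [twoAbel] at h1
      linarith
    have hC0 : 0 ≤ C := (norm_nonneg _).trans (hC 0 ⟨le_rfl, zero_le_one⟩)
    calc ∫ t in Ioo (0 : ℝ) 1,
          ‖r * (abelKernel (a + b) t x * wPoly a b p t * f x)‖
        ≤ ∫ t in Ioo (0 : ℝ) 1,
          r * C * ‖f x‖ * (abelKernel (a + b) t x * rho (a - 1) (b - 1) t) := by
          refine setIntegral_mono_on ?_ ?_ measurableSet_Ioo fun t ht => ?_
          · exact (((integrableOn_abelKernel_mul P.lt_two hp
              (continuousOn_wPoly a b p) hx).mul_const _).const_mul r).norm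
          · exact (integrableOn_abelKernel_mul P.lt_two hw (continuousOn_rho _ _) hx).const_mul _
          · rw [norm_mul, norm_mul, norm_mul, Real.norm_of_nonneg P.r_nonneg,
              Real.norm_of_nonneg (abelKernel_nonneg _ _ _), wPoly, norm_mul,
              Real.norm_of_nonneg (rho_nonneg ht)]
            have h1 := hC t ⟨ht.1.le, ht.2.le⟩
            have h2 : 0 ≤ r * ‖f x‖ * (abelKernel (a + b) t x *
                rho (a - 1) (b - 1) t) :=
              mul_nonneg (mul_nonneg P.r_nonneg (norm_nonneg _))
                (mul_nonneg (abelKernel_nonneg _ _ _) (rho_nonneg ht))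
            nlinarith [mul_le_mul_of_nonneg_left h1 h2]
      _ = C * ‖f x‖ * (r * leftAbel (a + b) (rho (a - 1) (b - 1)) x) := by
          rw [integral_const_mul, leftAbel_eq_integral_abelKernel _ _ hx]; ring
      _ ≤ C * ‖f x‖ * abelConst a b r :=
          mul_le_mul_of_nonneg_left hA (mul_nonneg hC0 (norm_nonneg _))
      _ = _ := by ring

lemma integral_twoAbel_mul {α r : ℝ} {f g : ℝ → ℝ}
    (h : Integrable (fun z : ℝ × ℝ => r * (abelKernel α z.1 z.2 * f z.1 * g z.2))
      ((volume.restrict (Ioo (0 : ℝ) 1)).prod (volume.restrict (Ioo (0 : ℝ) 1))))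
    (h' : Integrable (fun z : ℝ × ℝ => (1 - r) * (abelKernel α z.1 z.2 * g z.1 * f z.2))
      ((volume.restrict (Ioo (0 : ℝ) 1)).prod (volume.restrict (Ioo (0 : ℝ) 1)))) :
    ∫ x in Ioo (0 : ℝ) 1, twoAbel α r f x * g x =
      ∫ t in Ioo (0 : ℝ) 1, f t * twoAbel α (1 - r) g t := by
  have e1 := integral_leftAbel_mul h
  have e2 := integral_leftAbel_mul h'
  have i1 := integrable_leftAbel_mul h
  have i2 := integrable_mul_rightAbel h
  have i3 := integrable_leftAbel_mul h'
  have i4 := integrable_mul_rightAbel h'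
  have e3 : ∫ x in Ioo (0 : ℝ) 1, twoAbel α r f x * g x =
      (∫ x in Ioo (0 : ℝ) 1, r * leftAbel α f x * g x) +
        ∫ x in Ioo (0 : ℝ) 1, g x * ((1 - r) * rightAbel α f x) := by
    rw [← integral_add i1 i4]
    refine integral_congr_ae (Eventually.of_forall fun x => ?_)
    simp only [twoAbel]; ring
  have e4 : ∫ x in Ioo (0 : ℝ) 1, f x * twoAbel α (1 - r) g x =
      (∫ x in Ioo (0 : ℝ) 1, (1 - r) * leftAbel α g x * f x) +
        ∫ x in Ioo (0 : ℝ) 1, f x * (r * rightAbel α g x) := by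
    rw [← integral_add i3 i2]
    refine integral_congr_ae (Eventually.of_forall fun x => ?_)
    simp only [twoAbel, sub_sub_cancel]; ring
  rw [e3, e4, e1, e2, add_comm]

/-- `L_r^α` and `L_{1-r}^α` are adjoint to each other on weighted polynomials. -/
theorem Params.integral_fracOp_poly {a b r : ℝ} (P : Params a b r) (p q : Polynomial ℝ) :
    ∫ x in Ioo (0 : ℝ) 1, fracOp (a + b) r (fun x => rho a b x * p.eval x) x *
        (rho b a x * q.eval x) =
      ∫ x in Ioo (0 : ℝ) 1, (rho a b x * p.eval x) *
        fracOp (a + b) (1 - r) (fun x => rho b a x * q.eval x) x := by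
  have half : ∀ {a b r : ℝ} (_ : Params a b r) (p q : Polynomial ℝ),
      ∫ x in Ioo (0 : ℝ) 1, fracOp (a + b) r (fun x => rho a b x * p.eval x) x *
        (rho b a x * q.eval x) =
      1 / Real.Gamma (2 - (a + b)) * ∫ x in Ioo (0 : ℝ) 1,
        twoAbel (a + b) r (wPoly a b (polyDiff a b p)) x * wPoly b a (polyDiff b a q) x := by
    intro a b r P p q
    obtain ⟨F, -, -, hF, hL⟩ := P.exists_fracOp_rho_mul (le_refl p.natDegree)
    have hv := integral_mul_deriv_of_zero (v := fun x => rho b a x * q.eval x)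
      (v' := wPoly b a (polyDiff b a q)) (F := fun x => F.eval x)
      (F' := fun x => F.derivative.eval x)
      ((continuous_rho P.b_pos.le P.a_pos.le).mul q.continuous).continuousOn
      (by simp [rho_zero P.a_pos.ne']) (by simp [rho_one P.b_pos.ne'])
      (fun x hx => (hasDerivAt_rho_mul b a hx q.differentiableAt).congr_deriv
        (by rw [wDiff_eval, wPoly]))
      (integrableOn_wPoly P.b_pos P.a_pos _) F.continuous.continuousOn
      (fun x _ => F.hasDerivAt x) F.derivative.continuous.continuousOn
    rw [← integral_const_mul]
    have e1 : ∫ x in Ioo (0 : ℝ) 1, 1 / Real.Gamma (2 - (a + b)) *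
        (twoAbel (a + b) r (wPoly a b (polyDiff a b p)) x * wPoly b a (polyDiff b a q) x) =
        ∫ x in Ioo (0 : ℝ) 1, F.eval x * wPoly b a (polyDiff b a q) x :=
      setIntegral_congr_fun measurableSet_Ioo fun x hx => by
        simp only [← mul_assoc]; rw [hF x hx]
    rw [e1, hv, ← integral_neg]
    refine setIntegral_congr_fun measurableSet_Ioo fun x hx => ?_
    simp only [hL x hx, Polynomial.eval_neg]
    ring
  have h2 := half P.symm q p
  rw [half P p q, integral_twoAbel_mul
    (P.integrable_abelKernel_wPoly _ (integrableOn_wPoly P.b_pos P.a_pos _))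
    (by simpa only [add_comm b a] using
      P.symm.integrable_abelKernel_wPoly _ (integrableOn_wPoly P.a_pos P.b_pos _))]
  rw [add_comm b a] at h2
  simp only [mul_comm (rho a b _ * _)]
  rw [h2]
  simp only [mul_comm (twoAbel _ _ _ _)]

/-! ### The fractional operator on test functions, and the weak form of the equation -/

lemma IsTest.eq_zero {ψ : ℝ → ℝ} (h : IsTest ψ) {x : ℝ} (hx : x ∉ Ioo (0 : ℝ) 1) : ψ x = 0 :=
  image_eq_zero_of_notMem_tsupport fun hm => hx (h.2.2 hm)

lemma IsTest.deriv {ψ : ℝ → ℝ} (h : IsTest ψ) : IsTest (deriv ψ) :=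
  ⟨(contDiff_infty_iff_deriv.1 h.1).2, h.2.1.deriv,
    (tsupport_deriv_subset).trans h.2.2⟩

lemma IsTest.comp_one_sub {ψ : ℝ → ℝ} (h : IsTest ψ) : IsTest fun t => ψ (1 - t) := by
  refine ⟨h.1.comp (contDiff_const.sub contDiff_id),
    h.2.1.comp_homeomorph (Homeomorph.subLeft (1 : ℝ)), ?_⟩
  have e : tsupport (fun t => ψ (1 - t)) = (Homeomorph.subLeft (1 : ℝ)) ⁻¹' tsupport ψ :=
    tsupport_comp_eq_preimage ψ (Homeomorph.subLeft (1 : ℝ))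
  rw [e]
  intro x hx
  have := one_sub_mem_Ioo (h.2.2 hx)
  simpa using this

lemma IsTest.continuous {ψ : ℝ → ℝ} (h : IsTest ψ) : Continuous ψ := h.1.continuous

lemma IsTest.exists_bound {ψ : ℝ → ℝ} (h : IsTest ψ) : ∃ C, ∀ x, |ψ x| ≤ C :=
  h.2.1.exists_bound_of_continuous h.continuous

lemma IsTest.hasDerivAt {ψ : ℝ → ℝ} (h : IsTest ψ) (x : ℝ) : HasDerivAt ψ (_root_.deriv ψ x) x :=
  (h.1.differentiable (by simp)).differentiableAt.hasDerivAt

/-- For a test function `h` the left Abel integral is the convolution `∫₀¹ s^{1-α} h(x - s) ds`,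
which makes sense for all real `x`. -/
def testAbel (α : ℝ) (h : ℝ → ℝ) (x : ℝ) : ℝ := ∫ s in Ioo (0 : ℝ) 1, s ^ (1 - α) * h (x - s)

lemma integrableOn_rpow_one_sub {α : ℝ} (hα : α < 2) :
    IntegrableOn (fun s : ℝ => s ^ (1 - α)) (Ioo 0 1) :=
  (intervalIntegrable_iff_integrableOn_Ioo_of_le zero_le_one).1
    (intervalIntegral.intervalIntegrable_rpow' (by linarith))

lemma IsTest.leftAbel_eq {α : ℝ} {h : ℝ → ℝ} (ht : IsTest h) {x : ℝ} (hx : x ∈ Ioo (0 : ℝ) 1) :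
    leftAbel α h x = testAbel α h x := by
  have h1 := intervalIntegral.integral_comp_sub_left (a := 0) (b := x)
    (fun t => 1 / (x - t) ^ (α - 1) * h t) x
  simp only [sub_sub_cancel, sub_zero, sub_self] at h1
  rw [leftAbel, ← h1, intervalIntegral.integral_of_le hx.1.le, integral_Ioc_eq_integral_Ioo,
    testAbel, ← inter_eq_right.2 (Ioo_subset_Ioo_right hx.2.le : Ioo 0 x ⊆ Ioo (0 : ℝ) 1),
    ← setIntegral_indicator measurableSet_Ioo]
  refine setIntegral_congr_fun measurableSet_Ioo fun s hs => ?_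
  by_cases hh : s < x
  · rw [indicator_of_mem (show s ∈ Ioo 0 x from ⟨hs.1, hh⟩), show 1 - α = -(α - 1) by ring,
      Real.rpow_neg hs.1.le, one_div]
  · rw [indicator_of_notMem (fun hm => hh hm.2), ht.eq_zero (fun hm => hh (by linarith [hm.1])),
      mul_zero]

lemma IsTest.hasDerivAt_testAbel {α : ℝ} (hα : α < 2) {h : ℝ → ℝ} (ht : IsTest h) (x : ℝ) :
    HasDerivAt (testAbel α h) (testAbel α (_root_.deriv h) x) x := by
  obtain ⟨C, hC⟩ := ht.exists_bound
  obtain ⟨D, hD⟩ := ht.deriv.exists_bound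
  have hi := integrableOn_rpow_one_sub hα
  have hc := ht.continuous
  have hc' := ht.deriv.continuous
  refine (hasDerivAt_integral_of_dominated_loc_of_deriv_le
    (μ := volume.restrict (Ioo (0 : ℝ) 1)) (x₀ := x) (s := univ)
    (F := fun x s => s ^ (1 - α) * h (x - s))
    (F' := fun x s => s ^ (1 - α) * _root_.deriv h (x - s))
    (bound := fun s => s ^ (1 - α) * D) univ_mem ?_ ?_ ?_ ?_ ?_ ?_).2
  · exact Eventually.of_forall fun z => hi.1.mul (by fun_prop)
  · exact Integrable.mul_bdd (c := C) hi (by fun_prop) (Eventually.of_forall fun s => hC _)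
  · exact hi.1.mul (by fun_prop)
  · filter_upwards [ae_restrict_mem measurableSet_Ioo] with s hs z _
    rw [norm_mul, Real.norm_of_nonneg (Real.rpow_nonneg hs.1.le _)]
    exact mul_le_mul_of_nonneg_left (hD _) (Real.rpow_nonneg hs.1.le _)
  · exact hi.mul_const _
  · refine Eventually.of_forall fun s z _ => ?_
    exact ((ht.hasDerivAt (z - s)).comp_sub_const z s).const_mul _

/-- The two-sided operator on a test function, as a function on the whole line. -/
def testTwoAbel (α r : ℝ) (h : ℝ → ℝ) (x : ℝ) : ℝ :=
  r * testAbel α h x + (1 - r) * testAbel α (fun t => h (1 - t)) (1 - x)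

lemma IsTest.rightAbel_eq {α : ℝ} {h : ℝ → ℝ} (ht : IsTest h) {x : ℝ} (hx : x ∈ Ioo (0 : ℝ) 1) :
    rightAbel α h x = testAbel α (fun t => h (1 - t)) (1 - x) := by
  rw [rightAbel_eq_leftAbel, ht.comp_one_sub.leftAbel_eq (one_sub_mem_Ioo hx)]

lemma IsTest.twoAbel_eq {α r : ℝ} {h : ℝ → ℝ} (ht : IsTest h) {x : ℝ} (hx : x ∈ Ioo (0 : ℝ) 1) :
    twoAbel α r h x = testTwoAbel α r h x := by
  rw [twoAbel, testTwoAbel, ht.leftAbel_eq hx, ht.rightAbel_eq hx]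

lemma IsTest.hasDerivAt_testAbel_one_sub {α : ℝ} (hα : α < 2) {h : ℝ → ℝ} (ht : IsTest h) (x : ℝ) :
    HasDerivAt (fun x => testAbel α (fun t => h (1 - t)) (1 - x))
      (testAbel α (fun t => _root_.deriv h (1 - t)) (1 - x)) x := by
  have h1 := (ht.comp_one_sub.hasDerivAt_testAbel hα (1 - x)).comp_const_sub 1 x
  refine h1.congr_deriv ?_
  have : _root_.deriv (fun t => h (1 - t)) = fun t => -_root_.deriv h (1 - t) := by
    ext t; exact deriv_comp_const_sub ..
  rw [this]
  simp [testAbel, integral_neg]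

lemma IsTest.hasDerivAt_testTwoAbel {α r : ℝ} (hα : α < 2) {h : ℝ → ℝ} (ht : IsTest h) (x : ℝ) :
    HasDerivAt (testTwoAbel α r h) (testTwoAbel α r (_root_.deriv h) x) x :=
  ((ht.hasDerivAt_testAbel hα x).const_mul r).add
    ((ht.hasDerivAt_testAbel_one_sub hα x).const_mul (1 - r))

lemma IsTest.continuous_testTwoAbel {α r : ℝ} (hα : α < 2) {h : ℝ → ℝ} (ht : IsTest h) :
    Continuous (testTwoAbel α r h) :=
  continuous_iff_continuousAt.2 fun x => (ht.hasDerivAt_testTwoAbel hα x).continuousAt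

lemma IsTest.fracOp_eq {α r : ℝ} (hα : α < 2) {ψ : ℝ → ℝ} (ht : IsTest ψ) {x : ℝ}
    (hx : x ∈ Ioo (0 : ℝ) 1) :
    fracOp α r ψ x =
      -(1 / Real.Gamma (2 - α) * testTwoAbel α r (_root_.deriv (_root_.deriv ψ)) x) := by
  have hmem : Ioo (0 : ℝ) 1 ∈ 𝓝 x := Ioo_mem_nhds hx.1 hx.2
  have h1 : HasDerivAt (leftAbel α (_root_.deriv ψ)) _ x :=
    (ht.deriv.hasDerivAt_testAbel hα x).congr_of_eventuallyEq (by
      filter_upwards [hmem] with z hz using ht.deriv.leftAbel_eq hz)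
  have h2 : HasDerivAt (rightAbel α (_root_.deriv ψ)) _ x :=
    (ht.deriv.hasDerivAt_testAbel_one_sub hα x).congr_of_eventuallyEq (by
      filter_upwards [hmem] with z hz using ht.deriv.rightAbel_eq hz)
  rw [FracDiff.fracOp_eq (fun _ _ => rfl) hx h1 h2, testTwoAbel]

lemma abelKernel_one_sub (α t x : ℝ) : abelKernel α (1 - x) (1 - t) = abelKernel α t x := by
  unfold abelKernel
  rw [show 1 - t - (1 - x) = x - t by ring]
  by_cases h : t < x
  · rw [if_pos h, if_pos (by linarith)]
  · rw [if_neg h, if_neg (by linarith)]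

/-- The reflection `(t, x) ↦ (1 - x, 1 - t)` of the square leaves the kernel invariant. -/
lemma integrable_abelKernel_reflect {α r : ℝ} {f g : ℝ → ℝ}
    (h : Integrable (fun z : ℝ × ℝ => r * (abelKernel α z.1 z.2 * f (1 - z.1) * g (1 - z.2)))
      ((volume.restrict (Ioo (0 : ℝ) 1)).prod (volume.restrict (Ioo (0 : ℝ) 1)))) :
    Integrable (fun z : ℝ × ℝ => r * (abelKernel α z.1 z.2 * g z.1 * f z.2))
      ((volume.restrict (Ioo (0 : ℝ) 1)).prod (volume.restrict (Ioo (0 : ℝ) 1))) := by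
  have hmp : MeasurePreserving (fun t : ℝ => 1 - t) (volume.restrict (Ioo (0 : ℝ) 1))
      (volume.restrict (Ioo (0 : ℝ) 1)) := by
    have h1 := (Measure.measurePreserving_sub_left volume (1 : ℝ)).restrict_preimage
      (measurableSet_Ioo (a := (0 : ℝ)) (b := 1))
    simpa using h1
  have h2 := ((hmp.prod hmp).comp Measure.measurePreserving_swap).integrable_comp_of_integrable h
  refine h2.congr (Eventually.of_forall fun z => ?_)
  simp only [Function.comp, Prod.map, Prod.swap, sub_sub_cancel, abelKernel_one_sub]
  ring

lemma integrable_abelKernel_bdd_mul {α : ℝ} (hα : α < 2) {f g : ℝ → ℝ}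
    (hf : IntegrableOn f (Ioo 0 1)) (hg : Measurable g) {C : ℝ} (hC : ∀ x, |g x| ≤ C) (r : ℝ) :
    Integrable (fun z : ℝ × ℝ => r * (abelKernel α z.1 z.2 * g z.1 * f z.2))
      ((volume.restrict (Ioo (0 : ℝ) 1)).prod (volume.restrict (Ioo (0 : ℝ) 1))) :=
  integrable_abelKernel_reflect (integrable_abelKernel_mul_bdd hα (integrableOn_comp_one_sub hf)
    (g := fun t => g (1 - t)) (hg.comp (by fun_prop)) (fun x => hC _) r)

/-- Integration by parts for `u` absolutely continuous with `u(0) = u(1) = 0`: the weak form of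
`L_r^α u` is the pairing of `u` with `L_{1-r}^α ψ`. -/
theorem integral_flux_mul_deriv {α r : ℝ} (hα : α < 2) {u ψ : ℝ → ℝ}
    (hu : AbsolutelyContinuousOnInterval u 0 1) (hu0 : u 0 = 0) (hu1 : u 1 = 0) (hψ : IsTest ψ) :
    ∫ x in (0 : ℝ)..1, (r * leftFlux α u x + (1 - r) * rightFlux α u x) * deriv ψ x =
      ∫ x in Ioo (0 : ℝ) 1, u x * fracOp α (1 - r) ψ x := by
  have hi : IntegrableOn (deriv u) (Ioo 0 1) :=
    (intervalIntegrable_iff_integrableOn_Ioo_of_le zero_le_one).1 hu.intervalIntegrable_deriv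
  obtain ⟨C, hC⟩ := hψ.deriv.exists_bound
  have hm : Measurable (deriv ψ) := hψ.deriv.continuous.measurable
  have key := integral_twoAbel_mul (integrable_abelKernel_mul_bdd hα hi hm hC r)
    (integrable_abelKernel_bdd_mul hα hi hm hC (1 - r))
  set c := 1 / Real.Gamma (2 - α) with hc
  set G := testTwoAbel α (1 - r) (deriv ψ) with hG
  have hGd : ∀ x, HasDerivAt G (testTwoAbel α (1 - r) (deriv (deriv ψ)) x) x := fun x =>
    hψ.deriv.hasDerivAt_testTwoAbel hα x
  have hdG : deriv G = testTwoAbel α (1 - r) (deriv (deriv ψ)) := funext fun x => (hGd x).deriv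
  have hGc : ContDiff ℝ 1 G := by
    rw [contDiff_one_iff_deriv]
    refine ⟨fun x => (hGd x).differentiableAt, ?_⟩
    rw [hdG]
    exact hψ.deriv.deriv.continuous_testTwoAbel hα
  have hparts := hu.integral_mul_deriv_eq_deriv_mul hGc.contDiffOn.absolutelyContinuousOnInterval
  rw [hu0, hu1, zero_mul, zero_mul, sub_zero, zero_sub, hdG] at hparts
  have e1 : ∫ x in (0 : ℝ)..1, (r * leftFlux α u x + (1 - r) * rightFlux α u x) * deriv ψ x =
      c * ∫ x in Ioo (0 : ℝ) 1, twoAbel α r (deriv u) x * deriv ψ x := by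
    rw [intervalIntegral.integral_of_le zero_le_one, integral_Ioc_eq_integral_Ioo,
      ← integral_const_mul]
    refine integral_congr_ae (Eventually.of_forall fun x => ?_)
    simp only [leftFlux_eq, rightFlux_eq, twoAbel, ← hc]
    ring
  have e2 : ∫ t in Ioo (0 : ℝ) 1, deriv u t * twoAbel α (1 - r) (deriv ψ) t =
      ∫ t in (0 : ℝ)..1, deriv u t * G t := by
    rw [intervalIntegral.integral_of_le zero_le_one, integral_Ioc_eq_integral_Ioo]
    exact setIntegral_congr_fun measurableSet_Ioo fun t ht => by
      simp only [hψ.deriv.twoAbel_eq ht, hG]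
  rw [e1, key, e2, ← neg_eq_iff_eq_neg.2 hparts, intervalIntegral.integral_of_le zero_le_one,
    integral_Ioc_eq_integral_Ioo, ← integral_neg, ← integral_const_mul]
  refine setIntegral_congr_fun measurableSet_Ioo fun x hx => ?_
  simp only [hψ.fracOp_eq hα hx, ← hc]
  ring

/-! ### Jacobi polynomials: orthogonality and leading coefficient -/

lemma integral_wMeasure (a b : ℝ) (f : ℝ → ℝ) :
    ∫ x, f x ∂(wMeasure a b) = ∫ x in Ioo (0 : ℝ) 1, rho a b x * f x := by
  unfold wMeasure
  rw [integral_withDensity_eq_integral_toReal_smul (measurable_rho a b).ennreal_ofReal (by simp)]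
  refine setIntegral_congr_fun measurableSet_Ioo fun x hx => ?_
  simp only [ENNReal.toReal_ofReal (rho_nonneg hx), smul_eq_mul]

lemma integrable_wMeasure_iff (a b : ℝ) (f : ℝ → ℝ) :
    Integrable f (wMeasure a b) ↔ IntegrableOn (fun x => rho a b x * f x) (Ioo 0 1) := by
  unfold wMeasure
  rw [integrable_withDensity_iff_integrable_smul₀' (measurable_rho a b).ennreal_ofReal.aemeasurable
    (by simp)]
  refine integrable_congr ?_
  filter_upwards [ae_restrict_mem measurableSet_Ioo] with x hx
  simp only [ENNReal.toReal_ofReal (rho_nonneg hx), smul_eq_mul]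

lemma ae_wMeasure_iff (a b : ℝ) (p : ℝ → Prop) :
    (∀ᵐ x ∂(wMeasure a b), p x) ↔ ∀ᵐ x ∂(volume.restrict (Ioo (0 : ℝ) 1)), p x := by
  unfold wMeasure
  rw [ae_withDensity_iff (measurable_rho a b).ennreal_ofReal]
  refine eventually_congr ?_
  filter_upwards [ae_restrict_mem measurableSet_Ioo] with x hx
  simp [rho_pos hx]

lemma ae_wMeasure_of_forall {a b : ℝ} {p : ℝ → Prop} (h : ∀ x ∈ Ioo (0 : ℝ) 1, p x) :
    ∀ᵐ x ∂(wMeasure a b), p x :=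
  (ae_wMeasure_iff a b p).2 ((ae_restrict_mem measurableSet_Ioo).mono h)

/-- The generalised binomial coefficient as a quotient of Gamma functions. -/
lemma choose_mul_Gamma (m : ℕ) {x : ℝ} (hx : (m : ℝ) < x + 1) :
    (m.factorial : ℝ) * Ring.choose x m * Real.Gamma (x - m + 1) = Real.Gamma (x + 1) := by
  induction m with
  | zero => simp
  | succ m ih =>
    have hm : (m : ℝ) + 1 < x + 1 := by exact_mod_cast hx
    have h1 := Ring.choose_smul_choose x (Nat.le_succ m)
    rw [Nat.succ_eq_add_one, Nat.add_sub_cancel_left, Ring.choose_one_right,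
      Nat.choose_succ_self_right, nsmul_eq_mul] at h1
    have h2 : Real.Gamma (x - m + 1) = (x - m) * Real.Gamma (x - m) :=
      Real.Gamma_add_one (by linarith)
    rw [← ih (by linarith), h2, Nat.factorial_succ]
    push_cast at h1 ⊢
    rw [show x - (m + 1) + 1 = x - m by ring]
    linear_combination (m.factorial * Real.Gamma (x - m)) * h1

lemma choose_pos {m : ℕ} {x : ℝ} (hx : (m : ℝ) < x + 1) : 0 < Ring.choose x m := by
  have h := choose_mul_Gamma m hx
  have h1 : 0 < Real.Gamma (x + 1) :=
    Real.Gamma_pos_of_pos (lt_of_le_of_lt (Nat.cast_nonneg m) hx)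
  have h2 : 0 < Real.Gamma (x - m + 1) := Real.Gamma_pos_of_pos (by linarith)
  have h3 : (0 : ℝ) < m.factorial := by exact_mod_cast m.factorial_pos
  by_contra! hc
  have := mul_nonpos_of_nonpos_of_nonneg (mul_nonpos_of_nonneg_of_nonpos h3.le hc) h2.le
  linarith

lemma Gamma_add_natCast {z : ℝ} (hz : 0 < z) (j : ℕ) :
    Real.Gamma (z + j) = Real.Gamma z * (ascPochhammer ℝ j).eval z := by
  induction j with
  | zero => simp
  | succ j ih =>
    have : z + (j + 1 : ℕ) = (z + j) + 1 := by push_cast; ring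
    rw [this, Real.Gamma_add_one (by positivity), ih, ascPochhammer_succ_eval]
    ring

/-- The Jacobi polynomial `G_n^{(a,b)}` as a polynomial. -/
def jacobiPoly (a b : ℝ) (n : ℕ) : Polynomial ℝ :=
  ∑ m ∈ Finset.range (n + 1),
    Polynomial.C (Ring.choose ((n : ℝ) + a) m * Ring.choose ((n : ℝ) + b) (n - m)) *
      ((Polynomial.X - Polynomial.C 1) ^ (n - m) * Polynomial.X ^ m)

lemma jacobiPoly_eval (a b : ℝ) (n : ℕ) (x : ℝ) : (jacobiPoly a b n).eval x = jacobiG a b n x := by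
  rw [jacobiPoly, jacobiG, Polynomial.eval_finsetSum]
  refine Finset.sum_congr rfl fun m hm => ?_
  have hm' : n = (n - m) + m := by have := Finset.mem_range.1 hm; omega
  have e : (2 : ℝ) ^ n = 2 ^ (n - m) * 2 ^ m := by rw [← pow_add, ← hm']
  simp only [Polynomial.eval_mul, Polynomial.eval_C, Polynomial.eval_pow, Polynomial.eval_sub,
    Polynomial.eval_X]
  rw [show 2 * x - 1 - 1 = 2 * (x - 1) by ring, show 2 * x - 1 + 1 = 2 * x by ring, mul_pow,
    mul_pow, e]
  field_simp

lemma jacobi_term_monic (n m : ℕ) (hm : m ≤ n) :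
    ((Polynomial.X - Polynomial.C (1 : ℝ)) ^ (n - m) * Polynomial.X ^ m).Monic ∧
      ((Polynomial.X - Polynomial.C (1 : ℝ)) ^ (n - m) * Polynomial.X ^ m).natDegree = n := by
  have h1 := (Polynomial.monic_X_sub_C (1 : ℝ)).pow (n - m)
  have h2 := Polynomial.monic_X_pow (R := ℝ) m
  refine ⟨h1.mul h2, ?_⟩
  rw [h1.natDegree_mul h2, Polynomial.natDegree_pow, Polynomial.natDegree_X_sub_C,
    Polynomial.natDegree_X_pow]
  omega

lemma jacobiPoly_natDegree_le (a b : ℝ) (n : ℕ) : (jacobiPoly a b n).natDegree ≤ n := by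
  refine Polynomial.natDegree_sum_le_of_forall_le _ _ fun m hm => ?_
  exact (Polynomial.natDegree_C_mul_le _ _).trans
    (jacobi_term_monic n m (by have := Finset.mem_range.1 hm; omega)).2.le

/-- The leading coefficient, by the Chu–Vandermonde identity. -/
lemma jacobiPoly_coeff (a b : ℝ) (n : ℕ) :
    (jacobiPoly a b n).coeff n = Ring.choose (2 * n + a + b) n := by
  rw [jacobiPoly, Polynomial.finsetSum_coeff,
    show (2 : ℝ) * n + a + b = (n + a) + (n + b) by ring, Ring.add_choose_eq _ (Commute.all _ _),
    Finset.Nat.sum_antidiagonal_eq_sum_range_succ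
      (fun i j => Ring.choose ((n : ℝ) + a) i * Ring.choose ((n : ℝ) + b) j)]
  refine Finset.sum_congr rfl fun m hm => ?_
  obtain ⟨h1, h2⟩ := jacobi_term_monic n m (by have := Finset.mem_range.1 hm; omega)
  have h3 := h1.coeff_natDegree
  rw [h2] at h3
  rw [Polynomial.coeff_C_mul, h3, mul_one]

lemma jacobiPoly_coeff_pos {a b : ℝ} (hab : 0 < a + b + 1) (n : ℕ) :
    0 < (jacobiPoly a b n).coeff n := by
  rw [jacobiPoly_coeff]
  refine choose_pos ?_
  have : (0 : ℝ) ≤ n := Nat.cast_nonneg n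
  linarith

lemma jacobiPoly_coeff_swap (a b : ℝ) (n : ℕ) :
    (jacobiPoly b a n).coeff n = (jacobiPoly a b n).coeff n := by
  rw [jacobiPoly_coeff, jacobiPoly_coeff, add_right_comm]

/-- The `n`-th finite difference of a polynomial of degree `j < n` vanishes. -/
lemma sum_neg_one_pow_mul_ascPochhammer {n j : ℕ} (hj : j < n) (y : ℝ) :
    ∑ m ∈ Finset.range (n + 1), (-1 : ℝ) ^ (n - m) / (m.factorial * (n - m).factorial) *
      (ascPochhammer ℝ j).eval (y + m) = 0 := by
  have h := congrFun (Polynomial.fwdDiff_iter_eq_zero_of_degree_lt (P := ascPochhammer ℝ j)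
    (n := n) (by rw [ascPochhammer_natDegree]; exact hj)) y
  rw [fwdDiff_iter_eq_sum_shift] at h
  have h2 : ∑ m ∈ Finset.range (n + 1), (-1 : ℝ) ^ (n - m) / (m.factorial * (n - m).factorial) *
      (ascPochhammer ℝ j).eval (y + m) = (1 / n.factorial) *
      ∑ k ∈ Finset.range (n + 1), ((-1 : ℤ) ^ (n - k) * (n.choose k : ℤ)) •
        (ascPochhammer ℝ j).eval (y + k • (1 : ℝ)) := by
    rw [Finset.mul_sum]
    refine Finset.sum_congr rfl fun m hm => ?_
    have hm' : m ≤ n := by have := Finset.mem_range.1 hm; omega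
    have hch : (n.choose m : ℝ) * m.factorial * (n - m).factorial = n.factorial := by
      exact_mod_cast Nat.choose_mul_factorial_mul_factorial hm'
    rw [zsmul_eq_mul, nsmul_eq_mul, mul_one]
    push_cast
    rw [← hch]
    have hc0 : (n.choose m : ℝ) ≠ 0 := by exact_mod_cast (Nat.choose_pos hm').ne'
    field_simp
  rw [h2, h]
  simp

/-- Orthogonality to the monomials of lower degree: by the beta integral, the moment is an `n`-th
finite difference of a polynomial of degree `j < n`. -/
lemma integral_rho_mul_jacobiPoly_mul_pow {a b : ℝ} (ha : -1 < a) (hb : -1 < b) {n j : ℕ}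
    (hj : j < n) :
    ∫ x in Ioo (0 : ℝ) 1, rho a b x * ((jacobiPoly a b n).eval x * x ^ j) = 0 := by
  have hterm : ∀ m ∈ Finset.range (n + 1), ∀ x ∈ Ioo (0 : ℝ) 1,
      rho a b x * ((x - 1) ^ (n - m) * x ^ m * x ^ j) =
        (-1) ^ (n - m) * rho (a + (n - m : ℕ)) (b + (m + j : ℕ)) x := by
    intro m _ x hx
    have h1 : 0 < 1 - x := by linarith [hx.2]
    rw [rho, rho, Real.rpow_add_natCast h1.ne', Real.rpow_add_natCast hx.1.ne', pow_add,
      show x - 1 = (-1) * (1 - x) by ring, mul_pow]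
    ring
  have e1 : ∀ x ∈ Ioo (0 : ℝ) 1, rho a b x * ((jacobiPoly a b n).eval x * x ^ j) =
      ∑ m ∈ Finset.range (n + 1), Ring.choose ((n : ℝ) + a) m * Ring.choose ((n : ℝ) + b) (n - m) *
        ((-1) ^ (n - m) * rho (a + (n - m : ℕ)) (b + (m + j : ℕ)) x) := by
    intro x hx
    rw [jacobiPoly, Polynomial.eval_finsetSum, Finset.sum_mul, Finset.mul_sum]
    refine Finset.sum_congr rfl fun m hm => ?_
    rw [← hterm m hm x hx]
    simp only [Polynomial.eval_mul, Polynomial.eval_C, Polynomial.eval_pow, Polynomial.eval_sub,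
      Polynomial.eval_X]
    ring
  have hpos1 : ∀ k : ℕ, -1 < a + k := fun k => by have : (0 : ℝ) ≤ k := k.cast_nonneg; linarith
  have hpos2 : ∀ k : ℕ, -1 < b + k := fun k => by have : (0 : ℝ) ≤ k := k.cast_nonneg; linarith
  rw [setIntegral_congr_fun measurableSet_Ioo e1, integral_finsetSum _ fun m _ =>
    ((integrableOn_rho (hpos1 _) (hpos2 _)).const_mul _).const_mul _]
  have e2 : ∀ m ∈ Finset.range (n + 1), ∫ x in Ioo (0 : ℝ) 1,
      Ring.choose ((n : ℝ) + a) m * Ring.choose ((n : ℝ) + b) (n - m) *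
        ((-1) ^ (n - m) * rho (a + (n - m : ℕ)) (b + (m + j : ℕ)) x) =
      Real.Gamma (n + a + 1) * Real.Gamma (n + b + 1) / Real.Gamma (a + b + n + j + 2) *
        ((-1 : ℝ) ^ (n - m) / (m.factorial * (n - m).factorial) *
          (ascPochhammer ℝ j).eval ((b + 1) + m)) := by
    intro m hm
    have hm' : m ≤ n := by have := Finset.mem_range.1 hm; omega
    have hc : ((n - m : ℕ) : ℝ) = n - m := Nat.cast_sub hm'
    have hmn : (m : ℝ) ≤ n := by exact_mod_cast hm'
    have hm0 : (0 : ℝ) ≤ m := m.cast_nonneg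
    have c1 := choose_mul_Gamma m (x := (n : ℝ) + a) (by linarith)
    have c2 := choose_mul_Gamma (n - m) (x := (n : ℝ) + b) (by rw [hc]; linarith)
    have c3 := Gamma_add_natCast (z := (b + 1) + m) (by linarith) j
    rw [integral_const_mul, integral_const_mul, integral_rho (hpos1 _) (hpos2 _)]
    rw [hc] at c2 ⊢
    push_cast
    rw [show a + (n - m) + 1 = (n : ℝ) + a - m + 1 by ring,
      show b + (m + j) + 1 = (b + 1) + m + j by ring, c3,
      show a + ((n : ℝ) - m) + (b + (m + j)) + 2 = a + b + n + j + 2 by ring, ← c1, ← c2,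
      show (n : ℝ) + b - (n - m) + 1 = b + 1 + m by ring]
    field_simp
  rw [Finset.sum_congr rfl e2, ← Finset.mul_sum, sum_neg_one_pow_mul_ascPochhammer hj, mul_zero]

/-- The weighted integral `∫ ρ^{(a,b)} p q` of two polynomials. -/
def polyInner (a b : ℝ) (p q : Polynomial ℝ) : ℝ :=
  ∫ x in Ioo (0 : ℝ) 1, rho a b x * (p.eval x * q.eval x)

lemma polyInner_comm (a b : ℝ) (p q : Polynomial ℝ) : polyInner a b p q = polyInner a b q p := by
  simp only [polyInner, mul_comm (p.eval _)]

lemma polyInner_add_right {a b : ℝ} (ha : -1 < a) (hb : -1 < b) (p q q' : Polynomial ℝ) :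
    polyInner a b p (q + q') = polyInner a b p q + polyInner a b p q' := by
  simp only [polyInner, Polynomial.eval_add, mul_add]
  exact integral_add (integrableOn_rho_mul ha hb (p.continuous.mul q.continuous))
    (integrableOn_rho_mul ha hb (p.continuous.mul q'.continuous))

lemma polyInner_C_mul_right (a b c : ℝ) (p q : Polynomial ℝ) :
    polyInner a b p (Polynomial.C c * q) = c * polyInner a b p q := by
  rw [polyInner, polyInner, ← integral_const_mul]
  refine integral_congr_ae (Eventually.of_forall fun x => ?_)
  simp only [Polynomial.eval_mul, Polynomial.eval_C]
  ring

lemma polyInner_jacobiPoly_eq_zero {a b : ℝ} (ha : -1 < a) (hb : -1 < b) {n : ℕ}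
    {q : Polynomial ℝ} (hq : q.natDegree < n) : polyInner a b (jacobiPoly a b n) q = 0 := by
  have h : ∀ k : ℕ, k ≤ n → ∀ q : Polynomial ℝ, q.natDegree < k →
      polyInner a b (jacobiPoly a b n) q = 0 := by
    intro k hk q hqk
    rw [Polynomial.as_sum_range_C_mul_X_pow' q hqk]
    have : ∀ s : Finset ℕ, (∀ i ∈ s, i < n) → polyInner a b (jacobiPoly a b n)
        (∑ i ∈ s, Polynomial.C (q.coeff i) * Polynomial.X ^ i) = 0 := by
      intro s
      induction s using Finset.induction_on with
      | empty => intro _; simp [polyInner]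
      | insert i s his ih =>
        intro hs
        rw [Finset.sum_insert his, polyInner_add_right ha hb, polyInner_C_mul_right,
          ih fun i hi => hs i (Finset.mem_insert_of_mem hi), add_zero]
        have h0 := integral_rho_mul_jacobiPoly_mul_pow ha hb (hs i (Finset.mem_insert_self i s))
        rw [polyInner]
        simp only [Polynomial.eval_pow, Polynomial.eval_X]
        rw [h0, mul_zero]
    exact this _ fun i hi => (Finset.mem_range.1 hi).trans_le hk
  exact h n le_rfl q hq

lemma eq_zero_of_polyInner_self {a b : ℝ} (ha : -1 < a) (hb : -1 < b) {p : Polynomial ℝ}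
    (h : polyInner a b p p = 0) : p = 0 := by
  have hi : IntegrableOn (fun x => rho a b x * (p.eval x * p.eval x)) (Ioo 0 1) :=
    integrableOn_rho_mul ha hb (p.continuous.mul p.continuous)
  rw [polyInner, setIntegral_eq_zero_iff_of_nonneg_ae ?_ hi] at h
  · by_contra hp
    have hz : ∀ᵐ x ∂(volume.restrict (Ioo (0 : ℝ) 1)), x ∈ {x | p.IsRoot x} := by
      filter_upwards [h, ae_restrict_mem measurableSet_Ioo] with x hx hm
      have := (mul_eq_zero.1 hx).resolve_left (rho_pos hm).ne'
      simpa using mul_self_eq_zero.1 this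
    have hfin : {x | p.IsRoot x}.Finite := Polynomial.finite_setOfPred_isRoot hp
    have h1 : volume.restrict (Ioo (0 : ℝ) 1) {x | p.IsRoot x} = 0 := by
      exact hfin.measure_zero _
    have h2 : volume.restrict (Ioo (0 : ℝ) 1) univ = 0 := by
      rw [← union_compl_self {x | p.IsRoot x}]
      exact measure_union_null h1 hz
    simp at h2
  · filter_upwards [ae_restrict_mem measurableSet_Ioo] with x hx
    exact mul_nonneg (rho_nonneg hx) (mul_self_nonneg _)

/-- A polynomial of degree at most `n` that is orthogonal to all polynomials of lower degree is
determined by its coefficient of `x^n`. -/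
lemma eq_C_mul_jacobiPoly {a b : ℝ} (ha : -1 < a) (hb : -1 < b) {n : ℕ} {Q : Polynomial ℝ} {c : ℝ}
    (hQ : Q.natDegree ≤ n) (hc : Q.coeff n = c * (jacobiPoly a b n).coeff n)
    (horth : ∀ q : Polynomial ℝ, q.natDegree < n → polyInner a b Q q = 0) :
    Q = Polynomial.C c * jacobiPoly a b n := by
  set D := Q + Polynomial.C (-c) * jacobiPoly a b n with hD
  have hDn : D.coeff n = 0 := by
    rw [hD, Polynomial.coeff_add, Polynomial.coeff_C_mul, hc]; ring
  have hDd : D.natDegree ≤ n := Polynomial.natDegree_add_le_of_degree_le hQ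
    ((Polynomial.natDegree_C_mul_le _ _).trans (jacobiPoly_natDegree_le a b n))
  have hD0 : D = 0 := by
    by_contra hne
    have hlt : D.natDegree < n := by
      refine lt_of_le_of_ne hDd fun h => hne ?_
      rw [← h] at hDn
      exact Polynomial.leadingCoeff_eq_zero.1 hDn
    refine hne (eq_zero_of_polyInner_self ha hb ?_)
    conv_lhs => arg 4; rw [hD]
    rw [polyInner_add_right ha hb, polyInner_C_mul_right, polyInner_comm a b D Q, horth D hlt,
      polyInner_comm a b D, polyInner_jacobiPoly_eq_zero ha hb hlt]
    ring
  rw [hD] at hD0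
  have : Q = -(Polynomial.C (-c) * jacobiPoly a b n) := eq_neg_of_add_eq_zero_left hD0
  rw [this]
  simp

/-! ### Completeness of the Jacobi polynomials -/

/-- By Weierstrass' theorem an integrable function on `(0,1)` is determined by its moments. -/
lemma ae_eq_zero_of_integral_mul_poly {v : ℝ → ℝ} (hv : IntegrableOn v (Ioo 0 1))
    (h : ∀ p : Polynomial ℝ, ∫ x in Ioo (0 : ℝ) 1, v x * p.eval x = 0) :
    ∀ᵐ x ∂(volume.restrict (Ioo (0 : ℝ) 1)), v x = 0 := by
  rw [ae_restrict_iff' measurableSet_Ioo]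
  refine isOpen_Ioo.ae_eq_zero_of_integral_contDiff_smul_eq_zero hv.locallyIntegrableOn ?_
  intro g hg _ hgU
  have hg0 : ∀ x, x ∉ Ioo (0 : ℝ) 1 → g x • v x = 0 := fun x hx => by
    rw [image_eq_zero_of_notMem_tsupport fun hm => hx (hgU hm), zero_smul]
  rw [← setIntegral_eq_integral_of_forall_compl_eq_zero hg0]
  have hbd : ∀ ε > 0, |∫ x in Ioo (0 : ℝ) 1, g x • v x| ≤ ε * ∫ x in Ioo (0 : ℝ) 1, |v x| := by
    intro ε hε
    obtain ⟨p, hp⟩ := exists_polynomial_near_of_continuousOn 0 1 g hg.continuous.continuousOn ε hε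
    have i1 : ∀ {f : ℝ → ℝ}, Continuous f → IntegrableOn (fun x => v x * f x) (Ioo 0 1) := by
      intro f hf
      obtain ⟨C, hC⟩ := (isCompact_Icc (a := (0 : ℝ)) (b := 1)).exists_bound_of_continuousOn
        hf.continuousOn
      refine Integrable.mul_bdd (c := C) hv hf.aestronglyMeasurable ?_
      filter_upwards [ae_restrict_mem measurableSet_Ioo] with x hx
      exact hC x ⟨hx.1.le, hx.2.le⟩
    have e : ∫ x in Ioo (0 : ℝ) 1, g x • v x = ∫ x in Ioo (0 : ℝ) 1, v x * (g x - p.eval x) := by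
      simp only [mul_sub, smul_eq_mul, mul_comm (g _)]
      rw [integral_sub (i1 hg.continuous) (i1 p.continuous), h p, sub_zero]
    rw [e, ← integral_const_mul, ← Real.norm_eq_abs]
    refine (norm_integral_le_integral_norm _).trans ?_
    refine setIntegral_mono_on ?_ ?_ measurableSet_Ioo ?_
    · exact (i1 (hg.continuous.sub p.continuous)).norm
    · exact hv.norm.const_mul ε
    · intro x hx
      rw [norm_mul, mul_comm]
      refine mul_le_mul_of_nonneg_right ?_ (abs_nonneg _)
      rw [Real.norm_eq_abs, abs_sub_comm]
      exact (hp x ⟨hx.1.le, hx.2.le⟩).le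
  by_contra hne
  have hpos := abs_pos.2 hne
  set K := ∫ x in Ioo (0 : ℝ) 1, |v x| with hK
  have hK0 : 0 ≤ K := integral_nonneg fun _ => abs_nonneg _
  have h1 := hbd (|∫ x in Ioo (0 : ℝ) 1, g x • v x| / (2 * (K + 1))) (by positivity)
  rw [div_mul_eq_mul_div, le_div_iff₀ (by positivity)] at h1
  nlinarith

lemma span_jacobiPoly {a b : ℝ} (hab : 0 < a + b + 1) :
    Submodule.span ℝ (range (jacobiPoly a b)) = ⊤ := by
  have h : ∀ n : ℕ, ∀ p : Polynomial ℝ, p.degree < n →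
      p ∈ Submodule.span ℝ (range (jacobiPoly a b)) := by
    intro n
    induction n with
    | zero =>
      intro p hp
      have : p = 0 := Polynomial.degree_eq_bot.1 (Nat.WithBot.lt_zero_iff.1 (by exact_mod_cast hp))
      rw [this]
      exact zero_mem _
    | succ n ih =>
      intro p hp
      have hc := (jacobiPoly_coeff_pos hab n).ne'
      set c := p.coeff n / (jacobiPoly a b n).coeff n with hcd
      have hD : p - c • jacobiPoly a b n ∈ Submodule.span ℝ (range (jacobiPoly a b)) := by
        refine ih _ ((Polynomial.degree_lt_iff_coeff_zero _ _).2 fun m hm => ?_)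
        rw [Polynomial.coeff_sub, Polynomial.coeff_smul, smul_eq_mul]
        rcases hm.eq_or_lt with rfl | hlt
        · rw [hcd, div_mul_cancel₀ _ hc, sub_self]
        · rw [(Polynomial.degree_lt_iff_coeff_zero _ _).1 hp m hlt,
            Polynomial.coeff_eq_zero_of_natDegree_lt
              ((jacobiPoly_natDegree_le a b n).trans_lt hlt), mul_zero, sub_zero]
      have := add_mem hD (Submodule.smul_mem _ c (Submodule.subset_span (mem_range_self n)))
      rwa [sub_add_cancel] at this
  refine eq_top_iff.2 fun p _ => h (p.natDegree + 1) p ?_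
  exact Polynomial.degree_le_natDegree.trans_lt (by exact_mod_cast Nat.lt_succ_self _)

lemma ae_eq_zero_of_integral_mul_jacobiPoly {a b : ℝ} (hab : 0 < a + b + 1) {v : ℝ → ℝ}
    (hv : IntegrableOn v (Ioo 0 1))
    (h : ∀ n, ∫ x in Ioo (0 : ℝ) 1, v x * (jacobiPoly a b n).eval x = 0) :
    ∀ᵐ x ∂(volume.restrict (Ioo (0 : ℝ) 1)), v x = 0 := by
  refine ae_eq_zero_of_integral_mul_poly hv fun p => ?_
  have hi : ∀ p : Polynomial ℝ, IntegrableOn (fun x => v x * p.eval x) (Ioo 0 1) := by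
    intro p
    obtain ⟨C, hC⟩ := (isCompact_Icc (a := (0 : ℝ)) (b := 1)).exists_bound_of_continuousOn
      p.continuous.continuousOn
    refine Integrable.mul_bdd (c := C) hv p.continuous.aestronglyMeasurable ?_
    filter_upwards [ae_restrict_mem measurableSet_Ioo] with x hx
    exact hC x ⟨hx.1.le, hx.2.le⟩
  have hp : p ∈ Submodule.span ℝ (range (jacobiPoly a b)) := by
    rw [span_jacobiPoly hab]; trivial
  induction hp using Submodule.span_induction with
  | mem x hx =>
    obtain ⟨n, rfl⟩ := hx
    exact h n
  | zero => simp
  | add p q _ _ hp hq =>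
    simp only [Polynomial.eval_add, mul_add]
    rw [integral_add (hi p) (hi q), hp, hq, add_zero]
  | smul c p _ hp =>
    simp only [Polynomial.eval_smul, smul_eq_mul, mul_left_comm _ c]
    rw [integral_const_mul, hp, mul_zero]

lemma jacobiNorm_sq (a b : ℝ) (n : ℕ) :
    jacobiNorm a b n ^ 2 = polyInner a b (jacobiPoly a b n) (jacobiPoly a b n) := by
  rw [jacobiNorm, Real.sq_sqrt (integral_nonneg fun _ => sq_nonneg _), integral_wMeasure, polyInner]
  simp only [jacobiPoly_eval, sq]

lemma polyInner_jacobiPoly {a b : ℝ} (ha : -1 < a) (hb : -1 < b) (n m : ℕ) :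
    polyInner a b (jacobiPoly a b n) (jacobiPoly a b m) =
      if n = m then jacobiNorm a b n ^ 2 else 0 := by
  split_ifs with h
  · rw [h, jacobiNorm_sq]
  · rcases lt_or_gt_of_ne h with h | h
    · rw [polyInner_comm]
      exact polyInner_jacobiPoly_eq_zero ha hb ((jacobiPoly_natDegree_le a b n).trans_lt h)
    · exact polyInner_jacobiPoly_eq_zero ha hb ((jacobiPoly_natDegree_le a b m).trans_lt h)

lemma jacobiNorm_pos {a b : ℝ} (ha : -1 < a) (hb : -1 < b) (hab : 0 < a + b + 1) (n : ℕ) :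
    0 < jacobiNorm a b n := by
  refine lt_of_le_of_ne (Real.sqrt_nonneg _) fun h => ?_
  have h1 := jacobiNorm_sq a b n
  rw [← h, zero_pow two_ne_zero] at h1
  have h2 := jacobiPoly_coeff_pos hab n
  rw [eq_zero_of_polyInner_self ha hb h1.symm, Polynomial.coeff_zero] at h2
  exact lt_irrefl _ h2

lemma jacobiG_one_sub (a b : ℝ) (n : ℕ) (x : ℝ) :
    jacobiG a b n (1 - x) = (-1) ^ n * jacobiG b a n x := by
  rw [jacobiG, jacobiG, ← Finset.sum_flip, Finset.mul_sum]
  refine Finset.sum_congr rfl fun m hm => ?_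
  have hm' : m ≤ n := by have := Finset.mem_range.1 hm; omega
  have e : ((-1 : ℝ)) ^ n = (-1) ^ (n - m) * (-1) ^ m := by rw [← pow_add]; congr 1; omega
  rw [Nat.sub_sub_self hm', e, show 2 * (1 - x) - 1 - 1 = -1 * (2 * x - 1 + 1) by ring,
    show 2 * (1 - x) - 1 + 1 = -1 * (2 * x - 1 - 1) by ring, mul_pow, mul_pow]
  ring

lemma integral_Ioo_comp_one_sub (f : ℝ → ℝ) :
    ∫ x in Ioo (0 : ℝ) 1, f (1 - x) = ∫ x in Ioo (0 : ℝ) 1, f x := by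
  rw [← integral_Ioc_eq_integral_Ioo, ← integral_Ioc_eq_integral_Ioo,
    ← intervalIntegral.integral_of_le zero_le_one, ← intervalIntegral.integral_of_le zero_le_one,
    intervalIntegral.integral_comp_sub_left]
  simp

lemma jacobiNorm_swap (a b : ℝ) (n : ℕ) : jacobiNorm b a n = jacobiNorm a b n := by
  rw [jacobiNorm, jacobiNorm, integral_wMeasure, integral_wMeasure,
    ← integral_Ioo_comp_one_sub (fun x => rho a b x * jacobiG a b n x ^ 2)]
  refine congrArg Real.sqrt (integral_congr_ae (Eventually.of_forall fun x => ?_))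
  have : (((-1 : ℝ)) ^ n) ^ 2 = 1 := by rw [← pow_mul, mul_comm, pow_mul]; norm_num
  simp only [rho_one_sub, jacobiG_one_sub, mul_pow, this, one_mul]

/-- The Jacobi coefficient of a function on `(0,1)`, which is `coeff` for the class of a function in
the weighted `L²` space, see `coeff_toLp`. -/
def jcoeff (a b : ℝ) (n : ℕ) (g : ℝ → ℝ) : ℝ :=
  (∫ x in Ioo (0 : ℝ) 1, rho a b x * ((jacobiPoly a b n).eval x * g x)) / jacobiNorm a b n

lemma coeff_eq_jcoeff {a b : ℝ} (ha : -1 < a) (hb : -1 < b) (n : ℕ) (v : WL2 a b) :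
    coeff a b n v = jcoeff a b n v := by
  rw [coeff_eq_integral ha hb, jcoeff, div_eq_mul_inv, ← integral_mul_const]
  refine integral_congr_ae (Eventually.of_forall fun x => ?_)
  simp only [jacobiN, jacobiPoly_eval]
  ring

lemma jcoeff_congr {a b : ℝ} {n : ℕ} {g h : ℝ → ℝ} (hgh : g =ᵐ[wMeasure a b] h) :
    jcoeff a b n g = jcoeff a b n h := by
  have h1 : ∀ᵐ x ∂(volume.restrict (Ioo (0 : ℝ) 1)), g x = h x := (ae_wMeasure_iff a b _).1 hgh
  rw [jcoeff, jcoeff]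
  congr 1
  refine integral_congr_ae ?_
  filter_upwards [h1] with x hx
  simp only [hx]

lemma coeff_toLp {a b : ℝ} (ha : -1 < a) (hb : -1 < b) (n : ℕ) {g : ℝ → ℝ}
    (hg : MemLp g 2 (wMeasure a b)) : coeff a b n (hg.toLp g) = jcoeff a b n g := by
  rw [coeff_eq_jcoeff ha hb, jcoeff_congr hg.coeFn_toLp]

lemma jcoeff_jacobiN {a b : ℝ} (ha : -1 < a) (hb : -1 < b) (hab : 0 < a + b + 1) (n m : ℕ) :
    jcoeff a b n (jacobiN a b m) = if n = m then 1 else 0 := by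
  have e : jcoeff a b n (jacobiN a b m) =
      polyInner a b (jacobiPoly a b n) (jacobiPoly a b m) / jacobiNorm a b m /
        jacobiNorm a b n := by
    rw [jcoeff, polyInner, ← integral_div (jacobiNorm a b m)]
    refine congrArg (· / jacobiNorm a b n)
      (integral_congr_ae (Eventually.of_forall fun x => ?_))
    simp only [jacobiN, jacobiPoly_eval]
    ring
  rw [e, polyInner_jacobiPoly ha hb]
  have hn := (jacobiNorm_pos ha hb hab n).ne'
  split_ifs with h
  · subst h
    field_simp
  · simp

lemma jacobiLp_eq {a b : ℝ} (ha : -1 < a) (hb : -1 < b) (n : ℕ) :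
    jacobiLp a b n = (memLp_jacobiN ha hb n).toLp _ := by
  unfold jacobiLp; rw [dif_pos]

lemma orthonormal_jacobiLp {a b : ℝ} (ha : -1 < a) (hb : -1 < b) (hab : 0 < a + b + 1) :
    Orthonormal ℝ (jacobiLp a b) := by
  rw [orthonormal_iff_ite]
  intro n m
  have h : inner ℝ (jacobiLp a b n) (jacobiLp a b m) = coeff a b n (jacobiLp a b m) := rfl
  rw [h, jacobiLp_eq ha hb m, coeff_toLp ha hb, jcoeff_jacobiN ha hb hab]

lemma integrable_of_memLp {a b : ℝ} (ha : -1 < a) (hb : -1 < b) {g : ℝ → ℝ}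
    (hg : MemLp g 2 (wMeasure a b)) : IntegrableOn (fun x => rho a b x * g x) (Ioo 0 1) := by
  have := isFiniteMeasure_wMeasure ha hb
  exact (integrable_wMeasure_iff a b g).1 (hg.integrable one_le_two)

/-- The normalised Jacobi polynomials as an orthonormal basis. -/
def jacobiBasis {a b : ℝ} (ha : -1 < a) (hb : -1 < b) (hab : 0 < a + b + 1) :
    HilbertBasis ℕ ℝ (WL2 a b) :=
  HilbertBasis.mkOfOrthogonalEqBot (orthonormal_jacobiLp ha hb hab) <| by
    rw [Submodule.eq_bot_iff]
    intro v hv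
    have h0 : ∀ n, jcoeff a b n v = 0 := fun n => by
      rw [← coeff_eq_jcoeff ha hb]
      exact Submodule.inner_right_of_mem_orthogonal
        (Submodule.subset_span (mem_range_self n)) hv
    have h1 := ae_eq_zero_of_integral_mul_jacobiPoly hab (integrable_of_memLp ha hb (Lp.memLp v))
      fun n => by
        have := h0 n
        rw [jcoeff, div_eq_zero_iff] at this
        refine Eq.trans (integral_congr_ae (Eventually.of_forall fun x => ?_))
          (this.resolve_right (jacobiNorm_pos ha hb hab n).ne')
        ring
    rw [Lp.eq_zero_iff_ae_eq_zero]
    refine (ae_wMeasure_iff a b _).2 ?_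
    filter_upwards [h1, ae_restrict_mem measurableSet_Ioo] with x hx hm
    exact (mul_eq_zero.1 hx).resolve_left (rho_pos hm).ne'

lemma jacobiBasis_apply {a b : ℝ} (ha : -1 < a) (hb : -1 < b) (hab : 0 < a + b + 1) (n : ℕ) :
    jacobiBasis ha hb hab n = jacobiLp a b n :=
  congrFun (HilbertBasis.coe_mkOfOrthogonalEqBot _ _) n

lemma jacobiBasis_repr {a b : ℝ} (ha : -1 < a) (hb : -1 < b) (hab : 0 < a + b + 1) (v : WL2 a b)
    (n : ℕ) : (jacobiBasis ha hb hab).repr v n = coeff a b n v := by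
  rw [HilbertBasis.repr_apply_apply, jacobiBasis_apply]
  rfl

lemma summable_jcoeff_sq {a b : ℝ} (ha : -1 < a) (hb : -1 < b) (hab : 0 < a + b + 1) {g : ℝ → ℝ}
    (hg : MemLp g 2 (wMeasure a b)) : Summable fun n => jcoeff a b n g ^ 2 := by
  have h := (jacobiBasis ha hb hab).summable_inner_mul_inner (hg.toLp g) (hg.toLp g)
  refine h.congr fun n => ?_
  rw [jacobiBasis_apply, real_inner_comm, ← sq]
  exact congrArg (· ^ 2) (coeff_toLp ha hb n hg)

/-- It suffices that the function agrees on `(0,1)` with one that is continuous on the whole line,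
and thus bounded on `[0,1]`. -/
lemma memLp_of_eqOn_continuous {a b : ℝ} (ha : -1 < a) (hb : -1 < b) {g : ℝ → ℝ} {f : ℝ → ℝ}
    (hf : Continuous f) (hgf : ∀ x ∈ Ioo (0 : ℝ) 1, g x = f x) : MemLp g 2 (wMeasure a b) := by
  have := isFiniteMeasure_wMeasure ha hb
  obtain ⟨C, hC⟩ := (isCompact_Icc (a := (0 : ℝ)) (b := 1)).exists_bound_of_continuousOn
    hf.continuousOn
  have h : f =ᵐ[wMeasure a b] g := ae_wMeasure_of_forall fun x hx => (hgf x hx).symm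
  refine (memLp_congr_ae h).1 (MemLp.of_bound hf.aestronglyMeasurable C ?_)
  exact ae_wMeasure_of_forall fun x hx => hC x ⟨hx.1.le, hx.2.le⟩

/-! ### Eigenvalue relations -/

lemma contDiff_wDiff (a b : ℝ) {g : ℝ → ℝ} (hg : ContDiff ℝ ∞ g) : ContDiff ℝ ∞ (wDiff a b g) := by
  have hg' := (contDiff_infty_iff_deriv.1 hg).2
  unfold wDiff
  fun_prop

lemma integral_deriv_wDiff_mul {a b : ℝ} (ha : 0 < a) (hb : 0 < b) {g h : ℝ → ℝ}
    (hg : ContDiff ℝ ∞ g) (hh : ContDiff ℝ ∞ h) :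
    ∫ x in Ioo (0 : ℝ) 1, rho a b x * (h x * deriv (wDiff a b g) x) =
      -∫ x in Ioo (0 : ℝ) 1, wDiff a b g x * (rho (a - 1) (b - 1) x * wDiff a b h x) := by
  have hwg := contDiff_wDiff a b hg
  have hwg' := (contDiff_infty_iff_deriv.1 hwg).2
  rw [integral_mul_deriv_of_zero (v := fun x => rho a b x * h x)
    (v' := fun x => rho (a - 1) (b - 1) x * wDiff a b h x) (F := wDiff a b g)
    (F' := deriv (wDiff a b g)) ((continuous_rho ha.le hb.le).mul hh.continuous).continuousOn
    (by simp [rho_zero hb.ne']) (by simp [rho_one ha.ne'])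
    (fun x hx => hasDerivAt_rho_mul a b hx (hh.differentiable (by simp)).differentiableAt)
    (integrableOn_rho_mul (by linarith) (by linarith) (contDiff_wDiff a b hh).continuous)
    hwg.continuous.continuousOn
    (fun x _ => (hwg.differentiable (by simp)).differentiableAt.hasDerivAt)
    hwg'.continuous.continuousOn, neg_neg]
  refine integral_congr_ae (Eventually.of_forall fun x => ?_)
  ring

/-- The Sturm–Liouville operator `g ↦ (wDiff g)'` is symmetric. -/
lemma integral_deriv_wDiff_symm {a b : ℝ} (ha : 0 < a) (hb : 0 < b) {g h : ℝ → ℝ}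
    (hg : ContDiff ℝ ∞ g) (hh : ContDiff ℝ ∞ h) :
    ∫ x in Ioo (0 : ℝ) 1, rho a b x * (h x * deriv (wDiff a b g) x) =
      ∫ x in Ioo (0 : ℝ) 1, rho a b x * (g x * deriv (wDiff a b h) x) := by
  rw [integral_deriv_wDiff_mul ha hb hg hh, integral_deriv_wDiff_mul ha hb hh hg]
  refine congrArg Neg.neg (integral_congr_ae (Eventually.of_forall fun x => ?_))
  ring

lemma contDiff_eval (p : Polynomial ℝ) : ContDiff ℝ ∞ fun x => p.eval x := by
  simpa using p.contDiff_aeval (𝕜 := ℝ) ∞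

lemma deriv_wDiff_eval (a b : ℝ) (p : Polynomial ℝ) :
    deriv (wDiff a b fun x => p.eval x) = fun x => (polyDiff a b p).derivative.eval x := by
  ext x; rw [wDiff_eval, Polynomial.deriv]

/-- The Sturm–Liouville equation of the Jacobi polynomials. -/
lemma derivative_polyDiff_jacobiPoly {a b : ℝ} (ha : 0 < a) (hb : 0 < b) (n : ℕ) :
    (polyDiff a b (jacobiPoly a b n)).derivative =
      Polynomial.C (-((n + 1) * (a + b + n))) * jacobiPoly a b n := by
  have hdeg : ∀ {m : ℕ} {p : Polynomial ℝ}, p.natDegree ≤ m →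
      (polyDiff a b p).derivative.natDegree ≤ m := fun {m p} hp => by
    have h1 := Polynomial.natDegree_derivative_le (polyDiff a b p)
    have h2 := polyDiff_natDegree_le a b hp
    omega
  refine eq_C_mul_jacobiPoly (by linarith) (by linarith) (hdeg (jacobiPoly_natDegree_le a b n))
    ?_ fun q hq => ?_
  · rw [Polynomial.coeff_derivative, polyDiff_coeff a b (jacobiPoly_natDegree_le a b n)]
    ring
  · have h := integral_deriv_wDiff_symm ha hb (contDiff_eval q) (contDiff_eval (jacobiPoly a b n))
    rw [deriv_wDiff_eval, deriv_wDiff_eval] at h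
    have h2 := polyInner_jacobiPoly_eq_zero (a := a) (b := b) (by linarith) (by linarith)
      ((hdeg le_rfl).trans_lt hq)
    rw [polyInner] at h2
    rw [polyInner_comm, polyInner, ← h, h2]

/-- The operator `L_r^α` maps `ρ^{(a,b)} G_n^{(a,b)}` to a multiple of `G_n^{(b,a)}`: the image is a
polynomial of degree at most `n`, and by adjointness it is orthogonal to lower degrees. -/
theorem Params.fracOp_jacobiPoly {a b r : ℝ} (P : Params a b r) (n : ℕ) {x : ℝ}
    (hx : x ∈ Ioo (0 : ℝ) 1) :
    fracOp (a + b) r (fun x => rho a b x * (jacobiPoly a b n).eval x) x =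
      eigen a b r n * (jacobiPoly b a n).eval x := by
  have ha := P.a_pos
  have hb := P.b_pos
  obtain ⟨F, hFd, hFc, -, hF⟩ := P.exists_fracOp_rho_mul (jacobiPoly_natDegree_le a b n)
  have key : -F.derivative = Polynomial.C (eigen a b r n) * jacobiPoly b a n := by
    refine eq_C_mul_jacobiPoly (by linarith) (by linarith) (by rwa [Polynomial.natDegree_neg])
      (by rw [hFc, jacobiPoly_coeff_swap]) fun q hq => ?_
    obtain ⟨F', hFd', -, -, hF'⟩ := P.symm.exists_fracOp_rho_mul (le_refl q.natDegree)
    have h1 := P.integral_fracOp_poly (jacobiPoly a b n) q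
    have h2 : polyInner b a (-F.derivative) q = ∫ x in Ioo (0 : ℝ) 1,
        fracOp (a + b) r (fun x => rho a b x * (jacobiPoly a b n).eval x) x *
          (rho b a x * q.eval x) :=
      setIntegral_congr_fun measurableSet_Ioo fun x hx => by rw [hF x hx]; ring
    have h3 : polyInner a b (jacobiPoly a b n) (-F'.derivative) = ∫ x in Ioo (0 : ℝ) 1,
        (rho a b x * (jacobiPoly a b n).eval x) *
          fracOp (a + b) (1 - r) (fun x => rho b a x * q.eval x) x :=
      setIntegral_congr_fun measurableSet_Ioo fun x hx => by
        rw [add_comm a b, hF' x hx]; ring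
    rw [h2, h1, ← h3]
    exact polyInner_jacobiPoly_eq_zero (by linarith) (by linarith)
      (by rw [Polynomial.natDegree_neg]; omega)
  rw [hF x hx, key, Polynomial.eval_mul, Polynomial.eval_C]

/-! ### Rapidly decaying Jacobi coefficients -/

/-- Functions in all spaces `H^s_{(a,b)}(I)`. -/
structure Rapid (a b : ℝ) (g : ℝ → ℝ) : Prop where
  memLp : MemLp g 2 (wMeasure a b)
  summable : ∀ k : ℕ, Summable fun n : ℕ => (1 + (n : ℝ) ^ 2) ^ k * jcoeff a b n g ^ 2

lemma jcoeff_deriv_wDiff {a b : ℝ} (ha : 0 < a) (hb : 0 < b) {g : ℝ → ℝ} (hg : ContDiff ℝ ∞ g)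
    (n : ℕ) : jcoeff a b n (deriv (wDiff a b g)) = -((n + 1) * (a + b + n)) * jcoeff a b n g := by
  rw [jcoeff, jcoeff, integral_deriv_wDiff_symm ha hb hg (contDiff_eval _), deriv_wDiff_eval,
    derivative_polyDiff_jacobiPoly ha hb, ← mul_div_assoc, ← integral_const_mul]
  refine congrArg (· / jacobiNorm a b n) (integral_congr_ae (Eventually.of_forall fun x => ?_))
  simp only [Polynomial.eval_mul, Polynomial.eval_C]
  ring

/-- The Sturm–Liouville operator preserves smoothness and multiplies the `n`-th coefficient by a
factor of order `n²`. -/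
lemma rapid_of_contDiff {a b : ℝ} (ha : 0 < a) (hb : 0 < b) (hab : 1 ≤ a + b) {g : ℝ → ℝ}
    (hg : ContDiff ℝ ∞ g) : Rapid a b g where
  memLp := memLp_of_eqOn_continuous (by linarith) (by linarith) hg.continuous fun _ _ => rfl
  summable := by
    intro k
    induction k generalizing g with
    | zero =>
      simpa using summable_jcoeff_sq (a := a) (b := b) (by linarith) (by linarith) (by linarith)
        (memLp_of_eqOn_continuous (by linarith) (by linarith) hg.continuous fun _ _ => rfl)
    | succ k ih =>
      have h := ih (contDiff_infty_iff_deriv.1 (contDiff_wDiff a b hg)).2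
      refine Summable.of_nonneg_of_le (fun n => by positivity) (fun n => ?_) h
      rw [jcoeff_deriv_wDiff ha hb hg, pow_succ, mul_assoc, mul_pow]
      refine mul_le_mul_of_nonneg_left (mul_le_mul_of_nonneg_right ?_ (sq_nonneg _)) (by positivity)
      have hn : (0 : ℝ) ≤ n := n.cast_nonneg
      have h1 : (n : ℝ) + 1 ≤ (n + 1) * (a + b + n) := by nlinarith
      have h2 : (1 : ℝ) + n ^ 2 ≤ (n + 1) ^ 2 := by nlinarith
      rw [neg_sq]
      exact h2.trans (pow_le_pow_left₀ (by positivity) h1 2)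

/-! ### Growth of the eigenvalues -/

lemma Params.eigen_pos {a b r : ℝ} (P : Params a b r) (n : ℕ) : 0 < eigen a b r n := by
  have h1 : 0 < Real.Gamma (2 - (a + b)) := Real.Gamma_pos_of_pos (by linarith [P.lt_two])
  have h2 : 0 < abelFactor (a + b) (n + 1) := Finset.prod_pos fun j _ =>
    div_pos (by have := P.one_lt; have : (0 : ℝ) ≤ j := j.cast_nonneg; linarith) (by positivity)
  have h3 := P.a_pos
  have h4 := P.b_pos
  have h5 := P.abelConst_pos
  unfold eigen
  positivity

lemma abelFactor_eq {α : ℝ} (hα : 1 < α) {n : ℕ} (hn : n ≠ 0) :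
    abelFactor α (n + 1) * (n + 1) = (n : ℝ) ^ (α - 1) / Real.GammaSeq (α - 1) n := by
  have hprod : ∏ j ∈ Finset.range (n + 1), (α - 1 + j) ≠ 0 := by
    refine Finset.prod_ne_zero_iff.2 fun j _ => ?_
    have : (0 : ℝ) ≤ j := j.cast_nonneg
    linarith
  have hf : ∏ j ∈ Finset.range (n + 1), ((j : ℝ) + 1) = (n + 1).factorial := by
    rw [← Finset.prod_range_add_one_eq_factorial]
    push_cast
    rfl
  have hp : (0 : ℝ) < (n : ℝ) ^ (α - 1) :=
    Real.rpow_pos_of_pos (by exact_mod_cast Nat.pos_of_ne_zero hn) _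
  rw [abelFactor, Finset.prod_div_distrib, hf, Real.GammaSeq, Nat.factorial_succ]
  push_cast
  field_simp

/-- The factor `(α-1)_{n+1} / n!` in the eigenvalue is the reciprocal of Euler's approximation
`Real.GammaSeq` to `Γ(α-1)`, up to a power of `n`. -/
lemma tendsto_eigen_div {a b r : ℝ} (P : Params a b r) :
    Tendsto (fun n : ℕ => eigen a b r n / (1 + (n : ℝ) ^ 2) ^ ((a + b) / 2)) atTop
      (𝓝 (abelConst a b r / Real.Gamma (2 - (a + b)) / Real.Gamma (a + b - 1))) := by
  have hα := P.one_lt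
  have hG : Real.Gamma (a + b - 1) ≠ 0 := (Real.Gamma_pos_of_pos (by linarith)).ne'
  have h1 : Tendsto (fun n : ℕ => abelConst a b r / Real.Gamma (2 - (a + b)) /
      Real.GammaSeq (a + b - 1) n) atTop
      (𝓝 (abelConst a b r / Real.Gamma (2 - (a + b)) / Real.Gamma (a + b - 1))) :=
    tendsto_const_nhds.div (Real.GammaSeq_tendsto_Gamma _) hG
  have hinv : Tendsto (fun n : ℕ => ((n : ℝ))⁻¹) atTop (𝓝 0) := tendsto_inv_atTop_nhds_zero_nat
  have h2 : Tendsto (fun n : ℕ => (1 / (((n : ℝ))⁻¹ ^ 2 + 1)) ^ ((a + b) / 2)) atTop (𝓝 1) := by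
    have : Tendsto (fun n : ℕ => 1 / (((n : ℝ))⁻¹ ^ 2 + 1)) atTop (𝓝 (1 / (0 ^ 2 + 1))) :=
      tendsto_const_nhds.div ((hinv.pow 2).add_const 1) (by norm_num)
    have h3 := this.rpow_const (p := (a + b) / 2) (Or.inl (by norm_num))
    simpa using h3
  have h3 : Tendsto (fun n : ℕ => (a + b) * ((n : ℝ))⁻¹ + 1) atTop (𝓝 1) := by
    simpa using (hinv.const_mul (a + b)).add_const 1
  have h4 := (h1.mul h2).mul h3
  rw [mul_one, mul_one] at h4
  refine h4.congr' ?_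
  filter_upwards [eventually_ne_atTop 0] with n hn
  have hn0 : (0 : ℝ) < n := by exact_mod_cast Nat.pos_of_ne_zero hn
  have e1 : 1 / (((n : ℝ))⁻¹ ^ 2 + 1) = n ^ 2 / (1 + n ^ 2) := by field_simp
  have e2 : ((n : ℝ) ^ 2) ^ ((a + b) / 2) = n ^ (a + b - 1) * n := by
    rw [← Real.rpow_natCast, ← Real.rpow_mul hn0.le, ← Real.rpow_add_one hn0.ne']
    congr 1; push_cast; ring
  have e3 := abelFactor_eq hα hn
  rw [e1, Real.div_rpow (by positivity) (by positivity), e2, eigen]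
  have e4 : abelFactor (a + b) (n + 1) * ((n + 1) * (a + b + n)) =
      (n : ℝ) ^ (a + b - 1) / Real.GammaSeq (a + b - 1) n * (a + b + n) := by
    rw [← e3]; ring
  rw [e4]
  field_simp

/-- The eigenvalues grow like `n^α`. -/
lemma Params.exists_eigen_bounds {a b r : ℝ} (P : Params a b r) : ∃ c C : ℝ, 0 < c ∧ 0 < C ∧
    ∀ n : ℕ, c * (1 + (n : ℝ) ^ 2) ^ ((a + b) / 2) ≤ eigen a b r n ∧
      eigen a b r n ≤ C * (1 + (n : ℝ) ^ 2) ^ ((a + b) / 2) := by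
  have h := tendsto_eigen_div P
  have hL : 0 < abelConst a b r / Real.Gamma (2 - (a + b)) / Real.Gamma (a + b - 1) :=
    div_pos (div_pos P.abelConst_pos (Real.Gamma_pos_of_pos (by linarith [P.lt_two])))
      (Real.Gamma_pos_of_pos (by linarith [P.one_lt]))
  obtain ⟨C, hC⟩ := h.bddAbove_range
  obtain ⟨D, hD⟩ := (h.inv₀ hL.ne').bddAbove_range
  have hpos : ∀ n : ℕ, (0 : ℝ) < (1 + (n : ℝ) ^ 2) ^ ((a + b) / 2) := fun n => by positivity
  have hq : ∀ n : ℕ, 0 < eigen a b r n / (1 + (n : ℝ) ^ 2) ^ ((a + b) / 2) := fun n =>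
    div_pos (P.eigen_pos n) (hpos n)
  have hC' : ∀ n : ℕ, eigen a b r n / (1 + (n : ℝ) ^ 2) ^ ((a + b) / 2) ≤ C := fun n =>
    hC (mem_range_self n)
  have hD' : ∀ n : ℕ, (eigen a b r n / (1 + (n : ℝ) ^ 2) ^ ((a + b) / 2))⁻¹ ≤ D := fun n =>
    hD (mem_range_self n)
  have hD0 : 0 < D := (inv_pos.2 (hq 0)).trans_le (hD' 0)
  refine ⟨D⁻¹, C, inv_pos.2 hD0, (hq 0).trans_le (hC' 0), fun n => ⟨?_, ?_⟩⟩
  · rw [← le_div_iff₀ (hpos n)]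
    exact inv_le_of_inv_le₀ (hq n) (hD' n)
  · rw [← div_le_iff₀ (hpos n)]
    exact hC' n

/-! ### Jacobi coefficients of the image of a test function -/

lemma contDiffOn_rho (a b : ℝ) : ContDiffOn ℝ ∞ (rho a b) (Ioo 0 1) := by
  unfold rho
  refine ContDiffOn.mul (ContDiffOn.rpow_const_of_ne (by fun_prop) fun x hx => ?_)
    (ContDiffOn.rpow_const_of_ne contDiffOn_id fun x hx => hx.1.ne')
  have := hx.2
  linarith

lemma IsTest.mul {ψ k : ℝ → ℝ} (hψ : IsTest ψ) (hk : ContDiffOn ℝ ∞ k (Ioo 0 1)) :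
    IsTest fun x => k x * ψ x := by
  refine ⟨contDiff_iff_contDiffAt.2 fun x => ?_, hψ.2.1.mul_left,
    (tsupport_mul_subset_right).trans hψ.2.2⟩
  by_cases hx : x ∈ tsupport ψ
  · have hx' := hψ.2.2 hx
    exact ((hk x hx').contDiffAt (Ioo_mem_nhds hx'.1 hx'.2)).mul hψ.1.contDiffAt
  · have h0 : (fun x => k x * ψ x) =ᶠ[𝓝 x] fun _ => 0 := by
      filter_upwards [notMem_tsupport_iff_eventuallyEq.1 hx] with z hz
      simp [hz]
    exact contDiffAt_const.congr_of_eventuallyEq h0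

lemma IsTest.rho_mul {ψ : ℝ → ℝ} (hψ : IsTest ψ) (a b : ℝ) : IsTest fun x => rho a b x * ψ x :=
  hψ.mul (contDiffOn_rho a b)

lemma IsTest.div_rho {ψ : ℝ → ℝ} (hψ : IsTest ψ) (a b : ℝ) : IsTest fun x => ψ x / rho a b x := by
  have h := hψ.mul (k := fun x => (rho a b x)⁻¹)
    ((contDiffOn_rho a b).inv fun x hx => (rho_pos hx).ne')
  simpa only [div_eq_inv_mul] using h

lemma IsTest.rho_mul_div {ψ : ℝ → ℝ} (hψ : IsTest ψ) (a b : ℝ) :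
    (fun x => rho a b x * (ψ x / rho a b x)) = ψ := by
  ext x
  by_cases hx : x ∈ Ioo (0 : ℝ) 1
  · exact mul_div_cancel₀ _ (rho_pos hx).ne'
  · simp [hψ.eq_zero hx]

/-- The function `ρ^{(a,b)} p` as the primitive of its derivative. -/
lemma integral_wPoly_polyDiff {a b : ℝ} (ha : 0 < a) (hb : 0 < b) (p : Polynomial ℝ) {x : ℝ}
    (hx : x ∈ Icc (0 : ℝ) 1) :
    ∫ t in (0 : ℝ)..x, wPoly a b (polyDiff a b p) t = rho a b x * p.eval x := by
  have h := intervalIntegral.integral_eq_sub_of_hasDerivAt_of_le hx.1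
    ((continuous_rho ha.le hb.le).mul p.continuous).continuousOn
    (f' := wPoly a b (polyDiff a b p)) (fun t ht => ?_) ?_
  · rw [h]
    simp [rho_zero hb.ne']
  · refine (hasDerivAt_rho_mul a b ⟨ht.1, ht.2.trans_le hx.2⟩ p.differentiableAt).congr_deriv ?_
    rw [wDiff_eval, wPoly]
  · rw [intervalIntegrable_iff_integrableOn_Ioo_of_le hx.1]
    exact (integrableOn_wPoly ha hb _).mono_set (Ioo_subset_Ioo_right hx.2)

lemma absolutelyContinuousOnInterval_primitive {v : ℝ → ℝ} (hv : IntegrableOn v (Ioo 0 1)) :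
    AbsolutelyContinuousOnInterval (fun x => ∫ t in (0 : ℝ)..x, v t) 0 1 :=
  ((intervalIntegrable_iff_integrableOn_Ioo_of_le zero_le_one).2
    hv).absolutelyContinuousOnInterval_intervalIntegral (by simp)

/-- Adjointness against test functions: `ρ^{(a,b)} G_n` is absolutely continuous, hence the weak
form of the equation applies, and its flux is a polynomial. -/
lemma Params.integral_fracOp_test {a b r : ℝ} (P : Params a b r) (n : ℕ) {ψ : ℝ → ℝ}
    (hψ : IsTest ψ) :
    ∫ x in Ioo (0 : ℝ) 1, (rho a b x * (jacobiPoly a b n).eval x) * fracOp (a + b) (1 - r) ψ x =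
      eigen a b r n * ∫ x in Ioo (0 : ℝ) 1, (jacobiPoly b a n).eval x * ψ x := by
  set p := jacobiPoly a b n with hp
  obtain ⟨F, -, -, hFl, hF⟩ := P.exists_fracOp_rho_mul (jacobiPoly_natDegree_le a b n)
  rw [← hp] at hFl hF
  set v := wPoly a b (polyDiff a b p) with hv
  have hvi : IntegrableOn v (Ioo 0 1) := integrableOn_wPoly P.a_pos P.b_pos _
  set u : ℝ → ℝ := fun x => ∫ t in (0 : ℝ)..x, v t with hu
  have hux : ∀ x ∈ Icc (0 : ℝ) 1, u x = rho a b x * p.eval x := fun x hx =>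
    integral_wPoly_polyDiff P.a_pos P.b_pos p hx
  have hder : ∀ t ∈ Ioo (0 : ℝ) 1, deriv u t = v t := fun t ht => by
    have : u =ᶠ[𝓝 t] fun x => rho a b x * p.eval x := by
      filter_upwards [Ioo_mem_nhds ht.1 ht.2] with z hz using hux z ⟨hz.1.le, hz.2.le⟩
    rw [this.deriv_eq, deriv_rho_mul_eval a b p t ht]
  have key := integral_flux_mul_deriv (r := r) P.lt_two
    (absolutelyContinuousOnInterval_primitive hvi) (by simp)
    ((hux 1 ⟨zero_le_one, le_rfl⟩).trans (by rw [rho_one P.a_pos.ne', zero_mul])) hψ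
  rw [← hu] at key
  have e1 : ∫ x in (0 : ℝ)..1, (r * leftFlux (a + b) u x + (1 - r) * rightFlux (a + b) u x) *
      deriv ψ x = ∫ x in Ioo (0 : ℝ) 1, F.eval x * deriv ψ x := by
    rw [intervalIntegral.integral_of_le zero_le_one, integral_Ioc_eq_integral_Ioo]
    refine setIntegral_congr_fun measurableSet_Ioo fun x hx => ?_
    simp only [← hFl x hx, leftFlux_eq, rightFlux_eq, twoAbel, leftAbel_congr hder hx,
      rightAbel_congr hder hx]
    ring
  have e2 := integral_mul_deriv_of_zero (v := ψ) (v' := deriv ψ) (F := fun x => F.eval x)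
    (F' := fun x => F.derivative.eval x) hψ.continuous.continuousOn (hψ.eq_zero (by simp))
    (hψ.eq_zero (by simp)) (fun x _ => hψ.hasDerivAt x)
    (hψ.deriv.continuous.continuousOn.integrableOn_Icc.mono_set Ioo_subset_Icc_self)
    F.continuous.continuousOn (fun x _ => F.hasDerivAt x) F.derivative.continuous.continuousOn
  have e3 : ∫ x in Ioo (0 : ℝ) 1, u x * fracOp (a + b) (1 - r) ψ x =
      ∫ x in Ioo (0 : ℝ) 1, (rho a b x * p.eval x) * fracOp (a + b) (1 - r) ψ x :=
    setIntegral_congr_fun measurableSet_Ioo fun x hx => by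
      simp only [hux x ⟨hx.1.le, hx.2.le⟩]
  rw [← e3, ← key, e1, e2, ← integral_neg, ← integral_const_mul]
  refine setIntegral_congr_fun measurableSet_Ioo fun x hx => ?_
  have h1 := hF x hx
  rw [hp, P.fracOp_jacobiPoly n hx, Polynomial.eval_neg] at h1
  linear_combination (-ψ x) * h1

/-- The functions `g` by which the equation is tested. -/
def Admissible (g : ℝ → ℝ) : Prop := IsTest g ∨ ∃ p : Polynomial ℝ, g = fun x => p.eval x

lemma Admissible.contDiff {g : ℝ → ℝ} (hg : Admissible g) : ContDiff ℝ ∞ g := by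
  rcases hg with hg | ⟨p, rfl⟩
  · exact hg.1
  · exact contDiff_eval p

/-- `L_{1-r}^α (ρ^{(b,a)} g)` is bounded and continuous on `(0,1)`. -/
lemma Params.exists_continuous_fracOp {a b r : ℝ} (P : Params a b r) {g : ℝ → ℝ}
    (hg : Admissible g) : ∃ f : ℝ → ℝ, Continuous f ∧ ∀ x ∈ Ioo (0 : ℝ) 1,
      fracOp (a + b) (1 - r) (fun x => rho b a x * g x) x = f x := by
  rcases hg with hg | ⟨p, rfl⟩
  · exact ⟨_, continuous_const.mul ((hg.rho_mul b a).deriv.deriv.continuous_testTwoAbel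
      P.lt_two) |>.neg, fun x hx => (hg.rho_mul b a).fracOp_eq P.lt_two hx⟩
  · obtain ⟨F, -, -, -, hF⟩ := P.symm.exists_fracOp_rho_mul (le_refl p.natDegree)
    rw [add_comm b a] at hF
    exact ⟨_, (-F.derivative).continuous, hF⟩

lemma Params.memLp_fracOp {a b r : ℝ} (P : Params a b r) {g : ℝ → ℝ} (hg : Admissible g) :
    MemLp (fracOp (a + b) (1 - r) fun x => rho b a x * g x) 2 (wMeasure a b) := by
  obtain ⟨f, hf, hfg⟩ := P.exists_continuous_fracOp hg
  exact memLp_of_eqOn_continuous (by linarith [P.a_pos]) (by linarith [P.b_pos]) hf hfg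

/-- In Jacobi coefficients the operator is diagonal. -/
theorem Params.jcoeff_fracOp {a b r : ℝ} (P : Params a b r) {g : ℝ → ℝ} (hg : Admissible g)
    (n : ℕ) : jcoeff a b n (fracOp (a + b) (1 - r) fun x => rho b a x * g x) =
      eigen a b r n * jcoeff b a n g := by
  rw [jcoeff, jcoeff, jacobiNorm_swap, ← mul_div_assoc]
  refine congrArg (· / jacobiNorm b a n) ?_
  simp only [← mul_assoc (rho a b _)]
  rcases hg with hg | ⟨p, rfl⟩
  · rw [P.integral_fracOp_test n (hg.rho_mul b a)]
    refine congrArg (eigen a b r n * ·)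
      (integral_congr_ae (Eventually.of_forall fun x => ?_))
    ring
  · rw [← P.integral_fracOp_poly (jacobiPoly a b n) p, ← integral_const_mul]
    refine setIntegral_congr_fun measurableSet_Ioo fun x hx => ?_
    simp only [P.fracOp_jacobiPoly n hx]
    ring

lemma Params.rapid_admissible {a b r : ℝ} (P : Params a b r) {g : ℝ → ℝ} (hg : Admissible g) :
    Rapid b a g :=
  rapid_of_contDiff P.b_pos P.a_pos P.symm.one_lt.le hg.contDiff

lemma Params.rapid_fracOp {a b r : ℝ} (P : Params a b r) {g : ℝ → ℝ} (hg : Admissible g) :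
    Rapid a b (fracOp (a + b) (1 - r) fun x => rho b a x * g x) where
  memLp := P.memLp_fracOp hg
  summable := by
    intro k
    obtain ⟨c, C, -, hC, hbd⟩ := P.exists_eigen_bounds
    refine Summable.of_nonneg_of_le (fun n => by positivity) (fun n => ?_)
      (((P.rapid_admissible hg).summable (k + 2)).mul_left (C ^ 2))
    have h1 : (1 : ℝ) ≤ 1 + (n : ℝ) ^ 2 := by nlinarith [sq_nonneg (n : ℝ)]
    have h2 : (1 + (n : ℝ) ^ 2) ^ ((a + b) / 2) ≤ 1 + (n : ℝ) ^ 2 := by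
      conv_rhs => rw [← Real.rpow_one (1 + (n : ℝ) ^ 2)]
      exact Real.rpow_le_rpow_of_exponent_le h1 (by linarith [P.lt_two])
    have h3 : eigen a b r n ≤ C * (1 + (n : ℝ) ^ 2) :=
      (hbd n).2.trans (mul_le_mul_of_nonneg_left h2 hC.le)
    have h4 := pow_le_pow_left₀ (P.eigen_pos n).le h3 2
    rw [P.jcoeff_fracOp hg, mul_pow]
    calc (1 + (n : ℝ) ^ 2) ^ k * (eigen a b r n ^ 2 * jcoeff b a n g ^ 2)
        ≤ (1 + (n : ℝ) ^ 2) ^ k * ((C * (1 + (n : ℝ) ^ 2)) ^ 2 * jcoeff b a n g ^ 2) := by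
          gcongr
      _ = _ := by ring

/-! ### Sequence models of the weighted Sobolev spaces -/

/-- The sequence space `ℓ²(ℕ)`. -/
abbrev SeqL2 : Type := lp (fun _ : ℕ => ℝ) 2

lemma one_add_sq_pos (j : ℕ) : (0 : ℝ) < 1 + (j : ℝ) ^ 2 := by positivity

lemma rpow_neg_mul_rpow (s : ℝ) (j : ℕ) :
    (1 + (j : ℝ) ^ 2) ^ (-s / 2) * (1 + (j : ℝ) ^ 2) ^ (s / 2) = 1 := by
  rw [← Real.rpow_add (one_add_sq_pos j), ← add_div, neg_add_cancel, zero_div, Real.rpow_zero]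

lemma rpow_half_sq (s : ℝ) (j : ℕ) :
    ((1 + (j : ℝ) ^ 2) ^ (s / 2)) ^ 2 = (1 + (j : ℝ) ^ 2) ^ s := by
  rw [← Real.rpow_natCast, ← Real.rpow_mul (one_add_sq_pos j).le]
  norm_num

lemma summable_sq_of_seqL2 (y : SeqL2) : Summable fun j => y j ^ 2 := by
  have h := (lp.memℓp y).summable (by norm_num)
  simpa using h

lemma memℓp_two_of_summable_sq {f : ℕ → ℝ} (h : Summable fun j => f j ^ 2) :
    Memℓp f (2 : ENNReal) := by
  refine memℓp_gen (h.congr fun j => ?_)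
  simp

lemma mem_posSubmodule_of_rapid {a b : ℝ} (ha : -1 < a) (hb : -1 < b) {g : ℝ → ℝ}
    (hg : Rapid a b g) (s : ℝ) : hg.memLp.toLp g ∈ posSubmodule s a b := by
  obtain ⟨N, hN⟩ := exists_nat_ge s
  refine Summable.of_nonneg_of_le (fun j => by positivity) (fun j => ?_) (hg.summable N)
  rw [coeff_toLp ha hb]
  refine mul_le_mul_of_nonneg_right ?_ (sq_nonneg _)
  have h1 : (1 : ℝ) ≤ 1 + (j : ℝ) ^ 2 := by nlinarith [sq_nonneg (j : ℝ)]
  have h2 := Real.rpow_le_rpow_of_exponent_le h1 hN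
  rwa [Real.rpow_natCast] at h2

/-- Injectivity and surjectivity hold because the Jacobi polynomials form a Hilbert basis: for
`s ≥ 0` the coefficients `(1 + j²)^{-s/2} y_j` are again square summable. -/
lemma bijective_toSeq {s a b : ℝ} (ha : -1 < a) (hb : -1 < b) (hab : 0 < a + b + 1) (hs : 0 ≤ s) :
    Function.Bijective (PosSpace.toSeq s a b) := by
  constructor
  · rw [← LinearMap.ker_eq_bot, LinearMap.ker_eq_bot']
    intro v hv
    have h0 : ∀ j, coeff a b j v.toL2 = 0 := fun j => by
      have h1 : (1 + (j : ℝ) ^ 2) ^ (s / 2) * coeff a b j v.toL2 = 0 :=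
        congrFun (congrArg (fun y : SeqL2 => (y : ℕ → ℝ)) hv) j
      exact (mul_eq_zero.1 h1).resolve_left (Real.rpow_pos_of_pos (one_add_sq_pos j) _).ne'
    have h2 : (v.toL2 : WL2 a b) = 0 := by
      refine (jacobiBasis ha hb hab).repr.injective ?_
      ext j
      rw [jacobiBasis_repr, h0, map_zero]
      rfl
    exact Subtype.ext h2
  · intro y
    have hle : ∀ j : ℕ, ((1 + (j : ℝ) ^ 2) ^ (-s / 2) * y j) ^ 2 ≤ y j ^ 2 := fun j => by
      rw [mul_pow, rpow_half_sq]
      refine mul_le_of_le_one_left (sq_nonneg _) ?_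
      exact Real.rpow_le_one_of_one_le_of_nonpos (by nlinarith [sq_nonneg (j : ℝ)]) (by linarith)
    set c : SeqL2 := ⟨fun j : ℕ => (1 + (j : ℝ) ^ 2) ^ (-s / 2) * y j,
      memℓp_two_of_summable_sq (Summable.of_nonneg_of_le (fun _ => sq_nonneg _) hle
        (summable_sq_of_seqL2 y))⟩ with hc
    set v : WL2 a b := (jacobiBasis ha hb hab).repr.symm c with hv
    have hco : ∀ j, coeff a b j v = (1 + (j : ℝ) ^ 2) ^ (-s / 2) * y j := fun j => by
      rw [← jacobiBasis_repr ha hb hab, hv, LinearIsometryEquiv.apply_symm_apply]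
    have hmem : v ∈ posSubmodule s a b := by
      refine (summable_sq_of_seqL2 y).congr fun j => ?_
      rw [hco, ← rpow_half_sq s, ← mul_pow, ← mul_assoc, mul_comm (_ ^ (s / 2)),
        rpow_neg_mul_rpow, one_mul]
    refine ⟨(⟨v, hmem⟩ : posSubmodule s a b), ?_⟩
    ext j
    change (1 + (j : ℝ) ^ 2) ^ (s / 2) * coeff a b j v = y j
    rw [hco, ← mul_assoc, mul_comm (_ ^ (s / 2)), rpow_neg_mul_rpow, one_mul]

/-- For `s ≥ 0` the weighted coefficients identify `H^s_{(a,b)}(I)` with `ℓ²`. -/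
def posIso {a b : ℝ} (ha : -1 < a) (hb : -1 < b) (hab : 0 < a + b + 1) {s : ℝ} (hs : 0 ≤ s) :
    PosSpace s a b ≃ₗᵢ[ℝ] SeqL2 where
  toLinearEquiv := LinearEquiv.ofBijective (PosSpace.toSeq s a b) (bijective_toSeq ha hb hab hs)
  norm_map' _ := rfl

lemma posIso_apply {a b : ℝ} (ha : -1 < a) (hb : -1 < b) (hab : 0 < a + b + 1) {s : ℝ}
    (hs : 0 ≤ s) (v : PosSpace s a b) (j : ℕ) :
    posIso ha hb hab hs v j = (1 + (j : ℝ) ^ 2) ^ (s / 2) * coeff a b j v.toL2 := rfl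

/-- For `s ≥ 0` the dual of `H^s_{(a,b)}(I)` is identified with `ℓ²` by the Riesz representation
theorem. -/
def dualIso {a b : ℝ} (ha : -1 < a) (hb : -1 < b) (hab : 0 < a + b + 1) {s : ℝ} (hs : 0 ≤ s) :
    StrongDual ℝ (PosSpace s a b) ≃ₗᵢ[ℝ] SeqL2 where
  toFun F := (InnerProductSpace.toDual ℝ SeqL2).symm
    (F.comp ((posIso ha hb hab hs).symm.toContinuousLinearEquiv : SeqL2 →L[ℝ] PosSpace s a b))
  map_add' F G := by rw [ContinuousLinearMap.add_comp, map_add]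
  map_smul' c F := by rw [ContinuousLinearMap.smul_comp, map_smul]; simp
  invFun y := (InnerProductSpace.toDual ℝ SeqL2 y).comp
    ((posIso ha hb hab hs).toContinuousLinearEquiv : PosSpace s a b →L[ℝ] SeqL2)
  left_inv F := by
    ext v
    simp
  right_inv y := by
    rw [LinearIsometryEquiv.symm_apply_eq]
    ext v
    simp
  norm_map' F := by
    change ‖(InnerProductSpace.toDual ℝ SeqL2).symm _‖ = _
    rw [LinearIsometryEquiv.norm_map]
    refine le_antisymm ?_ ?_
    · refine ContinuousLinearMap.opNorm_le_bound _ (norm_nonneg _) fun y => ?_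
      have := F.le_opNorm ((posIso ha hb hab hs).symm y)
      rwa [LinearIsometryEquiv.norm_map] at this
    · refine ContinuousLinearMap.opNorm_le_bound _ (norm_nonneg _) fun v => ?_
      have := (F.comp ((posIso ha hb hab hs).symm.toContinuousLinearEquiv :
        SeqL2 →L[ℝ] PosSpace s a b)).le_opNorm (posIso ha hb hab hs v)
      rw [LinearIsometryEquiv.norm_map] at this
      simpa using this

lemma dualIso_inner {a b : ℝ} (ha : -1 < a) (hb : -1 < b) (hab : 0 < a + b + 1) {s : ℝ}
    (hs : 0 ≤ s) (F : StrongDual ℝ (PosSpace s a b)) (v : PosSpace s a b) :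
    F v = ∑' j, dualIso ha hb hab hs F j * ((1 + (j : ℝ) ^ 2) ^ (s / 2) * coeff a b j v.toL2) := by
  have h1 : F v = inner ℝ (dualIso ha hb hab hs F) (posIso ha hb hab hs v) := by
    change F v = inner ℝ ((InnerProductSpace.toDual ℝ SeqL2).symm _) _
    rw [InnerProductSpace.toDual_symm_apply]
    simp
  rw [h1, lp.inner_eq_tsum]
  refine tsum_congr fun j => ?_
  rw [posIso_apply]
  exact mul_comm _ _

/-- The isometry of `H^s_{(a,b)}(I)`, `s ∈ ℝ`, with `ℓ²`. The Boolean index is a variable with an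
equation, so that its two values can be treated by cases. -/
def sobIso {a b : ℝ} (ha : -1 < a) (hb : -1 < b) (hab : 0 < a + b + 1) :
    ∀ (t : Bool) (s : ℝ), t = decide (0 ≤ s) → (SobAux t s a b ≃ₗᵢ[ℝ] SeqL2)
  | true, _, h => posIso ha hb hab (by simpa using h.symm)
  | false, _, h => dualIso ha hb hab (by have h' := h.symm; simp at h'; linarith)

/-- The duality pairing in terms of coefficients. For a rapidly decreasing `g` both pairings are
defined, whatever the order `s` is. -/
lemma pairs_iff {a b : ℝ} (ha : -1 < a) (hb : -1 < b) (hab : 0 < a + b + 1) {t : Bool} {s : ℝ}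
    (ht : t = decide (0 ≤ s)) (F : SobAux t s a b) {g : ℝ → ℝ} (hg : Rapid a b g) (c : ℝ) :
    Pairs F g c ↔ ∑' j : ℕ,
      (1 + (j : ℝ) ^ 2) ^ (-s / 2) * sobIso ha hb hab t s ht F j * jcoeff a b j g = c := by
  cases t with
  | true =>
    have h1 : ∫ x, (PosSpace.toL2 F : WL2 a b) x * g x ∂(wMeasure a b) =
        inner ℝ (PosSpace.toL2 F : WL2 a b) (hg.memLp.toLp g) := by
      rw [L2.inner_def]
      refine integral_congr_ae ?_
      filter_upwards [hg.memLp.coeFn_toLp] with x hx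
      rw [hx]
      simp [mul_comm]
    have h2 := (jacobiBasis ha hb hab).tsum_inner_mul_inner (PosSpace.toL2 F : WL2 a b)
      (hg.memLp.toLp g)
    have h3 : ∑' j : ℕ, (1 + (j : ℝ) ^ 2) ^ (-s / 2) * sobIso ha hb hab true s ht F j *
        jcoeff a b j g = inner ℝ (PosSpace.toL2 F : WL2 a b) (hg.memLp.toLp g) := by
      rw [← h2]
      refine tsum_congr fun j => ?_
      have e1 : sobIso ha hb hab true s ht F j =
        (1 + (j : ℝ) ^ 2) ^ (s / 2) * coeff a b j (PosSpace.toL2 F) := rfl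
      have e2 : inner ℝ (jacobiLp a b j) (hg.memLp.toLp g) = jcoeff a b j g :=
        coeff_toLp ha hb j hg.memLp
      have e3 : inner ℝ (PosSpace.toL2 F : WL2 a b) (jacobiLp a b j) =
        coeff a b j (PosSpace.toL2 F) := real_inner_comm _ _
      rw [e1, jacobiBasis_apply, e2, e3, ← mul_assoc, rpow_neg_mul_rpow, one_mul]
    rw [h3, ← h1]
    exact and_iff_right hg.memLp
  | false =>
    set w : PosSpace (-s) a b :=
      (⟨hg.memLp.toLp g, mem_posSubmodule_of_rapid ha hb hg _⟩ : posSubmodule (-s) a b) with hw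
    have hwL : w.toL2 = hg.memLp.toLp g := rfl
    have h1 : SobAux.toDual F w = ∑' j : ℕ, (1 + (j : ℝ) ^ 2) ^ (-s / 2) *
        sobIso ha hb hab false s ht F j * jcoeff a b j g := by
      refine (dualIso_inner ha hb hab (by simp at ht; linarith) F w).trans (tsum_congr fun j => ?_)
      rw [hwL, coeff_toLp ha hb, mul_left_comm, ← mul_assoc]
      rfl
    rw [← h1]
    constructor
    · rintro ⟨w', hw', rfl⟩
      have : w' = w := by
        refine Subtype.ext (?_ : w'.toL2 = w.toL2)
        rw [hwL]
        exact Lp.ext (hw'.trans hg.memLp.coeFn_toLp.symm)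
      rw [this]
    · rintro rfl
      exact ⟨w, hg.memLp.coeFn_toLp, rfl⟩

/-! ### The diagonal operator -/

/-- Multiplication by a bounded sequence on `ℓ²`. -/
def diagOp (d : ℕ → ℝ) (C : ℝ) (hd : ∀ j, |d j| ≤ C) : SeqL2 →L[ℝ] SeqL2 :=
  LinearMap.mkContinuous
    { toFun := fun y => ⟨fun j => d j * y j, memℓp_two_of_summable_sq <| by
        refine Summable.of_nonneg_of_le (fun _ => sq_nonneg _) (fun j => ?_)
          ((summable_sq_of_seqL2 y).mul_left (C ^ 2))
        rw [mul_pow]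
        exact mul_le_mul_of_nonneg_right (sq_le_sq' (abs_le.1 (hd j)).1 (abs_le.1 (hd j)).2)
          (sq_nonneg _)⟩
      map_add' := fun y z => by ext j; exact mul_add _ _ _
      map_smul' := fun c y => by ext j; exact mul_left_comm _ _ _ } C fun y => by
    have hC : 0 ≤ C := (abs_nonneg _).trans (hd 0)
    refine lp.norm_le_of_forall_sum_le (by norm_num) (mul_nonneg hC (norm_nonneg _)) fun s => ?_
    have h1 := lp.sum_rpow_le_norm_rpow (p := 2) (by norm_num) y s
    simp only [ENNReal.toReal_ofNat, Real.rpow_ofNat, Real.norm_eq_abs, sq_abs] at h1 ⊢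
    calc ∑ j ∈ s, (d j * y j) ^ 2 ≤ ∑ j ∈ s, C ^ 2 * y j ^ 2 := by
          refine Finset.sum_le_sum fun j _ => ?_
          rw [mul_pow]
          exact mul_le_mul_of_nonneg_right (sq_le_sq' (abs_le.1 (hd j)).1 (abs_le.1 (hd j)).2)
            (sq_nonneg _)
      _ = C ^ 2 * ∑ j ∈ s, y j ^ 2 := by rw [Finset.mul_sum]
      _ ≤ C ^ 2 * ‖y‖ ^ 2 := mul_le_mul_of_nonneg_left h1 (sq_nonneg _)
      _ = (C * ‖y‖) ^ 2 := by ring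

lemma diagOp_apply (d : ℕ → ℝ) (C : ℝ) (hd : ∀ j, |d j| ≤ C) (y : SeqL2) (j : ℕ) :
    diagOp d C hd y j = d j * y j := rfl

/-- The factor `λ_n (1 + n²)^{-α/2}` by which the operator acts between the sequence models of
`H^{s+α}_{(a,b)}(I)` and `H^s_{(b,a)}(I)`. -/
def symbol (a b r : ℝ) (j : ℕ) : ℝ := eigen a b r j * (1 + (j : ℝ) ^ 2) ^ (-(a + b) / 2)

lemma Params.symbol_pos {a b r : ℝ} (P : Params a b r) (j : ℕ) : 0 < symbol a b r j :=
  mul_pos (P.eigen_pos j) (Real.rpow_pos_of_pos (one_add_sq_pos j) _)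

lemma Params.exists_symbol_bounds {a b r : ℝ} (P : Params a b r) :
    ∃ C : ℝ, (∀ j, |symbol a b r j| ≤ C) ∧ ∀ j, |(symbol a b r j)⁻¹| ≤ C := by
  obtain ⟨c, C, hc, hC, h⟩ := P.exists_eigen_bounds
  have e : ∀ (x : ℝ) (j : ℕ), x * (1 + (j : ℝ) ^ 2) ^ ((a + b) / 2) *
      (1 + (j : ℝ) ^ 2) ^ (-(a + b) / 2) = x := fun x j => by
    rw [mul_assoc, mul_comm (_ ^ _), rpow_neg_mul_rpow, mul_one]
  refine ⟨max C c⁻¹, fun j => ?_, fun j => ?_⟩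
  · rw [abs_of_pos (P.symbol_pos j)]
    refine le_max_of_le_left ?_
    have := mul_le_mul_of_nonneg_right (h j).2
      (Real.rpow_nonneg (one_add_sq_pos j).le (-(a + b) / 2))
    rwa [e] at this
  · rw [abs_of_pos (inv_pos.2 (P.symbol_pos j))]
    refine le_max_of_le_right ?_
    have := mul_le_mul_of_nonneg_right (h j).1
      (Real.rpow_nonneg (one_add_sq_pos j).le (-(a + b) / 2))
    rw [e] at this
    exact inv_anti₀ hc this

lemma Params.exists_diagEquiv {a b r : ℝ} (P : Params a b r) :
    ∃ D : SeqL2 ≃L[ℝ] SeqL2, ∀ y j, D y j = symbol a b r j * y j := by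
  obtain ⟨C, h1, h2⟩ := P.exists_symbol_bounds
  refine ⟨ContinuousLinearEquiv.equivOfInverse (diagOp _ C h1) (diagOp _ C h2) ?_ ?_,
    fun y j => rfl⟩
  · intro y
    ext j
    rw [diagOp_apply, diagOp_apply, inv_mul_cancel_left₀ (P.symbol_pos j).ne']
  · intro y
    ext j
    rw [diagOp_apply, diagOp_apply, mul_inv_cancel_left₀ (P.symbol_pos j).ne']

lemma Params.neg_one_lt {a b r : ℝ} (P : Params a b r) : -1 < a ∧ -1 < b ∧ 0 < a + b + 1 :=
  ⟨by linarith [P.a_pos], by linarith [P.b_pos], by linarith [P.one_lt]⟩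

/-- The equation by transposition says that `f_n = λ_n φ_n` for all Jacobi coefficients, here in
terms of the sequence models. Polynomials alone are sufficient for one direction; for the other, all
test functions have rapidly decreasing coefficients. -/
theorem Params.fracEq_iff {a b r : ℝ} (P : Params a b r) {s : ℝ} {t t' : Bool}
    (ht : t = decide (0 ≤ s + (a + b))) (ht' : t' = decide (0 ≤ s))
    (φ : SobAux t (s + (a + b)) a b) (f : SobAux t' s b a) :
    FracEq (a + b) r φ f ↔ ∀ j,
      sobIso P.symm.neg_one_lt.1 P.symm.neg_one_lt.2.1 P.symm.neg_one_lt.2.2 t' s ht' f j =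
        symbol a b r j *
          sobIso P.neg_one_lt.1 P.neg_one_lt.2.1 P.neg_one_lt.2.2 t (s + (a + b)) ht φ j := by
  set y := sobIso P.neg_one_lt.1 P.neg_one_lt.2.1 P.neg_one_lt.2.2 t (s + (a + b)) ht φ with hy
  set z := sobIso P.symm.neg_one_lt.1 P.symm.neg_one_lt.2.1 P.symm.neg_one_lt.2.2 t' s ht' f
    with hz
  have hexp : ∀ j : ℕ, (1 + (j : ℝ) ^ 2) ^ (-(s + (a + b)) / 2) =
      (1 + (j : ℝ) ^ 2) ^ (-s / 2) * (1 + (j : ℝ) ^ 2) ^ (-(a + b) / 2) := fun j => by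
    rw [← Real.rpow_add (one_add_sq_pos j)]; ring_nf
  have hterm : ∀ (g : ℝ → ℝ), Admissible g → ∀ j : ℕ,
      (1 + (j : ℝ) ^ 2) ^ (-(s + (a + b)) / 2) * y j *
        jcoeff a b j (fracOp (a + b) (1 - r) fun x => rho b a x * g x) =
      (1 + (j : ℝ) ^ 2) ^ (-s / 2) * (symbol a b r j * y j) * jcoeff b a j g := fun g hg j => by
    rw [P.jcoeff_fracOp hg, hexp, symbol]; ring
  have hmain : FracEq (a + b) r φ f ↔ ∀ g, Admissible g →
      ∑' j : ℕ, (1 + (j : ℝ) ^ 2) ^ (-s / 2) * z j * jcoeff b a j g =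
      ∑' j : ℕ, (1 + (j : ℝ) ^ 2) ^ (-s / 2) * (symbol a b r j * y j) * jcoeff b a j g := by
    refine forall_congr' fun g => forall_congr' fun hg => ?_
    have h1 := fun c => pairs_iff P.symm.neg_one_lt.1 P.symm.neg_one_lt.2.1 P.symm.neg_one_lt.2.2
      ht' f (P.rapid_admissible hg) c
    have h2 := fun c => pairs_iff P.neg_one_lt.1 P.neg_one_lt.2.1 P.neg_one_lt.2.2
      ht φ (P.rapid_fracOp hg) c
    simp only [h1, h2, ← hy, ← hz, hterm g hg]
    constructor
    · rintro ⟨c, e1, e2⟩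
      rw [e1, e2]
    · intro h
      exact ⟨_, rfl, h.symm⟩
  rw [hmain]
  constructor
  · intro h n
    have h1 := h (fun x => (jacobiPoly b a n).eval x) (Or.inr ⟨_, rfl⟩)
    -- testing with the `n`-th Jacobi polynomial isolates the `n`-th coefficient
    have hj : ∀ j, jcoeff b a j (fun x => (jacobiPoly b a n).eval x) =
        if j = n then jacobiNorm b a n else 0 := fun j => by
      have h2 := jcoeff_jacobiN P.symm.neg_one_lt.1 P.symm.neg_one_lt.2.1 P.symm.neg_one_lt.2.2 j n
      have hN := (jacobiNorm_pos P.symm.neg_one_lt.1 P.symm.neg_one_lt.2.1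
        P.symm.neg_one_lt.2.2 n).ne'
      have h3 : jcoeff b a j (jacobiN b a n) =
          jcoeff b a j (fun x => (jacobiPoly b a n).eval x) / jacobiNorm b a n := by
        rw [jcoeff, jcoeff, div_right_comm, ← integral_div (jacobiNorm b a n)]
        refine congrArg (· / jacobiNorm b a j)
          (integral_congr_ae (Eventually.of_forall fun x => ?_))
        simp only [jacobiN, jacobiPoly_eval]
        ring
      rw [h3, div_eq_iff hN] at h2
      rw [h2]
      split_ifs <;> simp
    rw [tsum_eq_single n (fun j hjn => by rw [hj, if_neg hjn, mul_zero]),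
      tsum_eq_single n (fun j hjn => by rw [hj, if_neg hjn, mul_zero]), hj, if_pos rfl] at h1
    have hN := (jacobiNorm_pos P.symm.neg_one_lt.1 P.symm.neg_one_lt.2.1
      P.symm.neg_one_lt.2.2 n).ne'
    have hp := (Real.rpow_pos_of_pos (one_add_sq_pos n) (-s / 2)).ne'
    exact mul_left_cancel₀ hp (mul_right_cancel₀ hN h1)
  · intro h g _
    simp only [h]

/-- Since the symbol is bounded and bounded away from zero, the equation defines an isomorphism. -/
theorem Params.exists_solution_equiv {a b r : ℝ} (P : Params a b r) (s : ℝ) {t t' : Bool}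
    (ht : t = decide (0 ≤ s + (a + b))) (ht' : t' = decide (0 ≤ s)) :
    ∃ T : SobAux t (s + (a + b)) a b ≃L[ℝ] SobAux t' s b a,
      ∀ φ f, T φ = f ↔ FracEq (a + b) r φ f := by
  obtain ⟨D, hD⟩ := P.exists_diagEquiv
  set U := sobIso P.neg_one_lt.1 P.neg_one_lt.2.1 P.neg_one_lt.2.2 t (s + (a + b)) ht with hU
  set V := sobIso P.symm.neg_one_lt.1 P.symm.neg_one_lt.2.1 P.symm.neg_one_lt.2.2 t' s ht' with hV
  refine ⟨(U.toContinuousLinearEquiv.trans D).trans V.symm.toContinuousLinearEquiv,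
    fun φ f => ?_⟩
  rw [P.fracEq_iff ht ht' φ f]
  have h1 : ((U.toContinuousLinearEquiv.trans D).trans V.symm.toContinuousLinearEquiv) φ = f ↔
      D (U φ) = V f := V.symm_apply_eq
  rw [h1, ← hU, ← hV]
  constructor
  · intro h j
    rw [← h, hD]
  · intro h
    ext j
    rw [hD, h]

/-! ### Absolutely continuous functions vanishing at the endpoints -/

lemma integral_deriv_mul_eval {u : ℝ → ℝ} (hu : AbsolutelyContinuousOnInterval u 0 1)
    (hu0 : u 0 = 0) (hu1 : u 1 = 0) (p : Polynomial ℝ) :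
    ∫ x in Ioo (0 : ℝ) 1, deriv u x * p.eval x =
      -∫ x in Ioo (0 : ℝ) 1, u x * p.derivative.eval x := by
  have hp : ContDiff ℝ 1 fun x => p.eval x := (contDiff_eval p).of_le (by simp)
  have h := hu.integral_mul_deriv_eq_deriv_mul hp.contDiffOn.absolutelyContinuousOnInterval
  simp only [hu0, hu1, zero_mul, sub_zero, zero_sub, Polynomial.deriv,
    intervalIntegral.integral_of_le zero_le_one, integral_Ioc_eq_integral_Ioo] at h
  linarith

lemma ae_deriv_primitive {v : ℝ → ℝ} (hv : IntegrableOn v (Ioo 0 1)) :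
    ∀ᵐ x ∂(volume.restrict (Ioo (0 : ℝ) 1)), deriv (fun x => ∫ t in (0 : ℝ)..x, v t) x = v x := by
  rw [ae_restrict_iff' measurableSet_Ioo]
  filter_upwards [((intervalIntegrable_iff_integrableOn_Ioo_of_le
    zero_le_one).2 hv).ae_hasDerivAt_integral] with x hx hx'
  rw [uIcc_of_le zero_le_one] at hx
  exact (hx ⟨hx'.1.le, hx'.2.le⟩ 0 ⟨le_rfl, zero_le_one⟩).deriv

lemma integrableOn_of_absolutelyContinuous {u : ℝ → ℝ}
    (hu : AbsolutelyContinuousOnInterval u 0 1) : IntegrableOn u (Ioo 0 1) := by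
  have h := hu.continuousOn
  rw [uIcc_of_le zero_le_one] at h
  exact h.integrableOn_Icc.mono_set Ioo_subset_Icc_self

lemma integrableOn_deriv_of_absolutelyContinuous {u : ℝ → ℝ}
    (hu : AbsolutelyContinuousOnInterval u 0 1) : IntegrableOn (deriv u) (Ioo 0 1) :=
  (intervalIntegrable_iff_integrableOn_Ioo_of_le zero_le_one).1 hu.intervalIntegrable_deriv

lemma integrableOn_mul_eval {u : ℝ → ℝ} (hu : IntegrableOn u (Ioo 0 1)) (p : Polynomial ℝ) :
    IntegrableOn (fun x => u x * p.eval x) (Ioo 0 1) := by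
  obtain ⟨C, hC⟩ := (isCompact_Icc (a := (0 : ℝ)) (b := 1)).exists_bound_of_continuousOn
    p.continuous.continuousOn
  refine Integrable.mul_bdd (c := C) hu p.continuous.aestronglyMeasurable ?_
  filter_upwards [ae_restrict_mem measurableSet_Ioo] with x hx
  exact hC x ⟨hx.1.le, hx.2.le⟩

/-- The polynomial `q` in `(ρ^{(a,b)} G̃_n)' = ρ^{(a-1,b-1)} q`, normalised in
`L²_{ρ^{(a-1,b-1)}}(I)`. -/
def fluxPoly (a b : ℝ) (n : ℕ) : Polynomial ℝ :=
  Polynomial.C (1 / (jacobiNorm a b n * Real.sqrt ((n + 1) * (a + b + n)))) *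
    polyDiff a b (jacobiPoly a b n)

/-- The orthogonality relation comes from the Sturm–Liouville equation for `G_n` by integration by
parts. -/
lemma polyInner_polyDiff {a b : ℝ} (ha : 0 < a) (hb : 0 < b) (n m : ℕ) :
    polyInner (a - 1) (b - 1) (polyDiff a b (jacobiPoly a b n)) (polyDiff a b (jacobiPoly a b m)) =
      (n + 1) * (a + b + n) * polyInner a b (jacobiPoly a b m) (jacobiPoly a b n) := by
  have h := integral_deriv_wDiff_mul ha hb (contDiff_eval (jacobiPoly a b n))
    (contDiff_eval (jacobiPoly a b m))
  rw [deriv_wDiff_eval, derivative_polyDiff_jacobiPoly ha hb, wDiff_eval, wDiff_eval] at h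
  rw [polyInner, polyInner, ← integral_const_mul]
  simp only [Polynomial.eval_mul, Polynomial.eval_C] at h
  rw [← neg_eq_iff_eq_neg, ← integral_neg] at h
  refine (integral_congr_ae (Eventually.of_forall fun x => ?_)).trans
    (h.symm.trans (integral_congr_ae (Eventually.of_forall fun x => ?_)))
  · ring
  · ring

lemma memLp_eval {a b : ℝ} (ha : -1 < a) (hb : -1 < b) (p : Polynomial ℝ) :
    MemLp (fun x => p.eval x) 2 (wMeasure a b) :=
  memLp_of_eqOn_continuous ha hb p.continuous fun _ _ => rfl

lemma inner_toLp_eval {a b : ℝ} (ha : -1 < a) (hb : -1 < b) (p : Polynomial ℝ) (v : WL2 a b) :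
    inner ℝ ((memLp_eval ha hb p).toLp _) v =
      ∫ x in Ioo (0 : ℝ) 1, rho a b x * v x * p.eval x := by
  simp only [mul_assoc]
  rw [L2.inner_def, ← integral_wMeasure a b fun x => v x * p.eval x]
  refine integral_congr_ae ?_
  filter_upwards [(memLp_eval ha hb p).coeFn_toLp] with x hx
  rw [hx]
  simp

lemma inner_toLp_eval_eval {a b : ℝ} (ha : -1 < a) (hb : -1 < b) (p q : Polynomial ℝ) :
    inner ℝ ((memLp_eval ha hb p).toLp _) ((memLp_eval ha hb q).toLp _) = polyInner a b p q := by
  rw [L2.inner_def, polyInner, ← integral_wMeasure]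
  refine integral_congr_ae ?_
  filter_upwards [(memLp_eval ha hb p).coeFn_toLp, (memLp_eval ha hb q).coeFn_toLp] with x hx hx'
  rw [hx, hx']
  simp [mul_comm]

lemma orthonormal_fluxPoly {a b : ℝ} (ha : 0 < a) (hb : 0 < b) :
    Orthonormal ℝ fun n => (memLp_eval (a := a - 1) (b := b - 1) (by linarith) (by linarith)
      (fluxPoly a b n)).toLp _ := by
  rw [orthonormal_iff_ite]
  intro n m
  rw [inner_toLp_eval_eval (by linarith) (by linarith), fluxPoly, fluxPoly,
    polyInner_C_mul_right, polyInner_comm,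
    polyInner_C_mul_right, polyInner_polyDiff ha hb, polyInner_jacobiPoly (by linarith)
    (by linarith)]
  split_ifs with h
  · subst h
    have hN := (jacobiNorm_pos (a := a) (b := b) (by linarith) (by linarith) (by linarith) n).ne'
    have hn : (0 : ℝ) ≤ n := n.cast_nonneg
    have hμ : (0 : ℝ) < (n + 1) * (a + b + n) := by positivity
    have hs := Real.sq_sqrt hμ.le
    have hs0 := (Real.sqrt_pos.2 hμ).ne'
    field_simp
    rw [hs]
  · simp

/-- A function `φ` with `∑ (1 + n²) φ_n² < ∞` is, up to the weight, the primitive of an integrable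
function: the derivatives of `ρ^{(a,b)} G̃_n` are `ρ^{(a-1,b-1)}` times functions that are
orthogonal in `L²_{ρ^{(a-1,b-1)}}(I)`, with norms of order `n`. -/
theorem exists_primitive_eq_rho_mul {a b : ℝ} (ha : 0 < a) (hb : 0 < b)
    (hab : a + b ≤ 2) {φ : WL2 a b} (hφ : φ ∈ posSubmodule 1 a b) :
    ∃ u : ℝ → ℝ, AbsolutelyContinuousOnInterval u 0 1 ∧ u 0 = 0 ∧ u 1 = 0 ∧
      ∀ᵐ x ∂(volume.restrict (Ioo (0 : ℝ) 1)), u x = rho a b x * φ x := by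
  have ha' : -1 < a - 1 := by linarith
  have hb' : -1 < b - 1 := by linarith
  have hμ : ∀ n : ℕ, (0 : ℝ) < (n + 1) * (a + b + n) := fun n => by positivity
  have hN := jacobiNorm_pos (a := a) (b := b) (by linarith) (by linarith) (by linarith)
  -- the coefficients of `(ρ^{(a,b)} φ)' / ρ^{(a-1,b-1)}` in the orthonormal system `fluxPoly`
  set c : SeqL2 := ⟨fun n => Real.sqrt ((n + 1) * (a + b + n)) * coeff a b n φ,
    memℓp_two_of_summable_sq (Summable.of_nonneg_of_le (fun _ => sq_nonneg _) (fun n => by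
      rw [mul_pow, Real.sq_sqrt (hμ n).le, ← mul_assoc]
      refine mul_le_mul_of_nonneg_right ?_ (sq_nonneg _)
      rw [Real.rpow_one]
      have hn : (0 : ℝ) ≤ n := n.cast_nonneg
      nlinarith [sq_nonneg ((n : ℝ) - 1), mul_le_mul_of_nonneg_left hab hn])
      ((show Summable fun j : ℕ => (1 + (j : ℝ) ^ 2) ^ (1 : ℝ) * coeff a b j φ ^ 2
        from hφ).mul_left 4))⟩ with hc
  have horth := orthonormal_fluxPoly ha hb
  set q := horth.orthogonalFamily.linearIsometry c with hq
  have hsum := horth.orthogonalFamily.hasSum_linearIsometry c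
  rw [← hq] at hsum
  have hinner : ∀ p : Polynomial ℝ, HasSum (fun n => c n * polyInner (a - 1) (b - 1) p
      (fluxPoly a b n))
      (∫ x in Ioo (0 : ℝ) 1, rho (a - 1) (b - 1) x * q x * p.eval x) := fun p => by
    have h1 := hsum.mapL (innerSL ℝ ((memLp_eval ha' hb' p).toLp _))
    rw [innerSL_apply_apply, inner_toLp_eval ha' hb'] at h1
    refine h1.congr_fun fun n => ?_
    rw [innerSL_apply_apply, LinearIsometry.toSpanSingleton_apply, inner_smul_right,
      inner_toLp_eval_eval ha' hb']
  set v : ℝ → ℝ := fun x => rho (a - 1) (b - 1) x * q x with hv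
  have hvi : IntegrableOn v (Ioo 0 1) := integrable_of_memLp ha' hb' (Lp.memLp q)
  set u : ℝ → ℝ := fun x => ∫ t in (0 : ℝ)..x, v t with hu
  have hAC : AbsolutelyContinuousOnInterval u 0 1 := absolutelyContinuousOnInterval_primitive hvi
  -- `ρ^{(a,b)} G_n` vanishes at both endpoints, so that its derivative has mean value zero
  have hone : ∀ n, polyInner (a - 1) (b - 1) 1 (fluxPoly a b n) = 0 := fun n => by
    have h1 := integral_wPoly_polyDiff ha hb (jacobiPoly a b n) (x := 1) ⟨zero_le_one, le_rfl⟩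
    rw [rho_one ha.ne', zero_mul, intervalIntegral.integral_of_le zero_le_one,
      integral_Ioc_eq_integral_Ioo] at h1
    rw [fluxPoly, polyInner_C_mul_right, polyInner]
    simp only [Polynomial.eval_one, one_mul]
    simp only [wPoly] at h1
    rw [h1, mul_zero]
  have hu1 : u 1 = 0 := by
    have h1 := hinner 1
    simp only [hone, mul_zero, Polynomial.eval_one, mul_one] at h1
    rw [hu]
    beta_reduce
    rw [intervalIntegral.integral_of_le zero_le_one, integral_Ioc_eq_integral_Ioo]
    exact (hasSum_zero.unique h1).symm
  refine ⟨u, hAC, by simp [hu], hu1, ?_⟩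
  have hφi : IntegrableOn (fun x => rho a b x * φ x) (Ioo 0 1) :=
    integrable_of_memLp (by linarith) (by linarith) (Lp.memLp φ)
  have hui := integrableOn_of_absolutelyContinuous hAC
  have key := ae_eq_zero_of_integral_mul_jacobiPoly (a := a) (b := b) (by linarith)
    (v := fun x => u x - rho a b x * φ x) (hui.sub hφi) fun n => ?_
  · filter_upwards [key] with x hx using sub_eq_zero.1 hx
  -- both moments are `jacobiNorm a b n` times the coefficient of `φ`
  have e1 : ∫ x in Ioo (0 : ℝ) 1, (rho a b x * φ x) * (jacobiPoly a b n).eval x =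
      jacobiNorm a b n * coeff a b n φ := by
    rw [coeff_eq_jcoeff (by linarith) (by linarith), jcoeff, mul_div_cancel₀ _ (hN n).ne']
    exact integral_congr_ae (Eventually.of_forall fun x => by ring)
  have e2 : ∫ x in Ioo (0 : ℝ) 1, v x * (polyDiff a b (jacobiPoly a b n)).eval x =
      (n + 1) * (a + b + n) * (jacobiNorm a b n * coeff a b n φ) := by
    refine (hinner _).unique ?_
    have h1 : ∀ m, c m * polyInner (a - 1) (b - 1) (polyDiff a b (jacobiPoly a b n))
        (fluxPoly a b m) = if m = n then
          (n + 1) * (a + b + n) * (jacobiNorm a b n * coeff a b n φ) else 0 := fun m => by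
      rw [fluxPoly, polyInner_C_mul_right, polyInner_polyDiff ha hb, polyInner_jacobiPoly
        (by linarith) (by linarith)]
      split_ifs with h
      · subst h
        have hN' := (hN m).ne'
        have hs0 := (Real.sqrt_pos.2 (hμ m)).ne'
        have hcm : c m = Real.sqrt ((m + 1) * (a + b + m)) * coeff a b m φ := rfl
        rw [hcm]
        field_simp
      · simp
    simp only [h1]
    exact hasSum_ite_eq n _
  have e3 := integral_deriv_mul_eval hAC (by simp [hu]) hu1 (polyDiff a b (jacobiPoly a b n))
  have e4 : ∫ x in Ioo (0 : ℝ) 1, deriv u x * (polyDiff a b (jacobiPoly a b n)).eval x =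
      ∫ x in Ioo (0 : ℝ) 1, v x * (polyDiff a b (jacobiPoly a b n)).eval x := by
    refine integral_congr_ae ?_
    filter_upwards [ae_deriv_primitive hvi] with x hx
    rw [hu, hx]
  have e5 : ∫ x in Ioo (0 : ℝ) 1, u x * (polyDiff a b (jacobiPoly a b n)).derivative.eval x =
      -((n + 1) * (a + b + n)) * ∫ x in Ioo (0 : ℝ) 1, u x * (jacobiPoly a b n).eval x := by
    rw [derivative_polyDiff_jacobiPoly ha hb, ← integral_const_mul]
    refine integral_congr_ae (Eventually.of_forall fun x => ?_)
    simp only [Polynomial.eval_mul, Polynomial.eval_C]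
    ring
  have e6 : ∫ x in Ioo (0 : ℝ) 1, u x * (jacobiPoly a b n).eval x =
      jacobiNorm a b n * coeff a b n φ := by
    refine mul_left_cancel₀ (hμ n).ne' ?_
    rw [← e2, ← e4, e3, e5]
    ring
  simp only [sub_mul]
  rw [integral_sub (integrableOn_mul_eval hui _) (integrableOn_mul_eval hφi _), e1, e6, sub_self]

/-! ### Uniqueness of weak solutions -/

/-- The primitive vanishes to the left of the support of `η`, and by the mean value condition also
to the right of it. -/
lemma isTest_primitive {η : ℝ → ℝ} (hη : IsTest η) (h0 : ∫ x in Ioo (0 : ℝ) 1, η x = 0) :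
    IsTest fun x => ∫ t in (0 : ℝ)..x, η t := by
  have hd : ∀ x, HasDerivAt (fun x => ∫ t in (0 : ℝ)..x, η t) (η x) x := fun x =>
    intervalIntegral.integral_hasDerivAt_right (hη.continuous.intervalIntegrable _ _)
      (hη.continuous.stronglyMeasurableAtFilter _ _) hη.continuous.continuousAt
  have hcd : ContDiff ℝ ∞ fun x => ∫ t in (0 : ℝ)..x, η t := by
    rw [contDiff_infty_iff_deriv]
    refine ⟨fun x => (hd x).differentiableAt, ?_⟩
    rw [show deriv (fun x => ∫ t in (0 : ℝ)..x, η t) = η from funext fun x => (hd x).deriv]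
    exact hη.1
  rcases (tsupport η).eq_empty_or_nonempty with he | hne
  · have hz : η = 0 := tsupport_eq_empty_iff.1 he
    have hz' : (fun x => ∫ t in (0 : ℝ)..x, η t) = 0 := by ext x; simp [hz]
    rw [hz', ← hz]
    exact hη
  have hK : IsCompact (tsupport η) := hη.2.1
  obtain ⟨m, hm, hm'⟩ := hK.exists_isLeast hne
  obtain ⟨M, hM, hM'⟩ := hK.exists_isGreatest hne
  have hm0 := hη.2.2 hm
  have hM0 := hη.2.2 hM
  have hsub : tsupport (fun x => ∫ t in (0 : ℝ)..x, η t) ⊆ Icc m M := by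
    refine closure_minimal (fun x hx => ?_) isClosed_Icc
    by_contra hxI
    refine hx ?_
    beta_reduce
    rcases lt_or_ge x m with h | h
    · refine (intervalIntegral.integral_congr fun t ht => ?_).trans
        (intervalIntegral.integral_zero (a := 0) (b := x))
      refine image_eq_zero_of_notMem_tsupport fun hmem => ?_
      have h1 := hm' hmem
      have h2 := ht.2
      rcases le_max_iff.1 h2 with h3 | h3
      · linarith [hm0.1]
      · linarith
    · have hMx : M < x := by
        by_contra hh
        exact hxI ⟨h, not_lt.1 hh⟩
      have e1 : ∫ t in M..x, η t = 0 := by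
        refine (intervalIntegral.integral_zero_ae (Eventually.of_forall fun t ht => ?_))
        rw [uIoc_of_le hMx.le] at ht
        exact image_eq_zero_of_notMem_tsupport fun hmem => absurd (hM' hmem) (not_le.2 ht.1)
      have e2 : ∫ t in M..1, η t = 0 := by
        refine (intervalIntegral.integral_zero_ae (Eventually.of_forall fun t ht => ?_))
        rw [uIoc_of_le hM0.2.le] at ht
        exact image_eq_zero_of_notMem_tsupport fun hmem => absurd (hM' hmem) (not_le.2 ht.1)
      have hI : ∀ y z : ℝ, IntervalIntegrable η volume y z := fun y z =>
        hη.continuous.intervalIntegrable _ _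
      rw [← integral_Ioc_eq_integral_Ioo, ← intervalIntegral.integral_of_le zero_le_one,
        ← intervalIntegral.integral_add_adjacent_intervals (hI 0 M) (hI M 1), e2, add_zero] at h0
      rw [← intervalIntegral.integral_add_adjacent_intervals (hI 0 M) (hI M x), e1, h0, add_zero]
  exact ⟨hcd, HasCompactSupport.of_support_subset_isCompact isCompact_Icc
    (subset_closure.trans hsub), hsub.trans fun x hx => ⟨hm0.1.trans_le hx.1, hx.2.trans_lt hM0.2⟩⟩

lemma exists_isTest_integral_eq_one : ∃ θ : ℝ → ℝ, IsTest θ ∧ ∫ x in Ioo (0 : ℝ) 1, θ x = 1 := by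
  let f : ContDiffBump (1 / 2 : ℝ) := ⟨1 / 8, 1 / 4, by norm_num, by norm_num⟩
  have hs : tsupport f ⊆ Ioo 0 1 := by
    rw [f.tsupport_eq, Real.closedBall_eq_Icc]
    intro x hx
    change x ∈ Icc ((1 : ℝ) / 2 - 1 / 4) (1 / 2 + 1 / 4) at hx
    exact ⟨by linarith [hx.1], by linarith [hx.2]⟩
  have ht : IsTest f := ⟨f.contDiff, f.hasCompactSupport, hs⟩
  have hpos : 0 < ∫ x in Ioo (0 : ℝ) 1, f x := by
    rw [setIntegral_eq_integral_of_forall_compl_eq_zero fun x hx => ht.eq_zero hx]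
    exact f.integral_pos
  refine ⟨fun x => (∫ x in Ioo (0 : ℝ) 1, f x)⁻¹ * f x, ht.mul contDiffOn_const, ?_⟩
  rw [integral_const_mul, inv_mul_cancel₀ hpos.ne']

lemma IsTest.integrableOn_mul {F ψ : ℝ → ℝ} (hF : IntegrableOn F (Ioo 0 1)) (hψ : IsTest ψ) :
    IntegrableOn (fun x => F x * ψ x) (Ioo 0 1) := by
  obtain ⟨C, hC⟩ := hψ.exists_bound
  exact Integrable.mul_bdd (c := C) hF hψ.continuous.aestronglyMeasurable
    (Eventually.of_forall hC)

/-- The lemma of du Bois-Reymond: a function with vanishing distributional derivative is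
constant. -/
lemma exists_ae_eq_const {F : ℝ → ℝ} (hF : IntegrableOn F (Ioo 0 1))
    (h : ∀ ψ, IsTest ψ → ∫ x in Ioo (0 : ℝ) 1, F x * deriv ψ x = 0) :
    ∃ C : ℝ, ∀ᵐ x ∂(volume.restrict (Ioo (0 : ℝ) 1)), F x = C := by
  obtain ⟨θ, hθ, hθ1⟩ := exists_isTest_integral_eq_one
  set C := ∫ x in Ioo (0 : ℝ) 1, F x * θ x with hC
  refine ⟨C, ?_⟩
  have hint : ∀ {ψ : ℝ → ℝ}, IsTest ψ → IntegrableOn ψ (Ioo 0 1) := fun hψ =>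
    hψ.continuous.continuousOn.integrableOn_Icc.mono_set Ioo_subset_Icc_self
  have hFC : IntegrableOn (fun x => F x - C) (Ioo 0 1) :=
    hF.sub (integrableOn_const (by simp))
  have key : ∀ᵐ x, x ∈ Ioo (0 : ℝ) 1 → F x - C = 0 := by
    refine isOpen_Ioo.ae_eq_zero_of_integral_contDiff_smul_eq_zero hFC.locallyIntegrableOn ?_
    intro g hg hgc hgU
    have hgt : IsTest g := ⟨hg, hgc, hgU⟩
    set k := ∫ x in Ioo (0 : ℝ) 1, g x with hk
    -- `g - k θ` has mean value zero, hence it is the derivative of a test function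
    have hη : IsTest fun x => g x - k * θ x := by
      refine ⟨hg.sub (contDiff_const.mul hθ.1), hgc.sub hθ.2.1.mul_left, ?_⟩
      refine (tsupport_sub g _).trans (union_subset hgU ?_)
      exact (tsupport_mul_subset_right).trans hθ.2.2
    have hη0 : ∫ x in Ioo (0 : ℝ) 1, (g x - k * θ x) = 0 := by
      rw [integral_sub (hint hgt) ((hint hθ).const_mul k), integral_const_mul, hθ1, mul_one,
        sub_self]
    have h1 := h _ (isTest_primitive hη hη0)
    have hd : deriv (fun x => ∫ t in (0 : ℝ)..x, (g t - k * θ t)) = fun x => g x - k * θ x :=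
      funext fun x => (intervalIntegral.integral_hasDerivAt_right
        (hη.continuous.intervalIntegrable _ _) (hη.continuous.stronglyMeasurableAtFilter _ _)
        hη.continuous.continuousAt).deriv
    rw [hd] at h1
    have i1 := hgt.integrableOn_mul hF
    have i2 := hθ.integrableOn_mul hF
    have e1 : ∫ x in Ioo (0 : ℝ) 1, F x * (g x - k * θ x) =
        (∫ x in Ioo (0 : ℝ) 1, F x * g x) - k * C := by
      rw [hC, ← integral_const_mul, ← integral_sub i1 (i2.const_mul k)]
      exact integral_congr_ae (Eventually.of_forall fun x => by ring)
    have e2 : ∫ x, g x • (F x - C) = ∫ x in Ioo (0 : ℝ) 1, g x • (F x - C) :=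
      (setIntegral_eq_integral_of_forall_compl_eq_zero fun x hx => by
        rw [hgt.eq_zero hx, zero_smul]).symm
    have e3 : ∫ x in Ioo (0 : ℝ) 1, g x • (F x - C) =
        (∫ x in Ioo (0 : ℝ) 1, F x * g x) - C * k := by
      rw [hk, ← integral_const_mul, ← integral_sub i1 ((hint hgt).const_mul C)]
      refine integral_congr_ae (Eventually.of_forall fun x => ?_)
      simp only [smul_eq_mul]
      ring
    rw [e2, e3]
    rw [e1] at h1
    linarith
  rw [ae_restrict_iff' measurableSet_Ioo]
  filter_upwards [key] with x hx hx' using sub_eq_zero.1 (hx hx')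

lemma integrableOn_twoAbel {α : ℝ} (hα : α < 2) (r : ℝ) {f : ℝ → ℝ}
    (hf : IntegrableOn f (Ioo 0 1)) : IntegrableOn (twoAbel α r f) (Ioo 0 1) := by
  have h1 := integrableOn_comp_one_sub (integrableOn_leftAbel hα (integrableOn_comp_one_sub hf))
  refine ((integrableOn_leftAbel hα hf).const_mul r).add ((h1.const_mul (1 - r)).congr ?_)
  exact Eventually.of_forall fun x => by simp only [rightAbel_eq_leftAbel]

/-- Fubini's theorem for the pairing of the flux of an absolutely continuous function with a
polynomial times the weight: since the two-sided Abel integral of the weight is bounded, it suffices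
that `f` is integrable. -/
lemma Params.integral_twoAbel_mul_wPoly {a b r : ℝ} (P : Params a b r) {f : ℝ → ℝ}
    (hf : IntegrableOn f (Ioo 0 1)) (p : Polynomial ℝ) :
    ∫ x in Ioo (0 : ℝ) 1, twoAbel (a + b) r f x * wPoly b a p x =
      ∫ x in Ioo (0 : ℝ) 1, f x * twoAbel (a + b) (1 - r) (wPoly b a p) x := by
  refine integral_twoAbel_mul (integrable_abelKernel_reflect ?_) ?_
  · have h := P.integrable_abelKernel_wPoly (p.comp (1 - Polynomial.X))
      (integrableOn_comp_one_sub hf)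
    rw [← wPoly_one_sub] at h
    exact h
  · simpa only [add_comm b a] using P.symm.integrable_abelKernel_wPoly p hf

/-- An absolutely continuous function that vanishes at the endpoints and satisfies `L_r^α u = 0` in
the sense of distributions has constant flux. Testing this with `ρ^{(b,a)} G_n^{(b,a)}` shows that
`u` is orthogonal to all polynomials. -/
theorem Params.eqOn_zero_of_integral_fracOp {a b r : ℝ} (P : Params a b r) {u : ℝ → ℝ}
    (hu : AbsolutelyContinuousOnInterval u 0 1) (hu0 : u 0 = 0) (hu1 : u 1 = 0)
    (h : ∀ ψ, IsTest ψ → ∫ x in Ioo (0 : ℝ) 1, u x * fracOp (a + b) (1 - r) ψ x = 0) :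
    EqOn u 0 (Icc 0 1) := by
  have hΓ : Real.Gamma (2 - (a + b)) ≠ 0 :=
    (Real.Gamma_pos_of_pos (by linarith [P.lt_two])).ne'
  have hi := integrableOn_deriv_of_absolutelyContinuous hu
  have hui := integrableOn_of_absolutelyContinuous hu
  obtain ⟨C, hC⟩ := exists_ae_eq_const
    ((integrableOn_twoAbel P.lt_two r hi).const_mul (1 / Real.Gamma (2 - (a + b)))) fun ψ hψ => by
      have h1 := (integral_flux_mul_deriv P.lt_two hu hu0 hu1 hψ).trans (h ψ hψ)
      rw [intervalIntegral.integral_of_le zero_le_one, integral_Ioc_eq_integral_Ioo] at h1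
      refine (integral_congr_ae (Eventually.of_forall fun x => ?_)).trans h1
      simp only [leftFlux_eq, rightFlux_eq, twoAbel]
      ring
  have hzero : ∀ᵐ x ∂(volume.restrict (Ioo (0 : ℝ) 1)), u x = 0 := by
    refine ae_eq_zero_of_integral_mul_jacobiPoly (a := a) (b := b) (by linarith [P.one_lt]) hui
      fun n => ?_
    set p := jacobiPoly b a n with hp
    obtain ⟨F, -, -, hFl, hF⟩ := P.symm.exists_fracOp_rho_mul (jacobiPoly_natDegree_le b a n)
    rw [← hp] at hFl hF
    -- the constant flux pairs to zero with the derivative of `ρ^{(b,a)} p`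
    have e1 : ∫ x in Ioo (0 : ℝ) 1, wPoly b a (polyDiff b a p) x = 0 := by
      have h1 := integral_wPoly_polyDiff P.b_pos P.a_pos p (x := 1) ⟨zero_le_one, le_rfl⟩
      rwa [rho_one P.b_pos.ne', zero_mul, intervalIntegral.integral_of_le zero_le_one,
        integral_Ioc_eq_integral_Ioo] at h1
    have e2 : ∫ x in Ioo (0 : ℝ) 1, 1 / Real.Gamma (2 - (a + b)) *
        (twoAbel (a + b) r (deriv u) x * wPoly b a (polyDiff b a p) x) = 0 := by
      refine (integral_congr_ae (g := fun x => C * wPoly b a (polyDiff b a p) x) ?_).trans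
        (by rw [integral_const_mul, e1, mul_zero])
      filter_upwards [hC] with x hx
      rw [← mul_assoc, hx]
    -- by Fubini the flux operator moves to `ρ^{(b,a)} p`, whose flux is the polynomial `F`
    rw [integral_const_mul, P.integral_twoAbel_mul_wPoly hi, ← integral_const_mul] at e2
    have e3 : ∫ x in Ioo (0 : ℝ) 1, deriv u x * F.eval x = 0 := by
      refine (setIntegral_congr_fun measurableSet_Ioo fun x hx => ?_).trans e2
      simp only [← hFl x hx, add_comm b a]
      ring
    rw [integral_deriv_mul_eval hu hu0 hu1, ← integral_neg] at e3
    have e4 : eigen b a (1 - r) n * ∫ x in Ioo (0 : ℝ) 1, u x * (jacobiPoly a b n).eval x = 0 := by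
      rw [← integral_const_mul]
      refine (setIntegral_congr_fun measurableSet_Ioo fun x hx => ?_).trans e3
      have h1 := hF x hx
      rw [hp, P.symm.fracOp_jacobiPoly n hx, Polynomial.eval_neg] at h1
      linear_combination u x * h1
    exact (mul_eq_zero.1 e4).resolve_left (P.symm.eigen_pos n).ne'
  have hcont := hu.continuousOn
  rw [uIcc_of_le zero_le_one] at hcont
  have hIcc : u =ᵐ[volume.restrict (Icc (0 : ℝ) 1)] 0 := by
    rw [← Measure.restrict_congr_set Ioo_ae_eq_Icc]
    exact hzero
  exact Measure.eqOn_Icc_of_ae_eq volume zero_ne_one hIcc hcont continuousOn_const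

/-! ### Existence of the solution -/

lemma pairs_unique {t : Bool} {s a b : ℝ} {F : SobAux t s a b} {g : ℝ → ℝ} {c c' : ℝ}
    (h : Pairs F g c) (h' : Pairs F g c') : c = c' := by
  cases t with
  | true => exact h.2.symm.trans h'.2
  | false =>
    obtain ⟨w, hw, rfl⟩ := h
    obtain ⟨w', hw', rfl⟩ := h'
    have : w = w' := Subtype.ext (show w.toL2 = w'.toL2 from Lp.ext (hw.trans hw'.symm))
    rw [this]

lemma IsSolution.eqOn {a b r : ℝ} (P : Params a b r) {t : Bool} {s : ℝ} {f : SobAux t s b a}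
    {u u' : ℝ → ℝ} (hu : IsSolution (a + b) r f u) (hu' : IsSolution (a + b) r f u') :
    EqOn u' u (Icc 0 1) := by
  have hint : ∀ {u : ℝ → ℝ}, AbsolutelyContinuousOnInterval u 0 1 → ∀ ψ, IsTest ψ →
      IntegrableOn (fun x => u x * fracOp (a + b) (1 - r) ψ x) (Ioo 0 1) := by
    intro u hu ψ hψ
    have hc : Continuous (testTwoAbel (a + b) (1 - r) (deriv (deriv ψ))) :=
      hψ.deriv.deriv.continuous_testTwoAbel P.lt_two
    have h1 := hu.continuousOn
    rw [uIcc_of_le zero_le_one] at h1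
    have h2 := (h1.mul (continuous_const (y := 1 / Real.Gamma (2 - (a + b))) |>.mul
      hc |>.neg).continuousOn).integrableOn_Icc.mono_set (μ := volume) Ioo_subset_Icc_self
    refine h2.congr_fun (fun x hx => ?_) measurableSet_Ioo
    rw [hψ.fracOp_eq P.lt_two hx]
    rfl
  have key := P.eqOn_zero_of_integral_fracOp
    (hu'.absolutelyContinuous.sub hu.absolutelyContinuous)
    (by simp [hu.left, hu'.left]) (by simp [hu.right, hu'.right]) fun ψ hψ => by
      obtain ⟨c, hc, e⟩ := hu.equation ψ hψ
      obtain ⟨c', hc', e'⟩ := hu'.equation ψ hψ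
      rw [integral_flux_mul_deriv P.lt_two hu.absolutelyContinuous hu.left hu.right hψ] at e
      rw [integral_flux_mul_deriv P.lt_two hu'.absolutelyContinuous hu'.left hu'.right hψ] at e'
      simp only [Pi.sub_apply, sub_mul]
      rw [integral_sub (hint hu'.absolutelyContinuous ψ hψ) (hint hu.absolutelyContinuous ψ hψ),
        e, e', pairs_unique hc hc', sub_self]
  exact fun x hx => sub_eq_zero.1 (key hx)

/-- For `s + α ≥ 1` the function `u = ρ^{(a,b)} φ` is absolutely continuous, and the equation by
transposition is the equation in the sense of distributions. -/
theorem Params.exists_isSolution {a b r : ℝ} (P : Params a b r) {s σ : ℝ} (hσ : 1 ≤ σ) {t : Bool}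
    {φ : SobAux true σ a b} {f : SobAux t s b a} (hφ : FracEq (a + b) r φ f) :
    ∃ u h : ℝ → ℝ, IsSolution (a + b) r f u ∧ IsFunction φ h ∧
      ∀ x ∈ Ioo (0 : ℝ) 1, u x = rho a b x * h x := by
  set v : WL2 a b := PosSpace.toL2 φ with hv
  have hmem : v ∈ posSubmodule 1 a b := by
    refine Summable.of_nonneg_of_le (fun j => by positivity) (fun j => ?_)
      (show Summable fun j : ℕ => (1 + (j : ℝ) ^ 2) ^ σ * coeff a b j v ^ 2 from φ.2)
    have h1 : (1 : ℝ) ≤ 1 + (j : ℝ) ^ 2 := by nlinarith [sq_nonneg (j : ℝ)]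
    exact mul_le_mul_of_nonneg_right (Real.rpow_le_rpow_of_exponent_le h1 hσ) (sq_nonneg _)
  obtain ⟨u, hAC, hu0, hu1, hu⟩ := exists_primitive_eq_rho_mul P.a_pos P.b_pos P.lt_two.le hmem
  refine ⟨u, fun x => u x / rho a b x, ⟨hAC, hu0, hu1, fun ψ hψ => ?_⟩, ?_, fun x hx =>
    (mul_div_cancel₀ _ (rho_pos hx).ne').symm⟩
  · obtain ⟨c, hc, hc'⟩ := hφ _ (Or.inl (hψ.div_rho b a))
    rw [hψ.rho_mul_div] at hc'
    refine ⟨c, hc, ?_⟩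
    rw [integral_flux_mul_deriv P.lt_two hAC hu0 hu1 hψ, ← hc'.2, integral_wMeasure]
    refine integral_congr_ae ?_
    filter_upwards [hu] with x hx
    rw [hx, mul_assoc]
  · refine (ae_wMeasure_iff a b _).2 ?_
    filter_upwards [hu, ae_restrict_mem measurableSet_Ioo] with x hx hx'
    rw [hx, mul_div_cancel_left₀ _ (rho_pos hx').ne']

/-! ### The condition on the parameters -/

lemma ConditionA.params {α r β : ℝ} (hα : 1 < α) (hα' : α < 2) (hr : 0 ≤ r) (hr' : r ≤ 1)
    (h : ConditionA α r β) : Params (α - β) β r := by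
  have hβ : 0 < β := by linarith [h.lower]
  have ha : 0 < α - β := by linarith [h.upper]
  have ha1 : α - β ≤ 1 := by linarith [h.lower]
  have hπ := Real.pi_pos
  have nonneg : ∀ {c : ℝ}, 0 < c → c ≤ 1 → 0 ≤ Real.sin (Real.pi * c) := fun h0 h1 =>
    Real.sin_nonneg_of_nonneg_of_le_pi (by positivity) (by nlinarith)
  have pos : ∀ {c : ℝ}, 0 < c → c < 1 → 0 < Real.sin (Real.pi * c) := fun h0 h1 =>
    Real.sin_pos_of_pos_of_lt_pi (by positivity) (by nlinarith)
  -- `α < 2` excludes that both exponents are equal to one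
  have hden : Real.sin (Real.pi * (α - β)) + Real.sin (Real.pi * β) ≠ 0 := by
    rcases lt_or_eq_of_le h.upper with h1 | h1
    · exact (add_pos_of_nonneg_of_pos (nonneg ha ha1) (pos hβ h1)).ne'
    · exact (add_pos_of_pos_of_nonneg (pos ha (by linarith)) (nonneg hβ h.upper)).ne'
  refine ⟨ha, ha1, hβ, h.upper, by linarith, by linarith, hr, hr', ?_⟩
  have := h.eq
  rw [eq_div_iff hden] at this
  linear_combination this

end FracDiff

end

theorem mainTheorem3 (α r β : ℝ) (hα : 1 < α) (hα' : α < 2) (hr : 0 ≤ r) (hr' : r ≤ 1)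
    (hβ : FracDiff.ConditionA α r β) (s : ℝ) :
    (∃ T : FracDiff.Sob (s + α) (α - β) β ≃L[ℝ] FracDiff.Sob s β (α - β),
      ∀ (φ : FracDiff.Sob (s + α) (α - β) β) (f : FracDiff.Sob s β (α - β)),
        T φ = f ↔ FracDiff.FracEq α r φ f) ∧
    (∃ C : ℝ, ∀ f : FracDiff.Sob s β (α - β),
      (∃! φ : FracDiff.Sob (s + α) (α - β) β, FracDiff.FracEq α r φ f) ∧
      ∀ φ : FracDiff.Sob (s + α) (α - β) β, FracDiff.FracEq α r φ f → ‖φ‖ ≤ C * ‖f‖) ∧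
    (1 ≤ s + α → ∃ C : ℝ, ∀ f : FracDiff.Sob s β (α - β),
      ∃ (u : ℝ → ℝ) (φ : FracDiff.Sob (s + α) (α - β) β) (h : ℝ → ℝ),
        FracDiff.IsSolution α r f u ∧
        (∀ u' : ℝ → ℝ, FracDiff.IsSolution α r f u' → EqOn u' u (Icc 0 1)) ∧
        FracDiff.IsFunction φ h ∧
        (∀ x ∈ Ioo (0 : ℝ) 1, u x = FracDiff.rho (α - β) β x * h x) ∧
        FracDiff.FracEq α r φ f ∧ ‖φ‖ ≤ C * ‖f‖) := by
  have P := hβ.params hα hα' hr hr'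
  obtain ⟨a, rfl⟩ : ∃ a, α = a + β := ⟨α - β, by ring⟩
  rw [add_sub_cancel_right] at P ⊢
  unfold FracDiff.Sob
  -- the index of the space of functions or functionals, with any decision procedure
  generalize ht : @decide (0 ≤ s + (a + β)) _ = t
  generalize ht' : @decide (0 ≤ s) _ = t'
  have ht1 : t = decide (0 ≤ s + (a + β)) := by rw [← ht]
  have ht2 : t' = decide (0 ≤ s) := by rw [← ht']
  clear ht ht'
  obtain ⟨T, hT⟩ := P.exists_solution_equiv s ht1 ht2
  obtain ⟨C, hC⟩ : ∃ C : ℝ, ∀ φ f, FracDiff.FracEq (a + β) r φ f → ‖φ‖ ≤ C * ‖f‖ := by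
    let S : FracDiff.SobAux t' s β a →L[ℝ] FracDiff.SobAux t (s + (a + β)) a β := T.symm
    refine ⟨‖S‖, fun φ f h => ?_⟩
    have h1 : S f = φ := by rw [← (hT φ f).2 h]; exact T.symm_apply_apply φ
    rw [← h1]
    exact S.le_opNorm f
  have sol : ∀ f, FracDiff.FracEq (a + β) r (T.symm f) f := fun f =>
    (hT _ _).1 (T.apply_symm_apply f)
  refine ⟨⟨T, hT⟩, ⟨C, fun f => ⟨⟨T.symm f, sol f, fun φ h => ?_⟩, fun φ => hC φ f⟩⟩,
    fun hs => ⟨C, fun f => ?_⟩⟩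
  · rw [← (hT φ f).2 h, T.symm_apply_apply]
  · have hb := hC _ f (sol f)
    have hsol := sol f
    generalize T.symm f = φ at hb hsol
    obtain rfl : t = true := by rw [ht1]; simp; linarith
    obtain ⟨u, h, hu, hφ, hh⟩ := P.exists_isSolution hs hsol
    exact ⟨u, φ, h, hu, fun u' hu' => hu.eqOn P hu', hφ, hh, hsol, hb⟩
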